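/- Let $N\ge 1$ and $k\ge 2$ be integers and let $\lambda_1,\dots,\lambda_N\ge 0$ with $\lambda:=\sum_i\lambda_i>0$. For every node $i\in\{1,\dots,N\}$ let $D_i$ be the law of a random vector of delays with values in $[0,\infty)^N$ whose $i$-th component is almost surely $0$; its $j$-th marginal $\Delta_i(j)$ is the law of the delay from node $i$ to node $j$. Blocks $1,2,\dots$ are issued at the points $0<t_1<t_2<\cdots$ of a Poisson process of intensity $\lambda$ on $[0,\infty)$; block $0$ is the genesis, which is visible to all nodes from time $t_0=0$ on. Block $n\ge1$ is issued by a random node $\mathrm{nodeID}_n$, equal to $i$ with probability $\lambda_i/\lambda$; given $\mathrm{nodeID}_n=i$, its delay vector $\mathrm{delay}_n=(\mathrm{delay}_n(j))_{j}$ has law $D_i$. The waiting time $t_n-t_{n-1}$ is independent of $(\mathrm{nodeID}_n,\mathrm{delay}_n)$, and the three together are independent of all data (times, issuers, delays, references) of the blocks $1,\dots,n-1$. Block $n$ references a $k$-tuple $\mathrm{Ref}_n$ of earlier blocks which, given all data of the blocks $1,\dots,n-1$ and $(t_n,\mathrm{nodeID}_n,\mathrm{delay}_n)$, is sampled uniformly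 with replacement from $\mathrm{pool}_n(\mathrm{nodeID}_n)$. Here the local tip pool $\mathrm{pool}_n(i)$ of node $i$ at time $t_n$ is the set of the genesis and of all blocks $m\ge1$ with $t_m+\mathrm{delay}_m(i)<t_n$, minus all blocks that are referenced by some block $m\ge1$ with $t_m+\mathrm{delay}_m(i)<t_n$. The observer tip pool $\mathrm{pool}^{(o)}_n$ is the set of the blocks $0,\dots,n$ that are not referenced by any of the blocks $1,\dots,n$. Put $X^{(i)}_n=|\mathrm{pool}_n(i)|$ and $X^{(o)}_n=|\mathrm{pool}^{(o)}_n|$. Assume partial synchronicity: there is $\Delta<\infty$ such that for all $i,j$ the delay from $i$ to $j$ is almost surely at most $\Delta$. Then there are constants $\mu^{(o)},\mu^{(1)},\dots,\mu^{(N)}\in\mathbb R$ such that, as $n\to\infty$, $$\frac1n\sum_{m=1}^n X^{(o)}_m\to\mu^{(o)}\qquad\text{and}\qquad \frac1n\sum_{m=1}^n X^{(i)}_m\to\mu^{(i)}\quad\text{for all } i\in\{1,\dots,N\},$$ almost surely and in $L^2$. Moreover, $X^{(o)}_n$ and, for every $i$, $X^{(i)}_n$ converge in distribution to some real random variables $X^{(o)}$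 and $X^{(i)}$. -/

import Mathlib

open MeasureTheory ProbabilityTheory Filter Topology
open scoped NNReal ENNReal

noncomputable section

namespace Ledger

/-- The data of a marked point process of blocks on a ledger with `N` nodes and `k` references per
block. The genesis is block `0`; for `n ≥ 1` the `n`-th block is issued at time `time n` by node
`issuer n`, it reaches node `j` after the delay `delay n j`, and it references the blocks
`ref n 0, …, ref n (k - 1)`. A block is identified by its index. The marks `issuer 0`, `delay 0` and
`ref 0` carry no meaning and are not used. -/
structure BlockProcess (Ω : Type*) (N k : ℕ) where
  time : ℕ → Ω → ℝ
  issuer : ℕ → Ω → Fin N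
  delay : ℕ → Ω → Fin N → ℝ≥0
  ref : ℕ → Ω → Fin k → ℕ

namespace BlockProcess

variable {Ω : Type*} {N k : ℕ}

/-- The references of block `m`, as a set. -/
def refSet (ξ : BlockProcess Ω N k) (m : ℕ) (ω : Ω) : Finset ℕ :=
  Finset.univ.image (ξ.ref m ω)

open Classical in
/-- The issued blocks (without the genesis) that node `i` has received strictly before time `t_n`.
Since delays are nonnegative and issuance times are nondecreasing, only blocks of index less
than `n` can satisfy `t_m + delay_m(i) < t_n`. -/
def received (ξ : BlockProcess Ω N k) (n : ℕ) (i : Fin N) (ω : Ω) : Finset ℕ :=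
  {m ∈ Finset.Ico 1 n | ξ.time m ω + (ξ.delay m ω i : ℝ) < ξ.time n ω}

/-- The blocks visible to node `i` at time `t_n`; the genesis is visible to all nodes. -/
def visBlocks (ξ : BlockProcess Ω N k) (n : ℕ) (i : Fin N) (ω : Ω) : Finset ℕ :=
  insert 0 (ξ.received n i ω)

/-- The references visible to node `i` at time `t_n`. -/
def visRef (ξ : BlockProcess Ω N k) (n : ℕ) (i : Fin N) (ω : Ω) : Finset ℕ :=
  (ξ.received n i ω).biUnion fun m => ξ.refSet m ω

/-- The local tip pool of node `i` at time `t_n`. -/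
def localPool (ξ : BlockProcess Ω N k) (n : ℕ) (i : Fin N) (ω : Ω) : Finset ℕ :=
  ξ.visBlocks n i ω \ ξ.visRef n i ω

/-- The tip pool of the perfect observer at time `t_n`: all blocks up to block `n` (including the
genesis) that none of the blocks `1, …, n` references. -/
def observerPool (ξ : BlockProcess Ω N k) (n : ℕ) (ω : Ω) : Finset ℕ :=
  Finset.Icc 0 n \ (Finset.Icc 1 n).biUnion fun m => ξ.refSet m ω

/-- The size of the local tip pool of node `i` at time `t_n`. -/
def localSize (ξ : BlockProcess Ω N k) (i : Fin N) (n : ℕ) (ω : Ω) : ℝ :=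
  ((ξ.localPool n i ω).card : ℝ)

/-- The size of the tip pool of the perfect observer at time `t_n`. -/
def observerSize (ξ : BlockProcess Ω N k) (n : ℕ) (ω : Ω) : ℝ :=
  ((ξ.observerPool n ω).card : ℝ)

/-- The marks of block `n + 1` other than its references, with the issuance time recorded
as the waiting time since the issuance of block `n`. -/
def newMark (ξ : BlockProcess Ω N k) (n : ℕ) (ω : Ω) : ℝ × Fin N × (Fin N → ℝ≥0) :=
  (ξ.time (n + 1) ω - ξ.time n ω, ξ.issuer (n + 1) ω, ξ.delay (n + 1) ω)

/-- The σ-algebra generated by the blocks `1, …, n` with their times and all their marks. -/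
abbrev history (ξ : BlockProcess Ω N k) (n : ℕ) : MeasurableSpace Ω :=
  ⨆ m ∈ Finset.Icc 1 n, MeasurableSpace.comap
    (fun ω => (ξ.time m ω, ξ.issuer m ω, ξ.delay m ω, ξ.ref m ω)) inferInstance

end BlockProcess

/-- The law of the marks (issuing node, delay vector) of a block: the issuer is node `i` with
probability `rate i / ∑ j, rate j`, and given that, the delay vector has law `D i`. -/
def issuerDelayLaw {N : ℕ} (rate : Fin N → ℝ≥0) (D : Fin N → Measure (Fin N → ℝ≥0)) :
    Measure (Fin N × (Fin N → ℝ≥0)) :=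
  ∑ i, ((rate i / ∑ j, rate j : ℝ≥0) : ℝ≥0∞) • (Measure.dirac i).prod (D i)

/-- `ξ` is, under `P`, the block process of a ledger with issuance rates `rate` and with delay
vector of law `D i` for the blocks issued by node `i`. -/
structure IsBlockProcess {Ω : Type*} [MeasurableSpace Ω] {N k : ℕ} (ξ : BlockProcess Ω N k)
    (P : Measure Ω) (rate : Fin N → ℝ≥0) (D : Fin N → Measure (Fin N → ℝ≥0)) : Prop where
  measurable_time : ∀ n, Measurable (ξ.time n)
  measurable_issuer : ∀ n, Measurable (ξ.issuer n)
  measurable_delay : ∀ n, Measurable (ξ.delay n)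
  measurable_ref : ∀ n, Measurable (ξ.ref n)
  /-- The process starts at time `0` with the genesis. -/
  time_zero : ∀ ω, ξ.time 0 ω = 0
  /-- Blocks are issued at the points of a Poisson process whose intensity is the total rate,
  with independent marks (issuer, delay vector) of the prescribed law, -/
  map_newMark : ∀ n, P.map (ξ.newMark n) =
    (expMeasure ((∑ j, rate j : ℝ≥0) : ℝ)).prod (issuerDelayLaw rate D)
  /-- and the waiting time, the issuer and the delays of a new block are independent of the past
  (including the references of the earlier blocks). -/
  indep_newMark : ∀ n,
    Indep (MeasurableSpace.comap (ξ.newMark n) inferInstance) (ξ.history n) P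
  /-- Given the past and the time, the issuer and the delays of the new block, its `k` references
  are sampled uniformly with replacement from the local tip pool of its issuer. -/
  ref_uniform : ∀ (n : ℕ) (r : Fin k → ℕ),
    P⟦ξ.ref (n + 1) ⁻¹' {r} |
        ξ.history n ⊔ MeasurableSpace.comap (ξ.newMark n) inferInstance⟧
      =ᵐ[P] fun ω => ∏ l : Fin k,
        if r l ∈ ξ.localPool (n + 1) (ξ.issuer (n + 1) ω) ω then
          ((ξ.localPool (n + 1) (ξ.issuer (n + 1) ω) ω).card : ℝ)⁻¹ else 0

/-- Admissible families of delay laws: each `D i` is the law of a random vector of nonnegative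
delays, and a node has no delay to itself. The law of the delay from `i` to `j` is
the `j`-th marginal of `D i`; the components may be independent or not. -/
structure IsDelayLaw {N : ℕ} (D : Fin N → Measure (Fin N → ℝ≥0)) : Prop where
  isProbabilityMeasure : ∀ i, IsProbabilityMeasure (D i)
  self_eq_zero : ∀ i, ∀ᵐ d ∂(D i), d i = 0

/-- Partial synchronicity: some finite constant bounds all delays almost surely. -/
def PartiallySynchronous {N : ℕ} (D : Fin N → Measure (Fin N → ℝ≥0)) : Prop :=
  ∃ Δ : ℝ≥0, ∀ i j, ∀ᵐ d ∂(D i), d j ≤ Δ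

/-- The time average `(1/n) ∑_{m=1}^n X_m`. -/
def timeAverage {Ω : Type*} (X : ℕ → Ω → ℝ) (n : ℕ) (ω : Ω) : ℝ :=
  (1 / (n : ℝ)) * ∑ m ∈ Finset.Icc 1 n, X m ω

/-- The time averages of `X` converge to the constant `c`, almost surely and in `L²`. -/
def TimeAveragesConverge {Ω : Type*} [MeasurableSpace Ω] (P : Measure Ω) (X : ℕ → Ω → ℝ)
    (c : ℝ) : Prop :=
  (∀ᵐ ω ∂P, Tendsto (fun n => timeAverage X n ω) atTop (𝓝 c)) ∧
  (∀ n, MemLp (timeAverage X n) 2 P) ∧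
  Tendsto (fun n => eLpNorm (fun ω => timeAverage X n ω - c) 2 P) atTop (𝓝 0)

/-- The real random variables `X n` converge in distribution to some real random variable. -/
def ConvergesInDistribution {Ω : Type*} [MeasurableSpace Ω] (P : Measure Ω)
    [IsProbabilityMeasure P] (X : ℕ → Ω → ℝ) : Prop :=
  ∃ (ν : Measure ℝ) (_ : IsProbabilityMeasure ν),
    TendstoInDistribution X atTop (id : ℝ → ℝ) (fun _ => P) ν

end Ledger

end

noncomputable section

namespace Ledger

/-! The pool sizes alone are not Markov: the next block depends on which recent blocks have reached
its issuer. The whole record of blocks is therefore taken as the state, and the proof finds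
regenerations in it. Suppose that the observer sees a single tip after block `s` and that the next
waiting time exceeds `Δ`. Then every node has received all blocks up to `s` before block `s + 1` is
issued, and block `s` is everybody's only tip and acts as a genesis. Exponential waiting times are
memoryless, so after subtracting `Δ` the later blocks form a fresh copy of the process, independent
of the first `s` blocks (`isLaw_shift`, `lintegral_regen`).

Regenerations are frequent. Let `L` be the number of observer tips and `A` the age, the number of
blocks since the last waiting time longer than `Δ`. Only these `A` blocks can still be in transit,
so a local pool misses at most `A` observer tips and has at most `k * A` extra elements. If `L` is
large and large compared with `A`, two references hit distinct observer tips with probability at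
least `3/4`, and `L` drops; otherwise it grows by at most one. Hence `x ^ L + B * y ^ A` is a
Lyapunov function (`exists_drift`). From at most `M` tips, `M - 1` long waits with well-chosen
references and one further long wait produce a regeneration (`exists_minorization`).

These two facts give geometric mixing by a Harris-type argument (`IsLyapunov.exists_mixing`). Take
two independent paths, one read with a lead of `n` blocks, and look for simultaneous regenerations
at the ends of periods of `M` blocks. After a simultaneous regeneration both have the same expected
future (`Observable.exists_coupling`); before it, a weighted Lyapunov function contracts in every
period (`IsLyapunov.uncoupled_succ`).

Mixing against the weight `1` makes means and point probabilities Cauchy, which gives convergence in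
distribution. Mixing against the weight `X n` makes covariances decay geometrically, which gives the
law of large numbers. The second moments come from a second Lyapunov function with base `x ^ 2`. -/

/-- The data (time, issuer, delays, references) of a block. -/
abbrev Block (N k : ℕ) := ℝ × Fin N × (Fin N → ℝ≥0) × (Fin k → ℕ)

/-- The space of sequences of blocks. -/
abbrev Path (N k : ℕ) := ℕ → Block N k

/-- Waiting time, issuer and delays of a new block. -/
abbrev Mark (N : ℕ) := ℝ × Fin N × (Fin N → ℝ≥0)

/-! ### The canonical path space; pools are functions of the recorded data. -/

variable {N k : ℕ}

/-- The coordinate process on the path space. -/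
def coord : BlockProcess (Path N k) N k where
  -- Forcing the genesis to time `0` makes entry `0` of a path irrelevant, so that truncated and
  -- shifted paths may carry arbitrary data there.
  time n h := if n = 0 then 0 else (h n).1
  issuer n h := (h n).2.1
  delay n h := (h n).2.2.1
  ref n h := (h n).2.2.2

namespace BlockProcess

/-- The path of the block data of a block process. -/
def path {Ω : Type*} (ξ : BlockProcess Ω N k) (ω : Ω) : Path N k :=
  fun n => (ξ.time n ω, ξ.issuer n ω, ξ.delay n ω, ξ.ref n ω)

section congr

variable {Ω Ω' : Type*} {ξ : BlockProcess Ω N k} {ξ' : BlockProcess Ω' N k}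
  {ω : Ω} {ω' : Ω'} {n : ℕ}

theorem received_congr (ht : ∀ m ≤ n, ξ.time m ω = ξ'.time m ω')
    (hd : ∀ m, 1 ≤ m → m < n → ξ.delay m ω = ξ'.delay m ω') (i : Fin N) :
    ξ.received n i ω = ξ'.received n i ω' := by
  classical
  ext m
  simp only [received, Finset.mem_filter, Finset.mem_Ico]
  refine and_congr_right fun hm => ?_
  rw [ht m hm.2.le, ht n le_rfl, hd m hm.1 hm.2]

theorem localPool_congr (ht : ∀ m ≤ n, ξ.time m ω = ξ'.time m ω')
    (hd : ∀ m, 1 ≤ m → m < n → ξ.delay m ω = ξ'.delay m ω')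
    (hr : ∀ m, 1 ≤ m → m < n → ξ.ref m ω = ξ'.ref m ω') (i : Fin N) :
    ξ.localPool n i ω = ξ'.localPool n i ω' := by
  classical
  have h1 := received_congr ht hd i
  have h2 : ξ.visRef n i ω = ξ'.visRef n i ω' := by
    rw [visRef, visRef, h1]
    refine Finset.biUnion_congr rfl fun m hm => ?_
    simp only [received, Finset.mem_filter, Finset.mem_Ico] at hm
    rw [refSet, refSet, hr m hm.1.1 hm.1.2]
  rw [localPool, localPool, visBlocks, visBlocks, h1, h2]

theorem observerPool_congr (hr : ∀ m, 1 ≤ m → m ≤ n → ξ.ref m ω = ξ'.ref m ω') :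
    ξ.observerPool n ω = ξ'.observerPool n ω' := by
  rw [observerPool, observerPool]
  congr 1
  refine Finset.biUnion_congr rfl fun m hm => ?_
  rw [Finset.mem_Icc] at hm
  rw [refSet, refSet, hr m hm.1 hm.2]

end congr

section mem

variable {Ω : Type*} {ξ : BlockProcess Ω N k} {ω : Ω} {n a : ℕ} {i : Fin N}

theorem mem_refSet {m : ℕ} : a ∈ ξ.refSet m ω ↔ ∃ l, ξ.ref m ω l = a := by
  simp [refSet]

theorem mem_received : a ∈ ξ.received n i ω ↔
    (1 ≤ a ∧ a < n) ∧ ξ.time a ω + (ξ.delay a ω i : ℝ) < ξ.time n ω := by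
  classical
  simp [received]

theorem mem_localPool : a ∈ ξ.localPool n i ω ↔
    (a = 0 ∨ a ∈ ξ.received n i ω) ∧ ∀ m ∈ ξ.received n i ω, ∀ l, ξ.ref m ω l ≠ a := by
  simp [localPool, visBlocks, visRef, mem_refSet]

theorem mem_observerPool : a ∈ ξ.observerPool n ω ↔
    a ≤ n ∧ ∀ m, 1 ≤ m → m ≤ n → ∀ l, ξ.ref m ω l ≠ a := by
  simp [observerPool, mem_refSet]

end mem

variable {Ω : Type*} (ξ : BlockProcess Ω N k)

theorem time_path (hξ : ∀ ω, ξ.time 0 ω = 0) (n : ℕ) (ω : Ω) :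
    coord.time n (ξ.path ω) = ξ.time n ω := by
  by_cases hn : n = 0
  · simp [coord, hn, hξ]
  · simp [coord, hn, path]

theorem localPool_path (hξ : ∀ ω, ξ.time 0 ω = 0) (n : ℕ) (i : Fin N) (ω : Ω) :
    coord.localPool n i (ξ.path ω) = ξ.localPool n i ω :=
  localPool_congr (fun _ _ => time_path ξ hξ _ _) (fun _ _ _ => rfl) (fun _ _ _ => rfl) i

theorem observerPool_path (n : ℕ) (ω : Ω) :
    coord.observerPool n (ξ.path ω) = ξ.observerPool n ω :=
  observerPool_congr fun _ _ _ => rfl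

end BlockProcess

open BlockProcess

/-! ### Measurability of the pools and their sizes. -/

section meas

@[fun_prop]
theorem measurable_coord_time (n : ℕ) : Measurable (coord (N := N) (k := k).time n) := by
  by_cases hn : n = 0
  · simp only [coord, hn, if_true]; fun_prop
  · simp only [coord, hn, if_false]; fun_prop

@[fun_prop]
theorem measurable_coord_issuer (n : ℕ) : Measurable (coord (N := N) (k := k).issuer n) := by
  simp only [coord]; fun_prop

@[fun_prop]
theorem measurable_coord_delay (n : ℕ) : Measurable (coord (N := N) (k := k).delay n) := by
  simp only [coord]; fun_prop

@[fun_prop]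
theorem measurable_coord_ref (n : ℕ) : Measurable (coord (N := N) (k := k).ref n) := by
  simp only [coord]; fun_prop

theorem measurableSet_ref_eq (m a : ℕ) (l : Fin k) :
    MeasurableSet {h : Path N k | coord.ref m h l = a} :=
  measurableSet_eq_fun (f := fun h : Path N k => coord.ref m h l) (by fun_prop) measurable_const

theorem measurableSet_mem_received (n a : ℕ) (i : Fin N) :
    MeasurableSet {h : Path N k | a ∈ coord.received n i h} := by
  simp only [mem_received]
  refine (MeasurableSet.const _).inter ?_
  exact measurableSet_lt (f := fun h : Path N k => coord.time a h + (coord.delay a h i : ℝ))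
    (by fun_prop) (by fun_prop)

theorem measurableSet_mem_localPool (n a : ℕ) (i : Fin N) :
    MeasurableSet {h : Path N k | a ∈ coord.localPool n i h} := by
  simp only [mem_localPool]
  refine MeasurableSet.inter ?_ ?_
  · exact (MeasurableSet.const _).union (measurableSet_mem_received n a i)
  · have : {h : Path N k | ∀ m ∈ coord.received n i h, ∀ l, coord.ref m h l ≠ a} =
        ⋂ m, ({h : Path N k | m ∈ coord.received n i h}ᶜ ∪
          ⋂ l, {h : Path N k | coord.ref m h l = a}ᶜ) := by
      ext h; simp [imp_iff_not_or]
    change MeasurableSet {h : Path N k | ∀ m ∈ coord.received n i h, ∀ l, coord.ref m h l ≠ a}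
    rw [this]
    exact MeasurableSet.iInter fun m => (measurableSet_mem_received n m i).compl.union
      (MeasurableSet.iInter fun l => (measurableSet_ref_eq m a l).compl)

theorem measurableSet_mem_observerPool (n a : ℕ) :
    MeasurableSet {h : Path N k | a ∈ coord.observerPool n h} := by
  simp only [mem_observerPool]
  refine (MeasurableSet.const _).inter ?_
  have : {h : Path N k | ∀ m, 1 ≤ m → m ≤ n → ∀ l, coord.ref m h l ≠ a} =
      ⋂ m, ⋂ (_ : 1 ≤ m), ⋂ (_ : m ≤ n), ⋂ l, {h : Path N k | coord.ref m h l = a}ᶜ := by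
    ext h; simp
  change MeasurableSet {h : Path N k | ∀ m, 1 ≤ m → m ≤ n → ∀ l, coord.ref m h l ≠ a}
  rw [this]
  exact MeasurableSet.iInter fun m => MeasurableSet.iInter fun _ => MeasurableSet.iInter fun _ =>
      MeasurableSet.iInter fun l => (measurableSet_ref_eq m a l).compl

/-- The cardinality of a random subset of `{0, …, n}` is measurable if membership is. -/
theorem measurable_card_of_mem {α : Type*} [MeasurableSpace α] {S : α → Finset ℕ} (n : ℕ)
    (hn : ∀ x, S x ⊆ Finset.range (n + 1)) (hS : ∀ a, MeasurableSet {x | a ∈ S x}) :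
    Measurable fun x => (S x).card := by
  classical
  have : (fun x => (S x).card) =
      fun x => ∑ a ∈ Finset.range (n + 1), Set.indicator {x | a ∈ S x} (fun _ => 1) x := by
    ext x
    rw [Finset.card_eq_sum_ones,
      ← Finset.sum_filter_add_sum_filter_not (Finset.range (n + 1)) (· ∈ S x)]
    have h1 : Finset.filter (· ∈ S x) (Finset.range (n + 1)) = S x := by
      ext a; simp only [Finset.mem_filter]; exact ⟨fun h => h.2, fun h => ⟨hn x h, h⟩⟩
    have h2 : ∑ a ∈ Finset.range (n + 1) with a ∉ S x,
        Set.indicator {x | a ∈ S x} (fun _ => 1) x = 0 :=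
      Finset.sum_eq_zero fun a ha => by simp only [Finset.mem_filter] at ha; simp [ha.2]
    rw [h1, h2, add_zero]
    exact Finset.sum_congr rfl fun a ha => by simp [ha]
  rw [this]
  exact Finset.measurable_sum _ fun a _ => measurable_const.indicator (hS a)

theorem localPool_subset {Ω : Type*} (ξ : BlockProcess Ω N k) (n : ℕ) (i : Fin N) (ω : Ω) :
    ξ.localPool n i ω ⊆ Finset.range (n + 1) := by
  intro a ha
  rw [mem_localPool, mem_received] at ha
  rw [Finset.mem_range]
  omega

theorem observerPool_subset {Ω : Type*} (ξ : BlockProcess Ω N k) (n : ℕ) (ω : Ω) :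
    ξ.observerPool n ω ⊆ Finset.range (n + 1) := by
  intro a ha
  rw [mem_observerPool] at ha
  rw [Finset.mem_range]
  omega

/-- The number of tips of the observer. -/
def tips (n : ℕ) (h : Path N k) : ℕ := (coord.observerPool n h).card

@[fun_prop]
theorem measurable_tips (n : ℕ) : Measurable (tips (N := N) (k := k) n) :=
  measurable_card_of_mem n (fun h => observerPool_subset _ n h) fun a =>
    measurableSet_mem_observerPool n a

/-- The number of local tips of node `i`. -/
def localTips (i : Fin N) (n : ℕ) (h : Path N k) : ℕ := (coord.localPool n i h).card

@[fun_prop]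
theorem measurable_localTips (i : Fin N) (n : ℕ) : Measurable (localTips (N := N) (k := k) i n) :=
  measurable_card_of_mem n (fun h => localPool_subset _ n i h) fun a =>
    measurableSet_mem_localPool n a i

end meas

/-! ### Truncating a path and appending one block. -/

section extend

variable [NeZero N]

/-- The first `n` blocks of a path. -/
def trunc (n : ℕ) (h : Path N k) : Path N k :=
  fun m => if 1 ≤ m ∧ m ≤ n then h m else (0, 0, 0, 0)

/-- The path whose first `n` blocks are those of `h`, and whose block `n + 1` has mark `z` and
references `r`. -/
def extend (n : ℕ) (h : Path N k) (z : Mark N) (r : Fin k → ℕ) : Path N k :=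
  Function.update (trunc n h) (n + 1) (coord.time n h + z.1, z.2.1, z.2.2, r)

@[fun_prop]
theorem measurable_trunc (n : ℕ) : Measurable (trunc (N := N) (k := k) n) := by
  refine measurable_pi_iff.2 fun m => ?_
  by_cases hm : 1 ≤ m ∧ m ≤ n
  · simp only [trunc, hm, and_self, if_true]; fun_prop
  · simp only [trunc, hm, if_false]; fun_prop

theorem trunc_trunc {n m : ℕ} (hnm : n ≤ m) (h : Path N k) : trunc n (trunc m h) = trunc n h := by
  ext1 a
  simp only [trunc]
  split_ifs with h1 h2
  · rfl
  · omega
  · rfl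

theorem coord_time_trunc {n m : ℕ} (hm : m ≤ n) (h : Path N k) :
    coord.time m (trunc n h) = coord.time m h := by
  by_cases h0 : m = 0
  · simp [coord, h0]
  · simp only [coord, h0, if_false, trunc]
    rw [if_pos (by omega)]

theorem trunc_apply {n m : ℕ} (h1 : 1 ≤ m) (hm : m ≤ n) (h : Path N k) :
    trunc n h m = h m := if_pos ⟨h1, hm⟩

theorem localPool_trunc {n m : ℕ} (hm : m ≤ n) (i : Fin N) (h : Path N k) :
    coord.localPool m i (trunc n h) = coord.localPool m i h :=
  localPool_congr (fun a ha => coord_time_trunc (ha.trans hm) h)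
    (fun a h1 ha => by simp only [coord, trunc_apply h1 (ha.le.trans hm)])
    (fun a h1 ha => by simp only [coord, trunc_apply h1 (ha.le.trans hm)]) i

theorem observerPool_trunc {n m : ℕ} (hm : m ≤ n) (h : Path N k) :
    coord.observerPool m (trunc n h) = coord.observerPool m h :=
  observerPool_congr (fun a h1 ha => by simp only [coord, trunc_apply h1 (ha.trans hm)])

theorem tips_trunc {n m : ℕ} (hm : m ≤ n) (h : Path N k) : tips m (trunc n h) = tips m h := by
  rw [tips, tips, observerPool_trunc hm]

theorem localTips_trunc {n m : ℕ} (hm : m ≤ n) (i : Fin N) (h : Path N k) :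
    localTips i m (trunc n h) = localTips i m h := by
  rw [localTips, localTips, localPool_trunc hm]

variable {n : ℕ} {h : Path N k} {z : Mark N} {r : Fin k → ℕ}

theorem trunc_extend {m : ℕ} (hm : m ≤ n) : trunc m (extend n h z r) = trunc m h := by
  ext1 a
  simp only [trunc, extend]
  split_ifs with h1
  · rw [Function.update_of_ne (by omega), trunc_apply h1.1 (by omega)]
  · rfl

theorem extend_trunc : extend n (trunc n h) z r = extend n h z r := by
  rw [extend, extend, trunc_trunc le_rfl, coord_time_trunc le_rfl]

theorem coord_time_extend : coord.time (n + 1) (extend n h z r) = coord.time n h + z.1 := by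
  simp [coord, extend]

theorem coord_time_extend_of_le {m : ℕ} (hm : m ≤ n) :
    coord.time m (extend n h z r) = coord.time m h := by
  rw [← coord_time_trunc hm, trunc_extend le_rfl, coord_time_trunc hm]

theorem coord_issuer_extend : coord.issuer (n + 1) (extend n h z r) = z.2.1 := by
  simp [coord, extend]

theorem coord_delay_extend : coord.delay (n + 1) (extend n h z r) = z.2.2 := by
  simp [coord, extend]

theorem coord_ref_extend : coord.ref (n + 1) (extend n h z r) = r := by
  simp [coord, extend]

theorem extend_apply_of_le {m : ℕ} (h1 : 1 ≤ m) (hm : m ≤ n) : extend n h z r m = h m := by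
  rw [extend, Function.update_of_ne (by omega), trunc_apply h1 hm]

theorem observerPool_extend_of_le {m : ℕ} (hm : m ≤ n) :
    coord.observerPool m (extend n h z r) = coord.observerPool m h := by
  rw [← observerPool_trunc hm, trunc_extend le_rfl, observerPool_trunc hm]

theorem tips_extend_of_le {m : ℕ} (hm : m ≤ n) : tips m (extend n h z r) = tips m h := by
  rw [tips, tips, observerPool_extend_of_le hm]

theorem trunc_succ_eq_extend (n : ℕ) (h : Path N k) :
    trunc (n + 1) h = extend n h (coord.newMark n h) (coord.ref (n + 1) h) := by
  ext1 a
  rw [extend]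
  by_cases ha : a = n + 1
  · subst ha
    rw [trunc_apply (by omega) le_rfl, Function.update_self]
    simp [newMark, coord]
  · rw [Function.update_of_ne ha, trunc, trunc]
    split_ifs <;> first | rfl | omega

/-- The tip pool from which block `n + 1` with mark `z` chooses its references. -/
def nextPool (n : ℕ) (h : Path N k) (z : Mark N) : Finset ℕ :=
  coord.localPool (n + 1) z.2.1 (extend n h z 0)

/-- A block never belongs to the set received by its own issuance time, so its references do not
influence the pool it samples from. The tuple `0` in `nextPool` is thus a mere placeholder. -/
theorem localPool_extend (i : Fin N) :
    coord.localPool (n + 1) i (extend n h z r) = coord.localPool (n + 1) i (extend n h z 0) := by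
  refine localPool_congr (fun m hm => ?_) (fun m h1 hm => ?_) (fun m h1 hm => ?_) i
  · rcases Nat.lt_or_ge n m with h2 | h2
    · obtain rfl : m = n + 1 := by omega
      rw [coord_time_extend, coord_time_extend]
    · rw [coord_time_extend_of_le h2, coord_time_extend_of_le h2]
  · simp only [coord]; rw [extend_apply_of_le h1 (by omega), extend_apply_of_le h1 (by omega)]
  · simp only [coord]; rw [extend_apply_of_le h1 (by omega), extend_apply_of_le h1 (by omega)]

theorem nextPool_trunc : nextPool n (trunc n h) z = nextPool n h z := by
  rw [nextPool, nextPool, extend_trunc]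

theorem nextPool_newMark (n : ℕ) (h : Path N k) :
    nextPool n h (coord.newMark n h) = coord.localPool (n + 1) (coord.issuer (n + 1) h) h := by
  rw [nextPool, ← localPool_extend (r := coord.ref (n + 1) h), ← trunc_succ_eq_extend,
    localPool_trunc le_rfl]
  rfl

theorem measurable_extend (n : ℕ) (r : Fin k → ℕ) :
    Measurable fun p : Path N k × Mark N => extend n p.1 p.2 r := by
  refine measurable_pi_iff.2 fun m => ?_
  by_cases hm : m = n + 1
  · subst hm
    simp only [extend, Function.update_self]
    exact (((measurable_coord_time n).comp measurable_fst).add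
      (measurable_fst.comp measurable_snd)).prodMk (by fun_prop)
  · simp only [extend, Function.update_of_ne hm]
    fun_prop

theorem measurableSet_mem_nextPool (n a : ℕ) :
    MeasurableSet {p : Path N k × Mark N | a ∈ nextPool n p.1 p.2} := by
  have : {p : Path N k × Mark N | a ∈ nextPool n p.1 p.2} =
      ⋃ i, ({p | p.2.2.1 = i} ∩ (fun p => extend n p.1 p.2 0) ⁻¹'
        {h | a ∈ coord.localPool (n + 1) i h}) := by
    ext p; simp [nextPool]
  rw [this]
  refine MeasurableSet.iUnion fun i => MeasurableSet.inter ?_ ?_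
  · exact measurableSet_eq_fun (f := fun p : Path N k × Mark N => p.2.2.1) (by fun_prop)
      measurable_const
  · exact measurable_extend n 0 (measurableSet_mem_localPool (n + 1) a i)

theorem measurable_card_nextPool (n : ℕ) :
    Measurable fun p : Path N k × Mark N => (nextPool n p.1 p.2).card :=
  measurable_card_of_mem (n + 1) (fun _ => localPool_subset coord (n + 1) _ _)
    (measurableSet_mem_nextPool n)

end extend

/-! ### Uniform sampling, the one-block transition operator, and laws determined by it. -/

section unif

/-- The probability that `k` uniform draws with replacement from `S` give the tuple `r`. -/
def unif (S : Finset ℕ) (r : Fin k → ℕ) : ℝ≥0∞ :=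
  ∏ l, if r l ∈ S then (S.card : ℝ≥0∞)⁻¹ else 0

theorem unif_of_mem {S : Finset ℕ} {r : Fin k → ℕ} (hr : ∀ l, r l ∈ S) :
    unif S r = ((S.card : ℝ≥0∞)⁻¹) ^ k := by
  simp [unif, hr]

theorem unif_of_notMem {S : Finset ℕ} {r : Fin k → ℕ} (hr : ¬ ∀ l, r l ∈ S) :
    unif S r = 0 := by
  push Not at hr
  obtain ⟨l, hl⟩ := hr
  exact Finset.prod_eq_zero (Finset.mem_univ l) (if_neg hl)

theorem tsum_unif_mul (S : Finset ℕ) (F : (Fin k → ℕ) → ℝ≥0∞) :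
    ∑' r, unif S r * F r =
      ∑ r ∈ Fintype.piFinset fun _ : Fin k => S, ((S.card : ℝ≥0∞)⁻¹) ^ k * F r := by
  rw [tsum_eq_sum (s := Fintype.piFinset fun _ : Fin k => S)]
  · refine Finset.sum_congr rfl fun r hr => ?_
    rw [unif_of_mem (Fintype.mem_piFinset.1 hr)]
  · intro r hr
    rw [unif_of_notMem (fun h => hr (Fintype.mem_piFinset.2 h)), zero_mul]

theorem tsum_unif {S : Finset ℕ} (hS : S.Nonempty) : ∑' r : Fin k → ℕ, unif S r = 1 := by
  have := tsum_unif_mul (k := k) S (fun _ => 1)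
  simp only [mul_one] at this
  rw [this, Finset.sum_const, Fintype.card_piFinset]
  simp only [Finset.prod_const, Finset.card_univ, Fintype.card_fin, nsmul_eq_mul, Nat.cast_pow]
  rw [← mul_pow, ENNReal.mul_inv_cancel, one_pow]
  · simpa using hS.ne_empty
  · simp

theorem tsum_unif_mul_const {S : Finset ℕ} (hS : S.Nonempty) (c : ℝ≥0∞) :
    ∑' r : Fin k → ℕ, unif S r * c = c := by
  rw [ENNReal.tsum_mul_right, tsum_unif hS, one_mul]

variable [NeZero N]

theorem measurable_unif_nextPool (n : ℕ) (r : Fin k → ℕ) :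
    Measurable fun p : Path N k × Mark N => unif (nextPool n p.1 p.2) r := by
  unfold unif
  refine Finset.measurable_prod _ fun l _ => ?_
  refine Measurable.ite (measurableSet_mem_nextPool (k := k) n (r l)) ?_ measurable_const
  exact (measurable_of_countable fun a : ℕ => (a : ℝ≥0∞)⁻¹).comp
    (measurable_card_nextPool (k := k) n)

/-- The transition operator from block `n` to block `n + 1`. -/
def step (ν : Measure (Mark N)) (n : ℕ) (Φ : Path N k → ℝ≥0∞) (h : Path N k) : ℝ≥0∞ :=
  ∫⁻ z, ∑' r, unif (nextPool n h z) r * Φ (extend n h z r) ∂ν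

theorem measurable_step_integrand (n : ℕ) {Φ : Path N k → ℝ≥0∞} (hΦ : Measurable Φ) :
    Measurable fun p : Path N k × Mark N =>
      ∑' r, unif (nextPool n p.1 p.2) r * Φ (extend n p.1 p.2 r) :=
  Measurable.tsum fun r =>
    (measurable_unif_nextPool n r).mul (hΦ.comp (measurable_extend n r))

theorem measurable_step (ν : Measure (Mark N)) [SFinite ν] (n : ℕ) {Φ : Path N k → ℝ≥0∞}
    (hΦ : Measurable Φ) : Measurable (step ν n Φ) :=
  (measurable_step_integrand n hΦ).lintegral_prod_right'

theorem step_trunc (ν : Measure (Mark N)) (n : ℕ) (Φ : Path N k → ℝ≥0∞) (h : Path N k) :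
    step ν n Φ (trunc n h) = step ν n Φ h := by
  simp only [step, nextPool_trunc, extend_trunc]

/-- A function on the path space depending on the first `n` blocks only. -/
structure Adapted (n : ℕ) (g : Path N k → ℝ≥0∞) : Prop where
  measurable : Measurable g
  trunc : ∀ h, g (trunc n h) = g h

theorem Adapted.mono {n m : ℕ} {g : Path N k → ℝ≥0∞} (hg : Adapted n g) (hnm : n ≤ m) :
    Adapted m g :=
  ⟨hg.measurable, fun h => by rw [← hg.trunc (Ledger.trunc m h), trunc_trunc hnm, hg.trunc]⟩

theorem Adapted.mul {n : ℕ} {g f : Path N k → ℝ≥0∞} (hg : Adapted n g) (hf : Adapted n f) :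
    Adapted n fun h => g h * f h :=
  ⟨hg.measurable.mul hf.measurable, fun h => by rw [hg.trunc, hf.trunc]⟩

theorem Adapted.const {n : ℕ} (c : ℝ≥0∞) : Adapted n fun _ : Path N k => c :=
  ⟨measurable_const, fun _ => rfl⟩

theorem Adapted.step (ν : Measure (Mark N)) [SFinite ν] {n : ℕ} {Φ : Path N k → ℝ≥0∞}
    (hΦ : Measurable Φ) : Adapted n (step ν n Φ) :=
  ⟨measurable_step ν n hΦ, step_trunc ν n Φ⟩

theorem Adapted.extend {n m : ℕ} {g : Path N k → ℝ≥0∞} (hg : Adapted m g) (hm : m ≤ n)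
    (h : Path N k) (z : Mark N) (r : Fin k → ℕ) : g (extend n h z r) = g h := by
  rw [← hg.trunc, trunc_extend hm, hg.trunc]

/-- Taking out what is known. -/
theorem step_mul_left (ν : Measure (Mark N)) [SFinite ν] {n : ℕ} {g Φ : Path N k → ℝ≥0∞}
    (hg : Adapted n g) (hΦ : Measurable Φ) (h : Path N k) :
    step ν n (fun h => g h * Φ h) h = g h * step ν n Φ h := by
  have hm : Measurable fun z => ∑' r, unif (nextPool n h z) r * Φ (Ledger.extend n h z r) := by
    have h1 := measurable_step_integrand n hΦ
    have h2 : Measurable fun z : Mark N => (h, z) := measurable_prodMk_left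
    have h3 := h1.comp h2
    simpa only [Function.comp_def] using h3
  refine Eq.trans (lintegral_congr fun z => ?_) (lintegral_const_mul (g h) hm)
  rw [← ENNReal.tsum_mul_left]
  refine tsum_congr fun r => ?_
  simp only [hg.extend le_rfl]
  ring

/-- `Q` is, up to normalization, the law of a block process with marks of law `ν`. -/
def IsLaw (ν : Measure (Mark N)) (Q : Measure (Path N k)) : Prop :=
  ∀ n Φ, Adapted (n + 1) Φ → ∫⁻ h, Φ h ∂Q = ∫⁻ h, step ν n Φ h ∂Q

/-- Blocks are peeled off one at a time with the transition operator until a constant remains; only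
the total mass of `Q` survives. Allowing unnormalized `Q` lets the result apply to the process
weighted by a regeneration event. -/
theorem IsLaw.lintegral_eq {ν : Measure (Mark N)} [SFinite ν] {P Q : Measure (Path N k)}
    [IsProbabilityMeasure P] (hP : IsLaw ν P) (hQ : IsLaw ν Q) (n : ℕ) :
    ∀ Φ, Adapted n Φ → ∫⁻ h, Φ h ∂Q = Q Set.univ * ∫⁻ h, Φ h ∂P := by
  induction n with
  | zero =>
    intro Φ hΦ
    have : Φ = fun _ => Φ (trunc 0 fun _ => (0, 0, 0, 0)) := by
      ext h
      rw [← hΦ.trunc]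
      congr 1
      ext1 m
      rw [trunc, trunc, if_neg (by omega), if_neg (by omega)]
    rw [this]
    simp [mul_comm]
  | succ n ih =>
    intro Φ hΦ
    rw [hP n Φ hΦ, hQ n Φ hΦ]
    exact ih _ (Adapted.step ν hΦ.measurable)

/-- This is the Markov property in weak form: integrating against all adapted weights `g` replaces
conditional expectations from here on. -/
theorem IsLaw.lintegral_mul {ν : Measure (Mark N)} [SFinite ν] {P : Measure (Path N k)}
    (hP : IsLaw ν P) {n : ℕ} {g Φ : Path N k → ℝ≥0∞} (hg : Adapted n g) (hΦ : Adapted (n + 1) Φ) :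
    ∫⁻ h, g h * Φ h ∂P = ∫⁻ h, g h * step ν n Φ h ∂P := by
  rw [hP n _ ((hg.mono n.le_succ).mul hΦ)]
  simp only [step_mul_left ν hg hΦ.measurable]

end unif

end Ledger

/-! ### The law of the given block process satisfies the transition recursion. -/

namespace Ledger

open BlockProcess

variable {N k : ℕ}

theorem unif_le_one (S : Finset ℕ) (r : Fin k → ℕ) : unif S r ≤ 1 := by
  refine Finset.prod_le_one' fun l _ => ?_
  split_ifs with h
  · rw [ENNReal.inv_le_one]
    exact_mod_cast Finset.card_pos.2 ⟨_, h⟩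
  · exact zero_le_one

/-- If the conditional probability of `A` given `m` is `w ∘ J`, then conditioning replaces the
indicator of `A` by `w ∘ J` in integrals of functions of `J`. -/
theorem setLIntegral_comp_eq_of_condExp {Ω β : Type*} [MeasurableSpace β] {m mΩ : MeasurableSpace Ω}
    {P : Measure Ω} [IsFiniteMeasure P] (hm : m ≤ mΩ) {A : Set Ω} (hA : MeasurableSet A)
    {J : Ω → β} (hJ : Measurable[m] J) {w : β → ℝ≥0∞} (hw : Measurable w) (hw1 : ∀ x, w x ≤ 1)
    (hc : P⟦A | m⟧ =ᵐ[P] fun ω => (w (J ω)).toReal) {F : β → ℝ≥0∞} (hF : Measurable F) :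
    ∫⁻ ω in A, F (J ω) ∂P = ∫⁻ ω, w (J ω) * F (J ω) ∂P := by
  have hJm : Measurable J := hJ.mono hm le_rfl
  have hwJ : Measurable fun ω => w (J ω) := hw.comp hJm
  -- The conditional probability is tested on the sets `J ⁻¹' E`, which lie in `m`. Equality of the
  -- two image measures then covers every measurable `F`, including those with infinite integral.
  have key : (P.restrict A).map J = (P.withDensity fun ω => w (J ω)).map J := by
    ext E hE
    rw [Measure.map_apply hJm hE, Measure.map_apply hJm hE, Measure.restrict_apply (hJm hE),
      withDensity_apply _ (hJm hE)]
    have h1 := setIntegral_condExp (μ := P) hm (f := A.indicator fun _ => (1 : ℝ))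
      ((integrable_const (1 : ℝ)).indicator hA) (hJ hE)
    rw [setIntegral_congr_ae (g := fun ω => (w (J ω)).toReal) (hJm hE)
      (hc.mono fun ω h _ => h), integral_indicator hA, Measure.restrict_restrict hA, integral_const,
      smul_eq_mul, mul_one, Measure.real, Measure.restrict_apply MeasurableSet.univ, Set.univ_inter,
      integral_toReal hwJ.aemeasurable (Eventually.of_forall fun ω =>
        (hw1 _).trans_lt ENNReal.one_lt_top)] at h1
    rw [Set.inter_comm, ← ENNReal.toReal_eq_toReal_iff' (measure_ne_top _ _) ?_, h1]
    refine ne_of_lt (lt_of_le_of_lt (lintegral_mono (g := fun _ => 1) fun ω => hw1 _) ?_)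
    simp
  calc _ = ∫⁻ p, F p ∂((P.restrict A).map J) := (lintegral_map hF hJm).symm
    _ = ∫⁻ p, F p ∂((P.withDensity fun ω => w (J ω)).map J) := by rw [key]
    _ = _ := by
      rw [lintegral_map hF hJm]
      exact lintegral_withDensity_eq_lintegral_mul P hwJ (hF.comp hJm)

/-- The law of the mark of a block. -/
abbrev markLaw (rate : Fin N → ℝ≥0) (D : Fin N → Measure (Fin N → ℝ≥0)) : Measure (Mark N) :=
  (expMeasure ((∑ j, rate j : ℝ≥0) : ℝ)).prod (issuerDelayLaw rate D)

section

variable {Ω : Type*} [NeZero N]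

theorem measurable_trunc_path (ξ : BlockProcess Ω N k) (n : ℕ) :
    Measurable[ξ.history n] fun ω => trunc n (ξ.path ω) := by
  refine (@measurable_pi_iff Ω ℕ (fun _ => Block N k) (ξ.history n) _ _).2 fun m => ?_
  by_cases hm : 1 ≤ m ∧ m ≤ n
  · simp only [trunc, hm, and_self, if_true]
    have h1 : MeasurableSpace.comap (fun ω => ξ.path ω m) inferInstance ≤ ξ.history n :=
      le_iSup₂_of_le (f := fun m (_ : m ∈ Finset.Icc 1 n) => MeasurableSpace.comap
        (fun ω => (ξ.time m ω, ξ.issuer m ω, ξ.delay m ω, ξ.ref m ω)) inferInstance) m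
        (Finset.mem_Icc.2 hm) le_rfl
    exact (comap_measurable _).mono h1 le_rfl
  · simp only [trunc, hm, if_false]
    exact measurable_const

theorem measurable_history_prod (ξ : BlockProcess Ω N k) (n : ℕ) :
    Measurable[ξ.history n ⊔ MeasurableSpace.comap (ξ.newMark n) inferInstance]
      fun ω => (trunc n (ξ.path ω), ξ.newMark n ω) :=
  ((measurable_trunc_path ξ n).mono le_sup_left le_rfl).prodMk
    ((comap_measurable (ξ.newMark n)).mono le_sup_right le_rfl)

end

variable {Ω : Type*} [mΩ : MeasurableSpace Ω] {P : Measure Ω}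
  {ξ : BlockProcess Ω N k} {rate : Fin N → ℝ≥0} {D : Fin N → Measure (Fin N → ℝ≥0)}

namespace IsBlockProcess

theorem measurable_path (hξ : IsBlockProcess ξ P rate D) : Measurable ξ.path :=
  measurable_pi_iff.2 fun n => (hξ.measurable_time n).prodMk ((hξ.measurable_issuer n).prodMk
    ((hξ.measurable_delay n).prodMk (hξ.measurable_ref n)))

theorem measurable_newMark (hξ : IsBlockProcess ξ P rate D) (n : ℕ) : Measurable (ξ.newMark n) :=
  ((hξ.measurable_time (n + 1)).sub (hξ.measurable_time n)).prodMk
    ((hξ.measurable_issuer (n + 1)).prodMk (hξ.measurable_delay (n + 1)))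

theorem history_le (hξ : IsBlockProcess ξ P rate D) (n : ℕ) : ξ.history n ≤ mΩ :=
  iSup₂_le fun m _ => ((hξ.measurable_time m).prodMk ((hξ.measurable_issuer m).prodMk
    ((hξ.measurable_delay m).prodMk (hξ.measurable_ref m)))).comap_le

theorem newMark_path (hξ : IsBlockProcess ξ P rate D) (n : ℕ) (ω : Ω) :
    coord.newMark n (ξ.path ω) = ξ.newMark n ω := by
  rw [newMark, newMark, time_path ξ hξ.time_zero, time_path ξ hξ.time_zero]
  rfl

theorem nextPool_path [NeZero N] (hξ : IsBlockProcess ξ P rate D) (n : ℕ) (ω : Ω) :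
    nextPool n (trunc n (ξ.path ω)) (ξ.newMark n ω) =
      ξ.localPool (n + 1) (ξ.issuer (n + 1) ω) ω := by
  rw [nextPool_trunc, ← hξ.newMark_path, nextPool_newMark, localPool_path ξ hξ.time_zero]
  rfl

variable [IsProbabilityMeasure P]

theorem isProbabilityMeasure_markLaw (hξ : IsBlockProcess ξ P rate D) :
    IsProbabilityMeasure (markLaw rate D) := by
  rw [markLaw, ← hξ.map_newMark 0]
  exact Measure.isProbabilityMeasure_map (hξ.measurable_newMark 0).aemeasurable

variable [NeZero N]

theorem setLIntegral_ref (hξ : IsBlockProcess ξ P rate D) (n : ℕ) (r : Fin k → ℕ)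
    {F : Path N k × Mark N → ℝ≥0∞} (hF : Measurable F) :
    ∫⁻ ω in ξ.ref (n + 1) ⁻¹' {r}, F (trunc n (ξ.path ω), ξ.newMark n ω) ∂P =
      ∫⁻ ω, unif (nextPool n (trunc n (ξ.path ω)) (ξ.newMark n ω)) r *
        F (trunc n (ξ.path ω), ξ.newMark n ω) ∂P := by
  refine setLIntegral_comp_eq_of_condExp (w := fun p => unif (nextPool n p.1 p.2) r)
    (sup_le (hξ.history_le n) (hξ.measurable_newMark n).comap_le)
    (hξ.measurable_ref (n + 1) (MeasurableSet.singleton r)) (measurable_history_prod ξ n)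
    (measurable_unif_nextPool n r) (fun _ => unif_le_one _ _) ?_ hF
  filter_upwards [hξ.ref_uniform n r] with ω hω
  rw [hω]
  simp only [unif, ENNReal.toReal_prod, hξ.nextPool_path]
  refine Finset.prod_congr rfl fun l _ => ?_
  split_ifs <;> simp

/-- Past and new mark are independent, so their joint law is a product and Tonelli applies. -/
theorem lintegral_newMark (hξ : IsBlockProcess ξ P rate D) (n : ℕ)
    {F : Path N k × Mark N → ℝ≥0∞} (hF : Measurable F) :
    ∫⁻ ω, F (trunc n (ξ.path ω), ξ.newMark n ω) ∂P =
      ∫⁻ ω, ∫⁻ z, F (trunc n (ξ.path ω), z) ∂(markLaw rate D) ∂P := by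
  have := hξ.isProbabilityMeasure_markLaw
  have hH : Measurable fun ω => trunc n (ξ.path ω) :=
    (measurable_trunc_path ξ n).mono (hξ.history_le n) le_rfl
  have hI : IndepFun (fun ω => trunc n (ξ.path ω)) (ξ.newMark n) P := by
    refine (indep_of_indep_of_le_right (hξ.indep_newMark n) ?_).symm
    exact (measurable_trunc_path ξ n).comap_le
  have h1 := (indepFun_iff_map_prod_eq_prod_map_map hH.aemeasurable
    (hξ.measurable_newMark n).aemeasurable).1 hI
  rw [hξ.map_newMark n] at h1
  rw [← lintegral_map hF (hH.prodMk (hξ.measurable_newMark n)), h1,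
    lintegral_prod _ hF.aemeasurable,
    lintegral_map hF.lintegral_prod_right' hH]

/-- Split according to the value `r` of the new references, a countable sum. On each piece the
conditional law of the references turns the indicator into the weight `unif`, and independence then
integrates out the mark. -/
theorem isLaw_map_path (hξ : IsBlockProcess ξ P rate D) :
    IsLaw (markLaw rate D) (P.map ξ.path) := by
  have := hξ.isProbabilityMeasure_markLaw
  intro n Φ hΦ
  rw [lintegral_map hΦ.measurable hξ.measurable_path,
    lintegral_map (measurable_step _ n hΦ.measurable) hξ.measurable_path]
  have hF (r : Fin k → ℕ) : Measurable fun p : Path N k × Mark N => Φ (extend n p.1 p.2 r) :=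
    hΦ.measurable.comp (measurable_extend n r)
  calc ∫⁻ ω, Φ (ξ.path ω) ∂P
      = ∫⁻ ω, ∑' r, (ξ.ref (n + 1) ⁻¹' {r}).indicator
          (fun ω => Φ (extend n (trunc n (ξ.path ω)) (ξ.newMark n ω) r)) ω ∂P := by
        refine lintegral_congr fun ω => ?_
        rw [tsum_eq_single (ξ.ref (n + 1) ω)]
        · rw [Set.indicator_of_mem (by simp), ← hΦ.trunc, trunc_succ_eq_extend, extend_trunc,
            hξ.newMark_path]
          rfl
        · intro r hr
          exact Set.indicator_of_notMem (by simpa using hr.symm) _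
    _ = ∑' r, ∫⁻ ω in ξ.ref (n + 1) ⁻¹' {r},
          Φ (extend n (trunc n (ξ.path ω)) (ξ.newMark n ω) r) ∂P := by
        have hm (r : Fin k → ℕ) : MeasurableSet (ξ.ref (n + 1) ⁻¹' {r}) :=
          hξ.measurable_ref (n + 1) (MeasurableSet.singleton r)
        rw [lintegral_tsum]
        · exact tsum_congr fun r => lintegral_indicator (hm r) _
        · intro r
          refine (Measurable.indicator ?_ (hm r)).aemeasurable
          exact (hF r).comp (((measurable_trunc_path ξ n).mono (hξ.history_le n) le_rfl).prodMk
            (hξ.measurable_newMark n))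
    _ = ∫⁻ ω, ∑' r, unif (nextPool n (trunc n (ξ.path ω)) (ξ.newMark n ω)) r *
          Φ (extend n (trunc n (ξ.path ω)) (ξ.newMark n ω) r) ∂P := by
        have hG (r : Fin k → ℕ) : Measurable fun ω =>
            unif (nextPool n (trunc n (ξ.path ω)) (ξ.newMark n ω)) r *
              Φ (extend n (trunc n (ξ.path ω)) (ξ.newMark n ω) r) := by
          have := ((measurable_unif_nextPool n r).mul (hF r)).comp
            (((measurable_trunc_path ξ n).mono (hξ.history_le n) le_rfl).prodMk
              (hξ.measurable_newMark n))
          simpa only [Function.comp_def, Pi.mul_apply] using this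
        rw [lintegral_tsum fun r => (hG r).aemeasurable]
        exact tsum_congr fun r => hξ.setLIntegral_ref n r (hF r)
    _ = ∫⁻ ω, step (markLaw rate D) n Φ (ξ.path ω) ∂P := by
        have := hξ.lintegral_newMark n (measurable_step_integrand n hΦ.measurable)
        refine this.trans (lintegral_congr fun ω => ?_)
        rw [← step_trunc, step]

end IsBlockProcess

end Ledger

/-! ### Regenerations, pathwise: after one, pools are translates of pools of the shifted path. -/

namespace Ledger

open BlockProcess

variable {N k : ℕ}

/-- The properties of the law of the marks that are used: delays bounded by `Δ`, and memoryless
waiting times that exceed `Δ` with positive probability. -/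
structure Memoryless (ν : Measure (Mark N)) (Δ : ℝ≥0) : Prop where
  ae_nonneg : ∀ᵐ z ∂ν, 0 ≤ z.1
  ae_delay_le : ∀ᵐ z ∂ν, ∀ i, z.2.2 i ≤ Δ
  gap_pos : 0 < ν {z | (Δ : ℝ) < z.1}
  lintegral_gap : ∀ ψ : Mark N → ℝ≥0∞, Measurable ψ →
    ∫⁻ z in {z | (Δ : ℝ) < z.1}, ψ (z.1 - Δ, z.2) ∂ν = ν {z | (Δ : ℝ) < z.1} * ∫⁻ z, ψ z ∂ν

/-- The first `n` blocks of the path `h` satisfy the almost sure constraints of the model. -/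
structure Valid (Δ : ℝ≥0) (n : ℕ) (h : Path N k) : Prop where
  time_le : ∀ m < n, coord.time m h ≤ coord.time (m + 1) h
  delay_le : ∀ m, 1 ≤ m → m ≤ n → ∀ i, coord.delay m h i ≤ Δ
  ref_mem : ∀ m, 1 ≤ m → m ≤ n → ∀ l, coord.ref m h l ∈ coord.localPool m (coord.issuer m h) h

theorem Valid.mono {Δ : ℝ≥0} {n m : ℕ} {h : Path N k} (hv : Valid Δ n h) (hm : m ≤ n) :
    Valid Δ m h :=
  ⟨fun a ha => hv.time_le a (ha.trans_le hm), fun a h1 ha => hv.delay_le a h1 (ha.trans hm),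
    fun a h1 ha => hv.ref_mem a h1 (ha.trans hm)⟩

theorem lt_of_mem_localPool {n a : ℕ} {i : Fin N} {h : Path N k} (hn : 1 ≤ n)
    (ha : a ∈ coord.localPool n i h) : a < n := by
  rw [mem_localPool, mem_received] at ha
  omega

theorem Valid.ref_lt {Δ : ℝ≥0} {n m : ℕ} {h : Path N k} (hv : Valid Δ n h) (h1 : 1 ≤ m)
    (hm : m ≤ n) (l : Fin k) : coord.ref m h l < m :=
  lt_of_mem_localPool h1 (hv.ref_mem m h1 hm l)

theorem Valid.mem_observerPool {Δ : ℝ≥0} {n : ℕ} {h : Path N k} (hv : Valid Δ n h) :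
    n ∈ coord.observerPool n h :=
  BlockProcess.mem_observerPool.2 ⟨le_rfl, fun _ h1 hm l => ((hv.ref_lt h1 hm l).trans_le hm).ne⟩

theorem time_mono {n : ℕ} {h : Path N k} (ht : ∀ m < n, coord.time m h ≤ coord.time (m + 1) h)
    {a b : ℕ} (hab : a ≤ b) (hb : b ≤ n) : coord.time a h ≤ coord.time b h := by
  induction b, hab using Nat.le_induction with
  | base => exact le_rfl
  | succ b hab ih => exact (ih (by omega)).trans (ht b (by omega))

/-- The genesis, or the last received block, is a tip. -/
theorem localPool_nonempty {Δ : ℝ≥0} {n : ℕ} {h : Path N k} (hv : Valid Δ n h) (i : Fin N) {q : ℕ}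
    (hq : q ≤ n + 1) : (coord.localPool q i h).Nonempty := by
  have hne : (insert 0 (coord.received q i h)).Nonempty := Finset.insert_nonempty _ _
  refine ⟨_, mem_localPool.2 ⟨Finset.mem_insert.1 (Finset.max'_mem _ hne), fun m hm l hl => ?_⟩⟩
  have h1 := (mem_received.1 hm).1
  have h2 := hv.ref_lt h1.1 (by omega) l
  have h3 := Finset.le_max' _ m (Finset.mem_insert_of_mem (b := 0) hm)
  omega

/-- A block issued by `t_{j-1}` arrives by `t_{j-1} + Δ < t_j ≤ t_q`. One long waiting time thus
delivers everything older, to all nodes and for good. -/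
theorem mem_received_of_gap {Δ : ℝ≥0} {a j q : ℕ} {i : Fin N} {h : Path N k}
    (ht : ∀ m < q, coord.time m h ≤ coord.time (m + 1) h) (hd : coord.delay a h i ≤ Δ)
    (hgap : (Δ : ℝ) < coord.time j h - coord.time (j - 1) h) (ha : 1 ≤ a) (haj : a < j)
    (hj : j ≤ q) : a ∈ coord.received q i h := by
  refine mem_received.2 ⟨⟨ha, by omega⟩, ?_⟩
  have h1 : coord.time a h ≤ coord.time (j - 1) h := time_mono ht (by omega) (by omega)
  have h2 : coord.time j h ≤ coord.time q h := time_mono ht hj le_rfl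
  have h3 : (coord.delay a h i : ℝ) ≤ Δ := by exact_mod_cast hd
  linarith

/-- After a long waiting time all nodes see all blocks. -/
theorem localPool_of_gap {Δ : ℝ≥0} {q : ℕ} {h : Path N k} (hv : Valid Δ q h)
    (ht : coord.time q h ≤ coord.time (q + 1) h)
    (hgap : (Δ : ℝ) < coord.time (q + 1) h - coord.time q h) (i : Fin N) :
    coord.localPool (q + 1) i h = coord.observerPool q h := by
  have ht' : ∀ m < q + 1, coord.time m h ≤ coord.time (m + 1) h := fun m hm => by
    rcases Nat.lt_succ_iff_lt_or_eq.1 hm with h2 | rfl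
    · exact hv.time_le m h2
    · exact ht
  have hrec {a : ℕ} : a ∈ coord.received (q + 1) i h ↔ 1 ≤ a ∧ a ≤ q := by
    constructor
    · intro ha
      have := (mem_received.1 ha).1
      omega
    · rintro ⟨h1, h2⟩
      exact mem_received_of_gap ht' (hv.delay_le a h1 h2 i) (j := q + 1) hgap h1 (by omega) le_rfl
  ext a
  simp only [mem_localPool, hrec, BlockProcess.mem_observerPool]
  constructor
  · exact fun ha => ⟨by omega, fun m h1 hm => ha.2 m ⟨h1, hm⟩⟩
  · exact fun ha => ⟨by omega, fun m hm => ha.2 m hm.1 hm.2⟩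

/-- Block `s + 1` is issued after a long waiting time, when block `s` is the only tip. -/
def Regen (Δ : ℝ≥0) (s : ℕ) (h : Path N k) : Prop :=
  (Δ : ℝ) < coord.time (s + 1) h - coord.time s h ∧ tips s h ≤ 1

/-- The blocks after block `s`, with block `s` as the genesis. -/
def shift (Δ : ℝ≥0) (s : ℕ) (h : Path N k) : Path N k := fun m =>
  -- Removing `Δ` affects only the first waiting time, which exceeds `Δ` at a regeneration and is
  -- exponential again after the subtraction. The truncated subtraction of `s` from references loses
  -- nothing there, since `le_ref` shows them to be at least `s`.
  (coord.time (s + m) h - coord.time s h - Δ, coord.issuer (s + m) h, coord.delay (s + m) h,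
    fun l => coord.ref (s + m) h l - s)

theorem coord_time_shift {Δ : ℝ≥0} {s m : ℕ} {h : Path N k} (hm : 1 ≤ m) :
    coord.time m (shift Δ s h) = coord.time (s + m) h - coord.time s h - Δ := by
  conv_lhs => simp only [coord]
  rw [if_neg (by omega)]; rfl

section shift

variable {Δ : ℝ≥0} {s n : ℕ} {h : Path N k}

theorem observerPool_eq_singleton (hv : Valid Δ s h) (hs : tips s h ≤ 1) :
    coord.observerPool s h = {s} :=
  (Finset.eq_of_subset_of_card_le (Finset.singleton_subset_iff.2 hv.mem_observerPool)
    (by simpa [tips] using hs)).symm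

theorem exists_ref_eq_of_lt (hv : Valid Δ s h) (hs : tips s h ≤ 1) {a : ℕ} (ha : a < s) :
    ∃ m, 1 ≤ m ∧ m ≤ s ∧ ∃ l, coord.ref m h l = a := by
  have h1 : a ∉ coord.observerPool s h := by
    rw [observerPool_eq_singleton hv hs, Finset.mem_singleton]; omega
  rw [BlockProcess.mem_observerPool] at h1
  push Not at h1
  exact h1 ha.le

/-- When `s` is the only tip, each older block is referenced by some block up to `s`, and the long
wait has delivered that referencing block to every node. -/
theorem le_of_mem_localPool (hr : Regen Δ s h) (hv : Valid Δ n h) {q : ℕ} (hsq : s < q)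
    (hq : q ≤ n + 1) (ht : ∀ m < q, coord.time m h ≤ coord.time (m + 1) h) {i : Fin N} {a : ℕ}
    (ha : a ∈ coord.localPool q i h) : s ≤ a := by
  by_contra! has
  obtain ⟨m, h1, hm, l, hl⟩ := exists_ref_eq_of_lt (hv.mono (by omega)) hr.2 has
  exact (mem_localPool.1 ha).2 m (mem_received_of_gap ht (hv.delay_le m h1 (by omega) i)
    (j := s + 1) hr.1 h1 (by omega) (by omega)) l hl

theorem le_ref (hr : Regen Δ s h) (hv : Valid Δ n h) {m : ℕ} (hsm : s < m) (hm : m ≤ n)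
    (l : Fin k) : s ≤ coord.ref m h l :=
  le_of_mem_localPool hr hv hsm (by omega) (fun _ ha => hv.time_le _ (by omega))
    (hv.ref_mem m (by omega) hm l)

theorem mem_received_shift {m b : ℕ} {i : Fin N} (hm : 1 ≤ m) (hb : 1 ≤ b) :
    b ∈ coord.received m i (shift Δ s h) ↔ s + b ∈ coord.received (s + m) i h := by
  rw [mem_received, mem_received, coord_time_shift hm, coord_time_shift hb]
  refine and_congr (by omega) ?_
  change _ + (coord.delay (s + b) h i : ℝ) < _ ↔ _
  constructor <;> intro h1 <;> linarith

/-- Comparisons of arrival times after `s` are translation invariant. Blocks up to `s` are all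
received, but they reference only blocks strictly below `s`, so they remove nothing from the pool at
or above `s`; block `s` itself takes the role of the always visible genesis. -/
theorem localPool_shift (hr : Regen Δ s h) (hv : Valid Δ n h) {m : ℕ} (hm1 : 1 ≤ m)
    (hm : s + m ≤ n + 1) (ht : ∀ a < s + m, coord.time a h ≤ coord.time (a + 1) h) (i : Fin N) :
    coord.localPool (s + m) i h =
      (coord.localPool m i (shift Δ s h)).map (addLeftEmbedding s) := by
  have hrec {a : ℕ} (h1 : 1 ≤ a) (ha : a ≤ s) : a ∈ coord.received (s + m) i h :=
    mem_received_of_gap ht (hv.delay_le a h1 (by omega) i) (j := s + 1) hr.1 h1 (by omega)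
      (by omega)
  ext a
  constructor
  · intro ha
    obtain ⟨b, rfl⟩ := Nat.exists_eq_add_of_le (le_of_mem_localPool hr hv (by omega) hm ht ha)
    refine Finset.mem_map.2 ⟨b, ?_, rfl⟩
    rw [mem_localPool] at ha ⊢
    refine ⟨?_, fun d hd l hl => ?_⟩
    · rcases Nat.eq_zero_or_pos b with hb | hb
      · exact Or.inl hb
      · exact Or.inr ((mem_received_shift hm1 hb).2 (ha.1.resolve_left (by omega)))
    · have hd1 := (mem_received.1 hd).1
      have h2 := le_ref hr hv (m := s + d) (by omega) (by omega) l
      have h3 : coord.ref (s + d) h l - s = b := hl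
      exact ha.2 (s + d) ((mem_received_shift hm1 hd1.1).1 hd) l (by omega)
  · intro ha
    obtain ⟨b, hb, rfl⟩ := Finset.mem_map.1 ha
    change s + b ∈ _
    rw [mem_localPool] at hb ⊢
    refine ⟨?_, fun c hc l hl => ?_⟩
    · rcases Nat.eq_zero_or_pos b with hb0 | hb0
      · rcases Nat.eq_zero_or_pos s with hs | hs
        · exact Or.inl (by omega)
        · exact Or.inr (hrec (by omega) (by omega))
      · exact Or.inr ((mem_received_shift hm1 hb0).1 (hb.1.resolve_left (by omega)))
    · have hc1 := (mem_received.1 hc).1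
      rcases Nat.lt_or_ge s c with hsc | hsc
      · obtain ⟨d, rfl⟩ := Nat.exists_eq_add_of_lt hsc
        refine hb.2 (d + 1) ((mem_received_shift hm1 (by omega)).2 (by rwa [← add_assoc])) l ?_
        change coord.ref (s + (d + 1)) h l - s = b
        rw [← add_assoc]; omega
      · have := hv.ref_lt hc1.1 (by omega) l
        omega

theorem observerPool_shift (hr : Regen Δ s h) {m : ℕ} (hv : Valid Δ (s + m) h) :
    coord.observerPool (s + m) h =
      (coord.observerPool m (shift Δ s h)).map (addLeftEmbedding s) := by
  ext a
  constructor
  · intro ha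
    rw [BlockProcess.mem_observerPool] at ha
    have has : s ≤ a := by
      by_contra! has
      obtain ⟨c, h1, hc, l, hl⟩ := exists_ref_eq_of_lt (hv.mono (by omega)) hr.2 has
      exact ha.2 c h1 (by omega) l hl
    obtain ⟨b, rfl⟩ := Nat.exists_eq_add_of_le has
    refine Finset.mem_map.2 ⟨b, BlockProcess.mem_observerPool.2 ⟨by omega, fun d h1 hd l hl => ?_⟩, rfl⟩
    have h2 := le_ref hr hv (m := s + d) (by omega) (by omega) l
    have h3 : coord.ref (s + d) h l - s = b := hl
    exact ha.2 (s + d) (by omega) (by omega) l (by omega)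
  · intro ha
    obtain ⟨b, hb, rfl⟩ := Finset.mem_map.1 ha
    change s + b ∈ _
    rw [BlockProcess.mem_observerPool] at hb ⊢
    refine ⟨by omega, fun c h1 hc l hl => ?_⟩
    rcases Nat.lt_or_ge s c with hsc | hsc
    · obtain ⟨d, rfl⟩ := Nat.exists_eq_add_of_lt hsc
      refine hb.2 (d + 1) (by omega) (by omega) l ?_
      change coord.ref (s + (d + 1)) h l - s = b
      rw [← add_assoc]; omega
    · have := hv.ref_lt h1 (by omega) l
      omega

theorem tips_shift (hr : Regen Δ s h) {m : ℕ} (hv : Valid Δ (s + m) h) :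
    tips (s + m) h = tips m (shift Δ s h) := by
  rw [tips, observerPool_shift hr hv, Finset.card_map, tips]

theorem localTips_shift (hr : Regen Δ s h) {m : ℕ} (hm : 1 ≤ m) (hv : Valid Δ (s + m) h)
    (i : Fin N) : localTips i (s + m) h = localTips i m (shift Δ s h) := by
  rw [localTips, localPool_shift hr hv hm (by omega) hv.time_le, Finset.card_map, localTips]

end shift

theorem measurable_shift (Δ : ℝ≥0) (s : ℕ) : Measurable (shift (N := N) (k := k) Δ s) := by
  refine measurable_pi_iff.2 fun m => ?_
  refine Measurable.prodMk ?_ (Measurable.prodMk (measurable_coord_issuer _)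
    (Measurable.prodMk (measurable_coord_delay _) ?_))
  · exact ((measurable_coord_time (s + m)).sub (measurable_coord_time s)).sub measurable_const
  · refine measurable_pi_iff.2 fun l => ?_
    exact (measurable_of_countable fun a : ℕ => a - s).comp
      ((measurable_pi_apply l).comp (measurable_coord_ref (s + m)))

theorem unif_map (S : Finset ℕ) (s : ℕ) (r : Fin k → ℕ) :
    unif (S.map (addLeftEmbedding s)) (fun l => s + r l) = unif S r := by
  simp [unif]

/-- Tuples with an entry below `s` have weight zero, so translation by `s` reindexes the whole sum.
-/
theorem tsum_unif_map (S : Finset ℕ) (s : ℕ) (F : (Fin k → ℕ) → ℝ≥0∞) :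
    ∑' r, unif (S.map (addLeftEmbedding s)) r * F (fun l => r l - s) = ∑' r, unif S r * F r := by
  have hinj : Function.Injective fun (r : Fin k → ℕ) l => s + r l := fun r r' h => by
    ext l; have := congrFun h l; simpa using this
  rw [← hinj.tsum_eq]
  · exact tsum_congr fun r => by simp only [unif_map, Nat.add_sub_cancel_left]
  · intro r hr
    have h1 : ∀ l, r l ∈ S.map (addLeftEmbedding s) := by
      by_contra h1
      exact hr (by simp only [unif_of_notMem h1, zero_mul])
    refine ⟨fun l => r l - s, funext fun l => ?_⟩
    obtain ⟨b, -, hb⟩ := Finset.mem_map.1 (h1 l)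
    change s + b = r l at hb
    change s + (r l - s) = r l
    omega

end Ledger

/-! ### Almost sure constraints and the regeneration property of the law. -/

namespace Ledger

open BlockProcess

variable {N k : ℕ}

section measurability

theorem measurableSet_valid (Δ : ℝ≥0) (n : ℕ) : MeasurableSet {h : Path N k | Valid Δ n h} := by
  have h1 : {h : Path N k | Valid Δ n h} =
      (⋂ m, ⋂ (_ : m < n), {h : Path N k | coord.time m h ≤ coord.time (m + 1) h}) ∩
      ((⋂ m, ⋂ (_ : 1 ≤ m), ⋂ (_ : m ≤ n), ⋂ i, {h : Path N k | coord.delay m h i ≤ Δ}) ∩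
      (⋂ m, ⋂ (_ : 1 ≤ m), ⋂ (_ : m ≤ n), ⋂ l, ⋃ i, ⋃ a, ({h : Path N k | coord.issuer m h = i} ∩
        ({h : Path N k | coord.ref m h l = a} ∩ {h : Path N k | a ∈ coord.localPool m i h})))) := by
    ext h
    simp only [Set.mem_ofPred_eq, Set.mem_inter_iff, Set.mem_iInter, Set.mem_iUnion]
    constructor
    · intro hv
      exact ⟨hv.time_le, hv.delay_le, fun m h1 hm l => ⟨_, _, rfl, rfl, hv.ref_mem m h1 hm l⟩⟩
    · rintro ⟨h1, h2, h3⟩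
      refine ⟨h1, h2, fun m hm1 hm l => ?_⟩
      obtain ⟨i, a, rfl, rfl, h4⟩ := h3 m hm1 hm l
      exact h4
  rw [h1]
  refine MeasurableSet.inter ?_ (MeasurableSet.inter ?_ ?_)
  · exact .iInter fun m => .iInter fun _ =>
      measurableSet_le (measurable_coord_time m) (measurable_coord_time (m + 1))
  · exact .iInter fun m => .iInter fun _ => .iInter fun _ => .iInter fun i =>
      measurableSet_le ((measurable_pi_apply i).comp (measurable_coord_delay m)) measurable_const
  · exact .iInter fun m => .iInter fun _ => .iInter fun _ => .iInter fun l => .iUnion fun i =>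
      .iUnion fun a => (measurableSet_eq_fun (measurable_coord_issuer m) measurable_const).inter
        ((measurableSet_ref_eq m a l).inter (measurableSet_mem_localPool m a i))

theorem measurableSet_gap (Δ : ℝ≥0) (s : ℕ) :
    MeasurableSet {h : Path N k | (Δ : ℝ) < coord.time (s + 1) h - coord.time s h} :=
  measurableSet_lt measurable_const ((measurable_coord_time (s + 1)).sub (measurable_coord_time s))

theorem measurableSet_tips_le (s a : ℕ) : MeasurableSet {h : Path N k | tips s h ≤ a} :=
  measurableSet_le (measurable_tips s) measurable_const

theorem measurableSet_regen (Δ : ℝ≥0) (s : ℕ) : MeasurableSet {h : Path N k | Regen Δ s h} :=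
  (measurableSet_gap Δ s).inter (measurableSet_tips_le s 1)

theorem measurableSet_gap_mark (Δ : ℝ≥0) : MeasurableSet {z : Mark N | (Δ : ℝ) < z.1} :=
  measurableSet_lt measurable_const measurable_fst

end measurability

variable [NeZero N]

theorem Adapted.indicator {n : ℕ} {A : Set (Path N k)} (hA : MeasurableSet A)
    (hA' : ∀ h, Ledger.trunc n h ∈ A ↔ h ∈ A) {f : Path N k → ℝ≥0∞} (hf : Adapted n f) :
    Adapted n (A.indicator f) :=
  ⟨hf.measurable.indicator hA, fun h => by
    by_cases h1 : h ∈ A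
    · rw [Set.indicator_of_mem h1, Set.indicator_of_mem ((hA' h).2 h1), hf.trunc]
    · rw [Set.indicator_of_notMem h1, Set.indicator_of_notMem (fun h2 => h1 ((hA' h).1 h2))]⟩

theorem Adapted.gap (Δ : ℝ≥0) (s : ℕ) {f : Path N k → ℝ≥0∞} (hf : Adapted (s + 1) f) :
    Adapted (s + 1) ({h | (Δ : ℝ) < coord.time (s + 1) h - coord.time s h}.indicator f) :=
  Adapted.indicator (measurableSet_gap Δ s) (fun h => by
    simp only [Set.mem_ofPred_eq, coord_time_trunc le_rfl, coord_time_trunc s.le_succ]) hf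

theorem Adapted.tips_le {n s : ℕ} (a : ℕ) (hs : s ≤ n) {f : Path N k → ℝ≥0∞} (hf : Adapted n f) :
    Adapted n ({h | tips s h ≤ a}.indicator f) :=
  Adapted.indicator (measurableSet_tips_le s a) (fun h => by
    simp only [Set.mem_ofPred_eq, tips_trunc hs]) hf

theorem Adapted.regen (Δ : ℝ≥0) {n s : ℕ} (hs : s + 1 ≤ n) {f : Path N k → ℝ≥0∞}
    (hf : Adapted n f) : Adapted n ({h | Regen Δ s h}.indicator f) :=
  Adapted.indicator (measurableSet_regen Δ s) (fun h => by
    simp only [Set.mem_ofPred_eq, Regen, tips_trunc (show s ≤ n by omega), coord_time_trunc hs,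
      coord_time_trunc (show s ≤ n by omega)]) hf

theorem valid_trunc {Δ : ℝ≥0} {n m : ℕ} (hm : m ≤ n) (h : Path N k) :
    Valid Δ m (trunc n h) ↔ Valid Δ m h := by
  have h0 {a : ℕ} (h1 : 1 ≤ a) (ha : a ≤ m) : trunc n h a = h a := trunc_apply h1 (ha.trans hm) h
  constructor
  · intro hv
    refine ⟨fun a ha => ?_, fun a h1 ha i => ?_, fun a h1 ha l => ?_⟩
    · have := hv.time_le a ha
      rwa [coord_time_trunc (by omega), coord_time_trunc (by omega)] at this
    · have := hv.delay_le a h1 ha i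
      simpa only [coord, h0 h1 ha] using this
    · have := hv.ref_mem a h1 ha l
      rw [localPool_trunc (ha.trans hm)] at this
      have e1 : coord.ref a (trunc n h) = coord.ref a h := by simp only [coord, h0 h1 ha]
      have e2 : coord.issuer a (trunc n h) = coord.issuer a h := by simp only [coord, h0 h1 ha]
      rwa [e1, e2] at this
  · intro hv
    refine ⟨fun a ha => ?_, fun a h1 ha i => ?_, fun a h1 ha l => ?_⟩
    · rw [coord_time_trunc (by omega), coord_time_trunc (by omega)]
      exact hv.time_le a ha
    · have := hv.delay_le a h1 ha i
      simpa only [coord, h0 h1 ha] using this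
    · rw [localPool_trunc (ha.trans hm)]
      have e1 : coord.ref a (trunc n h) = coord.ref a h := by simp only [coord, h0 h1 ha]
      have e2 : coord.issuer a (trunc n h) = coord.issuer a h := by simp only [coord, h0 h1 ha]
      rw [e1, e2]
      exact hv.ref_mem a h1 ha l

theorem Valid.extend {Δ : ℝ≥0} {n : ℕ} {h : Path N k} (hv : Valid Δ n h) {z : Mark N}
    (hz : 0 ≤ z.1) (hd : ∀ i, z.2.2 i ≤ Δ) {r : Fin k → ℕ} (hr : ∀ l, r l ∈ nextPool n h z) :
    Valid Δ (n + 1) (extend n h z r) := by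
  have hv' : Valid Δ n (Ledger.extend n h z r) := by
    rwa [← valid_trunc le_rfl, trunc_extend le_rfl, valid_trunc le_rfl]
  refine ⟨fun a ha => ?_, fun a h1 ha i => ?_, fun a h1 ha l => ?_⟩
  · rcases Nat.lt_succ_iff_lt_or_eq.1 ha with h2 | rfl
    · exact hv'.time_le a h2
    · rw [coord_time_extend, coord_time_extend_of_le le_rfl]; linarith
  · rcases Nat.le_succ_iff.1 ha with h2 | rfl
    · exact hv'.delay_le a h1 h2 i
    · rw [coord_delay_extend]; exact hd i
  · rcases Nat.le_succ_iff.1 ha with h2 | rfl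
    · exact hv'.ref_mem a h1 h2 l
    · rw [coord_ref_extend, coord_issuer_extend, localPool_extend]
      exact hr l

/-- By induction on `n`: one transition from a valid path reaches invalid ones with weight zero,
because marks are good almost surely and tuples outside the pool have `unif` equal to zero. -/
theorem ae_valid {ν : Measure (Mark N)} [IsProbabilityMeasure ν] {Δ : ℝ≥0} (hν : Memoryless ν Δ)
    {P : Measure (Path N k)} (hP : IsLaw ν P) : ∀ᵐ h ∂P, ∀ n, Valid Δ n h := by
  rw [ae_all_iff]
  intro n
  induction n with
  | zero => exact Eventually.of_forall fun h => ⟨by simp, fun m h1 hm => by omega,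
      fun m h1 hm => by omega⟩
  | succ n ih =>
    have hm : MeasurableSet {h : Path N k | Valid Δ (n + 1) h}ᶜ := (measurableSet_valid Δ _).compl
    have h1 := hP n ({h | Valid Δ (n + 1) h}ᶜ.indicator fun _ => 1)
      (Adapted.indicator hm (fun h => by
        simp only [Set.mem_compl_iff, Set.mem_ofPred_eq, valid_trunc le_rfl]) (Adapted.const 1))
    rw [lintegral_indicator hm, setLIntegral_one] at h1
    change P {h | Valid Δ (n + 1) h}ᶜ = 0
    rw [h1]
    refine (lintegral_congr_ae (g := fun _ => 0) ?_).trans lintegral_zero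
    filter_upwards [ih] with h hv
    refine (lintegral_congr_ae (g := fun _ => 0) ?_).trans lintegral_zero
    filter_upwards [hν.ae_nonneg, hν.ae_delay_le] with z hz hd
    refine ENNReal.tsum_eq_zero.2 fun r => ?_
    by_cases hr : ∀ l, r l ∈ nextPool n h z
    · rw [Set.indicator_of_notMem, mul_zero]
      simpa using hv.extend hz hd hr
    · rw [unif_of_notMem hr, zero_mul]

/-- Integrals of weighted functions are computed by one step of the dynamics. -/
theorem IsLaw.lintegral_mul_le {ν : Measure (Mark N)} [IsProbabilityMeasure ν] {Δ : ℝ≥0}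
    (hν : Memoryless ν Δ) {P : Measure (Path N k)} (hP : IsLaw ν P) {n : ℕ}
    {g Φ Ψ : Path N k → ℝ≥0∞} (hg : Adapted n g) (hΦ : Adapted (n + 1) Φ)
    (hΨ : ∀ h, Valid Δ n h → step ν n Φ h ≤ Ψ h) :
    ∫⁻ h, g h * Φ h ∂P ≤ ∫⁻ h, g h * Ψ h ∂P := by
  rw [hP.lintegral_mul hg hΦ]
  refine lintegral_mono_ae ?_
  filter_upwards [ae_valid hν hP] with h hv
  gcongr
  exact hΨ h (hv n)

section shift

variable {ν : Measure (Mark N)} {Δ : ℝ≥0} {s n : ℕ} {h : Path N k}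

theorem extend_congr {h' : Path N k} {z z' : Mark N} {r : Fin k → ℕ} (hh : trunc n h = trunc n h')
    (ht : coord.time n h + z.1 = coord.time n h' + z'.1) (hz : z.2 = z'.2) :
    extend n h z r = extend n h' z' r := by
  rw [extend, extend, hh, ht, hz]

/-- Beyond the first block the constant `Δ` cancels from waiting times, so shifting commutes with
appending the same mark. For the first block the waiting time is reduced by `Δ`, which is the
content of `trunc_shift_extend_zero`. -/
theorem trunc_shift_extend (hn : 1 ≤ n) (z : Mark N) (r : Fin k → ℕ) :
    trunc (n + 1) (shift Δ s (extend (s + n) h z r)) =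
      extend n (shift Δ s h) z fun l => r l - s := by
  have ht : coord.time (s + n) (extend (s + n) h z r) = coord.time (s + n) h :=
    coord_time_extend_of_le le_rfl
  have ht' : coord.time s (extend (s + n) h z r) = coord.time s h :=
    coord_time_extend_of_le (by omega)
  rw [trunc_succ_eq_extend]
  have hr : coord.ref (n + 1) (shift Δ s (extend (s + n) h z r)) = fun l => r l - s := by
    change (fun l => coord.ref (s + n + 1) (extend (s + n) h z r) l - s) = _
    rw [coord_ref_extend]
  rw [hr]
  have htr : trunc n (shift Δ s (extend (s + n) h z r)) = trunc n (shift Δ s h) := by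
    ext1 m
    simp only [trunc]
    split_ifs with hm
    · rw [shift, shift, coord_time_extend_of_le (by omega), ht']
      simp only [coord, extend_apply_of_le (show 1 ≤ s + m by omega) (show s + m ≤ s + n by omega)]
    · rfl
  refine extend_congr htr ?_ ?_
  · have e1 := coord_time_shift (Δ := Δ) (s := s) (h := extend (s + n) h z r)
      (show 1 ≤ n + 1 by omega)
    rw [← add_assoc, coord_time_extend, ht'] at e1
    simp only [newMark, e1, coord_time_shift hn]
    ring
  · simp only [newMark]
    change (coord.issuer (s + n + 1) _, coord.delay (s + n + 1) _) = _
    rw [coord_issuer_extend, coord_delay_extend]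

theorem trunc_shift_extend_zero (z : Mark N) (r : Fin k → ℕ) :
    trunc 1 (shift Δ s (extend s h z r)) =
      extend 0 (fun _ => (0, 0, 0, 0)) (z.1 - Δ, z.2) fun l => r l - s := by
  rw [trunc_succ_eq_extend]
  have hr : coord.ref (0 + 1) (shift Δ s (extend s h z r)) = fun l => r l - s := by
    rw [Nat.zero_add]
    change (fun l => coord.ref (s + 1) (extend s h z r) l - s) = _
    rw [coord_ref_extend]
  rw [hr]
  refine extend_congr ?_ ?_ ?_
  · ext1 m
    rw [trunc, trunc, if_neg (by omega), if_neg (by omega)]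
  · have e1 := coord_time_shift (Δ := Δ) (s := s) (h := extend s h z r) (le_refl 1)
    rw [coord_time_extend, coord_time_extend_of_le le_rfl] at e1
    have e : ∀ h' : Path N k, coord.time 0 h' = 0 := fun h' => by simp [coord]
    simp only [newMark, e, Nat.zero_add, e1]
    ring
  · simp only [newMark]
    change (coord.issuer (s + 1) _, coord.delay (s + 1) _) = _
    rw [coord_issuer_extend, coord_delay_extend]

theorem Regen.extend (hr : Regen Δ s h) (hn : s + 1 ≤ n) (z : Mark N) (r : Fin k → ℕ) :
    Regen Δ s (extend n h z r) := by
  rw [Regen, coord_time_extend_of_le hn, coord_time_extend_of_le (by omega),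
    tips_extend_of_le (by omega)]
  exact hr

theorem time_le_extend (hv : Valid Δ n h) {z : Mark N} (hz : 0 ≤ z.1) (r : Fin k → ℕ) :
    ∀ m < n + 1, coord.time m (extend n h z r) ≤ coord.time (m + 1) (extend n h z r) := by
  intro m hm
  rcases Nat.lt_succ_iff_lt_or_eq.1 hm with h2 | rfl
  · rw [coord_time_extend_of_le h2.le, coord_time_extend_of_le h2]
    exact hv.time_le m h2
  · rw [coord_time_extend, coord_time_extend_of_le le_rfl]; linarith

theorem Valid.extend_of_le (hv : Valid Δ n h) (z : Mark N) (r : Fin k → ℕ) :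
    Valid Δ n (Ledger.extend n h z r) := by
  rwa [← valid_trunc le_rfl, trunc_extend le_rfl, valid_trunc le_rfl]

theorem nextPool_shift (hr : Regen Δ s h) (hn : 1 ≤ n) (hv : Valid Δ (s + n) h) {z : Mark N}
    (hz : 0 ≤ z.1) :
    nextPool (s + n) h z = (nextPool n (shift Δ s h) z).map (addLeftEmbedding s) := by
  rw [nextPool, nextPool, add_assoc, localPool_shift (n := s + n) (hr.extend (by omega) z 0)
    (hv.extend_of_le z 0) (by omega) (by omega) (by simpa [add_assoc] using time_le_extend hv hz 0)]
  congr 1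
  rw [← localPool_trunc le_rfl, trunc_shift_extend hn, localPool_extend]

theorem step_shift (hν : Memoryless ν Δ) (hr : Regen Δ s h) (hn : 1 ≤ n) (hv : Valid Δ (s + n) h)
    {Φ : Path N k → ℝ≥0∞} (hΦ : Adapted (n + 1) Φ) :
    step ν (s + n) (fun h => Φ (shift Δ s h)) h = step ν n Φ (shift Δ s h) := by
  refine lintegral_congr_ae ?_
  filter_upwards [hν.ae_nonneg] with z hz
  rw [nextPool_shift hr hn hv hz]
  refine Eq.trans (tsum_congr fun r => ?_) (tsum_unif_map _ s _)
  rw [← hΦ.trunc (shift Δ s _), trunc_shift_extend hn]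

theorem nextPool_of_gap (hv : Valid Δ n h) {z : Mark N} (hz : (Δ : ℝ) < z.1) :
    nextPool n h z = coord.observerPool n h := by
  have h0 : (0 : ℝ) ≤ Δ := Δ.2
  rw [nextPool, localPool_of_gap (hv.extend_of_le z 0), observerPool_extend_of_le le_rfl]
  · rw [coord_time_extend, coord_time_extend_of_le le_rfl]; linarith
  · rw [coord_time_extend, coord_time_extend_of_le le_rfl]; linarith

theorem gap_extend (z : Mark N) (r : Fin k → ℕ) :
    (Δ : ℝ) < coord.time (n + 1) (extend n h z r) - coord.time n (extend n h z r) ↔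
      (Δ : ℝ) < z.1 := by
  rw [coord_time_extend, coord_time_extend_of_le le_rfl, add_sub_cancel_left]

/-- On a long wait the sampling pool is the observer pool whoever issues the block, so it leaves no
dependence on the mark in the weight. -/
theorem step_gap (Φ : Path N k → ℝ≥0∞) (hv : Valid Δ n h) :
    step ν n ({h | (Δ : ℝ) < coord.time (n + 1) h - coord.time n h}.indicator Φ) h =
      ∫⁻ z in {z | (Δ : ℝ) < z.1}, ∑' r, unif (coord.observerPool n h) r * Φ (extend n h z r) ∂ν := by
  rw [step, ← lintegral_indicator (measurableSet_gap_mark Δ)]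
  refine lintegral_congr fun z => ?_
  by_cases hz : (Δ : ℝ) < z.1
  · rw [Set.indicator_of_mem (show z ∈ {z : Mark N | (Δ : ℝ) < z.1} from hz), nextPool_of_gap hv hz]
    refine tsum_congr fun r => ?_
    rw [Set.indicator_of_mem (show extend n h z r ∈ {h : Path N k |
      (Δ : ℝ) < coord.time (n + 1) h - coord.time n h} from (gap_extend z r).2 hz)]
  · rw [Set.indicator_of_notMem (show z ∉ {z : Mark N | (Δ : ℝ) < z.1} from hz)]
    refine ENNReal.tsum_eq_zero.2 fun r => ?_
    rw [Set.indicator_of_notMem (show extend n h z r ∉ {h : Path N k |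
      (Δ : ℝ) < coord.time (n + 1) h - coord.time n h} from fun h2 => hz ((gap_extend z r).1 h2)),
      mul_zero]

theorem step_gap_one (hv : Valid Δ n h) :
    step ν n ({h : Path N k | (Δ : ℝ) < coord.time (n + 1) h - coord.time n h}.indicator
      fun _ => 1) h = ν {z | (Δ : ℝ) < z.1} := by
  rw [step_gap _ hv]
  simp only [tsum_unif_mul_const ⟨n, hv.mem_observerPool⟩]
  simp

theorem nextPool_zero (h : Path N k) (z : Mark N) : nextPool 0 h z = {0} := by
  ext a
  rw [nextPool, Finset.mem_singleton]
  constructor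
  · intro ha
    have := lt_of_mem_localPool le_rfl ha
    omega
  · rintro rfl
    refine mem_localPool.2 ⟨Or.inl rfl, fun m hm => ?_⟩
    have := (mem_received.1 hm).1
    omega

theorem step_zero (Φ : Path N k → ℝ≥0∞) (h h' : Path N k) : step ν 0 Φ h = step ν 0 Φ h' := by
  refine lintegral_congr fun z => tsum_congr fun r => ?_
  rw [nextPool_zero, nextPool_zero]
  congr 2
  refine extend_congr ?_ ?_ rfl
  · ext1 m
    rw [trunc, trunc, if_neg (by omega), if_neg (by omega)]
  · simp [coord]

/-- The only place where memorylessness acts on the dynamics: given a wait longer than `Δ`, the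
excess is a fresh waiting time, and sampling from `{s}` is sampling from the genesis pool after
translation. -/
theorem step_gap_shift [SFinite ν] (hν : Memoryless ν Δ) (hv : Valid Δ s h) (hs : tips s h ≤ 1)
    {Φ : Path N k → ℝ≥0∞} (hΦ : Adapted 1 Φ) (h' : Path N k) :
    step ν s ({h | (Δ : ℝ) < coord.time (s + 1) h - coord.time s h}.indicator
      fun h => Φ (shift Δ s h)) h = ν {z | (Δ : ℝ) < z.1} * step ν 0 Φ h' := by
  set o : Path N k := fun _ => (0, 0, 0, 0)
  have hm : Measurable fun z => ∑' r, unif (nextPool 0 o z) r * Φ (extend 0 o z r) := by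
    have h3 := (measurable_step_integrand 0 hΦ.measurable).comp
      (measurable_prodMk_left (x := o) (β := Mark N))
    simpa only [Function.comp_def] using h3
  rw [step_gap _ hv, step_zero Φ h' o, step, ← hν.lintegral_gap _ hm]
  refine lintegral_congr fun z => ?_
  have hS : coord.observerPool s h = ({0} : Finset ℕ).map (addLeftEmbedding s) := by
    rw [observerPool_eq_singleton hv hs, Finset.map_singleton]; rfl
  rw [nextPool_zero, hS]
  refine Eq.trans (tsum_congr fun r => ?_) (tsum_unif_map _ s _)
  rw [← hΦ.trunc (shift Δ s _), trunc_shift_extend_zero]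

end shift

section regen

variable {ν : Measure (Mark N)} [IsProbabilityMeasure ν] {Δ : ℝ≥0} {P : Measure (Path N k)}

/-- After a regeneration the block process starts afresh. -/
theorem isLaw_shift (hν : Memoryless ν Δ) (hP : IsLaw ν P) {s : ℕ} {g : Path N k → ℝ≥0∞}
    (hg : Adapted s g) :
    IsLaw ν ((P.withDensity ({h | Regen Δ s h}.indicator g)).map (shift Δ s)) := by
  have hG : Adapted (s + 1) ({h | Regen Δ s h}.indicator g) := (hg.mono s.le_succ).regen Δ le_rfl
  have hint {F : Path N k → ℝ≥0∞} (hF : Measurable F) :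
      ∫⁻ h, F h ∂((P.withDensity ({h | Regen Δ s h}.indicator g)).map (shift Δ s)) =
        ∫⁻ h, {h | Regen Δ s h}.indicator g h * F (shift Δ s h) ∂P := by
    rw [lintegral_map hF (measurable_shift Δ s)]
    exact lintegral_withDensity_eq_lintegral_mul P hG.measurable (hF.comp (measurable_shift Δ s))
  have hadp {m : ℕ} {F : Path N k → ℝ≥0∞} (hF : Adapted m F) :
      Adapted (s + m) fun h => F (shift Δ s h) := by
    refine ⟨hF.measurable.comp (measurable_shift Δ s), fun h => ?_⟩
    rw [← hF.trunc, ← hF.trunc (shift Δ s h)]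
    congr 1
    ext1 a
    simp only [trunc]
    split_ifs with ha
    · simp only [shift]
      change (coord.time (s + a) (trunc (s + m) h) - coord.time s (trunc (s + m) h) - Δ,
        (trunc (s + m) h (s + a)).2.1, (trunc (s + m) h (s + a)).2.2.1,
        fun l => (trunc (s + m) h (s + a)).2.2.2 l - s) = _
      rw [coord_time_trunc (by omega), coord_time_trunc (by omega),
        trunc_apply (by omega) (by omega)]
      rfl
    · rfl
  intro n Φ hΦ
  rw [hint hΦ.measurable, hint (measurable_step ν n hΦ.measurable)]
  rcases Nat.eq_zero_or_pos n with rfl | hn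
  · have hT : Adapted s ({h | tips s h ≤ 1}.indicator g) := hg.tips_le 1 le_rfl
    have hsplit (F : Path N k → ℝ≥0∞) (h : Path N k) : {h | Regen Δ s h}.indicator g h * F h =
        {h | tips s h ≤ 1}.indicator g h *
          {h | (Δ : ℝ) < coord.time (s + 1) h - coord.time s h}.indicator F h := by
      simp only [Set.indicator, Set.mem_ofPred_eq, Regen]
      by_cases h1 : (Δ : ℝ) < coord.time (s + 1) h - coord.time s h <;>
        by_cases h2 : tips s h ≤ 1 <;> simp [h1, h2]
    set o : Path N k := fun _ => (0, 0, 0, 0)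
    simp only [step_zero Φ _ o]
    rw [lintegral_congr (hsplit fun h => Φ (shift Δ s h)),
      lintegral_mul_const _ hG.measurable,
      lintegral_congr (fun h => (mul_one _).symm.trans (hsplit (fun _ => 1) h)),
      hP.lintegral_mul hT ((hadp hΦ).gap Δ s), hP.lintegral_mul hT ((Adapted.const 1).gap Δ s)]
    refine Eq.trans ?_ (lintegral_mul_const _ (hT.measurable.mul (measurable_step ν s
        ((Adapted.const 1).gap Δ s).measurable)))
    refine lintegral_congr_ae ?_
    filter_upwards [ae_valid hν hP] with h hv
    by_cases hs : tips s h ≤ 1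
    · rw [step_gap_shift hν (hv s) hs hΦ o, step_gap_one (hv s), mul_assoc]
    · rw [Set.indicator_of_notMem (show h ∉ {h : Path N k | tips s h ≤ 1} from hs), zero_mul,
        zero_mul, zero_mul]
  -- For later blocks the regeneration belongs to the past and is part of the weight.
  · rw [hP.lintegral_mul (hG.mono (by omega : s + 1 ≤ s + n)) (hadp hΦ)]
    refine lintegral_congr_ae ?_
    filter_upwards [ae_valid hν hP] with h hv
    by_cases hr : Regen Δ s h
    · rw [step_shift hν hr hn (hv _) hΦ]
    · rw [Set.indicator_of_notMem (show h ∉ {h : Path N k | Regen Δ s h} from hr), zero_mul,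
        zero_mul]

/-- Uniqueness of the law, applied to the weighted image measure of `isLaw_shift`, whose total mass
is the first factor on the right. -/
theorem lintegral_regen [IsProbabilityMeasure P] (hν : Memoryless ν Δ) (hP : IsLaw ν P) {s m : ℕ}
    {g f f' : Path N k → ℝ≥0∞} (hg : Adapted s g) (hf : Adapted m f)
    (hff : ∀ h, Regen Δ s h → (∀ n, Valid Δ n h) → f' h = f (shift Δ s h)) :
    ∫⁻ h, {h | Regen Δ s h}.indicator g h * f' h ∂P =
      (∫⁻ h, {h | Regen Δ s h}.indicator g h ∂P) * ∫⁻ h, f h ∂P := by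
  have hG : Adapted (s + 1) ({h | Regen Δ s h}.indicator g) := (hg.mono s.le_succ).regen Δ le_rfl
  have h1 := IsLaw.lintegral_eq hP (isLaw_shift hν hP hg) m f hf
  have h2 := lintegral_withDensity_eq_lintegral_mul P hG.measurable
      (hf.measurable.comp (measurable_shift Δ s))
  simp only [Function.comp_apply] at h2
  rw [lintegral_map hf.measurable (measurable_shift Δ s), h2,
    Measure.map_apply (measurable_shift Δ s) MeasurableSet.univ, Set.preimage_univ,
    withDensity_apply _ MeasurableSet.univ, Measure.restrict_univ] at h1
  rw [← h1]
  refine lintegral_congr_ae ?_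
  filter_upwards [ae_valid hν hP] with h hv
  by_cases hr : Regen Δ s h
  · rw [hff h hr hv]; rfl
  · simp [hr]

end regen

end Ledger

/-! ### Memorylessness of the exponential marks. -/

namespace Ledger

variable {N k : ℕ}

/-- Translate by `c`: the density at `w + c` is `exp (-(r * c))` times the density at `w`. -/
theorem setLIntegral_expMeasure_sub {r : ℝ} {c : ℝ} (hc : 0 ≤ c) {f : ℝ → ℝ≥0∞}
    (hf : Measurable f) :
    ∫⁻ w in Set.Ioi c, f (w - c) ∂(expMeasure r) =
      ENNReal.ofReal (Real.exp (-(r * c))) * ∫⁻ w, f w ∂(expMeasure r) := by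
  have hm : Measurable (exponentialPDF r) := (measurable_exponentialPDFReal r).ennreal_ofReal
  have he : expMeasure r = volume.withDensity (exponentialPDF r) := rfl
  have hfc : Measurable fun w => f (w - c) := hf.comp (measurable_id.sub_const c)
  rw [he, ← lintegral_indicator measurableSet_Ioi,
    lintegral_withDensity_eq_lintegral_mul _ hm (hfc.indicator measurableSet_Ioi),
    lintegral_withDensity_eq_lintegral_mul _ hm hf, ← lintegral_const_mul _ (hm.mul hf),
    ← lintegral_add_right_eq_self _ c]
  refine lintegral_congr_ae ?_
  -- At `w = 0` the translated open half-line misses the point while the density need not vanish;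
  -- this null set is discarded.
  filter_upwards [compl_mem_ae_iff.2 (measure_singleton (0 : ℝ))] with w hw
  have hw0 : w ≠ 0 := hw
  simp only [Pi.mul_apply]
  rcases lt_or_gt_of_ne hw0 with h | h
  · rw [Set.indicator_of_notMem (by simpa using h.le), exponentialPDF_of_neg h]
    simp
  · rw [Set.indicator_of_mem (by simpa using h), exponentialPDF_of_nonneg h.le,
      exponentialPDF_of_nonneg (by linarith), ← mul_assoc, ← ENNReal.ofReal_mul (Real.exp_nonneg _),
      mul_left_comm, ← Real.exp_add]
    simp only [add_sub_cancel_right]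
    ring_nf

theorem expMeasure_Ioi {r : ℝ} (hr : 0 < r) {c : ℝ} (hc : 0 ≤ c) :
    expMeasure r (Set.Ioi c) = ENNReal.ofReal (Real.exp (-(r * c))) := by
  have := isProbabilityMeasure_expMeasure hr
  simpa using setLIntegral_expMeasure_sub (r := r) hc (f := fun _ => 1) measurable_const

theorem ae_nonneg_expMeasure {r : ℝ} (hr : 0 < r) : ∀ᵐ w ∂(expMeasure r), 0 ≤ w := by
  have := isProbabilityMeasure_expMeasure hr
  have h1 := expMeasure_Ioi hr le_rfl
  rw [mul_zero, neg_zero, Real.exp_zero, ENNReal.ofReal_one] at h1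
  filter_upwards [(prob_compl_eq_zero_iff measurableSet_Ioi).2 h1] with w hw
  exact le_of_lt hw

variable {rate : Fin N → ℝ≥0} {D : Fin N → Measure (Fin N → ℝ≥0)}

theorem ae_issuerDelayLaw [∀ i, IsProbabilityMeasure (D i)] {p : (Fin N → ℝ≥0) → Prop}
    (h : ∀ i, ∀ᵐ d ∂(D i), p d) : ∀ᵐ z ∂(issuerDelayLaw rate D), p z.2 := by
  rw [issuerDelayLaw, ← Measure.sum_fintype, Measure.ae_sum_iff]
  intro i
  exact Measure.ae_smul_measure (Measure.quasiMeasurePreserving_snd.ae (h i)) _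

theorem memoryless_markLaw (hrate : 0 < ∑ i, rate i) [∀ i, IsProbabilityMeasure (D i)]
    [IsProbabilityMeasure (markLaw rate D)]
    {Δ : ℝ≥0} (h : ∀ i j, ∀ᵐ d ∂(D i), d j ≤ Δ) : Memoryless (markLaw rate D) Δ := by
  have hr : (0 : ℝ) < ((∑ j, rate j : ℝ≥0) : ℝ) := by exact_mod_cast hrate
  have := isProbabilityMeasure_expMeasure hr
  have hfin : IsFiniteMeasure (issuerDelayLaw rate D) := by
    refine ⟨?_⟩
    simp only [issuerDelayLaw, Measure.coe_finsetSum, Finset.sum_apply, Measure.smul_apply,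
      measure_univ, smul_eq_mul, mul_one]
    exact ENNReal.sum_lt_top.2 fun i _ => ENNReal.coe_lt_top
  -- The total mass is read off from the product with the exponential law, without summing the
  -- normalized rates.
  have hprob : issuerDelayLaw rate D Set.univ = 1 := by
    have h1 : markLaw rate D Set.univ = 1 := measure_univ
    rwa [markLaw, ← Set.univ_prod_univ, Measure.prod_prod, measure_univ, one_mul] at h1
  have hset : {z : Mark N | (Δ : ℝ) < z.1} = Set.Ioi (Δ : ℝ) ×ˢ Set.univ := by ext; simp
  have hgap : markLaw rate D {z | (Δ : ℝ) < z.1} =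
      ENNReal.ofReal (Real.exp (-(((∑ j, rate j : ℝ≥0) : ℝ) * Δ))) := by
    rw [hset, markLaw, Measure.prod_prod, hprob, mul_one, expMeasure_Ioi hr (NNReal.coe_nonneg Δ)]
  refine ⟨?_, ?_, ?_, ?_⟩
  · exact Measure.quasiMeasurePreserving_fst.ae (ae_nonneg_expMeasure hr)
  · exact Measure.quasiMeasurePreserving_snd.ae
      (ae_issuerDelayLaw (p := fun d => ∀ i, d i ≤ Δ) fun i => ae_all_iff.2 (h i))
  · rw [hgap]
    exact ENNReal.ofReal_pos.2 (Real.exp_pos _)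
  · intro ψ hψ
    rw [hgap, hset, markLaw, ← Measure.prod_restrict, Measure.restrict_univ,
      lintegral_prod_symm _ ?_, lintegral_prod_symm _ hψ.aemeasurable, ← lintegral_const_mul]
    · refine lintegral_congr fun y => ?_
      exact setLIntegral_expMeasure_sub (NNReal.coe_nonneg Δ) (hψ.comp measurable_prodMk_right)
    · exact hψ.lintegral_prod_left'
    · exact (hψ.comp ((measurable_fst.sub_const _).prodMk measurable_snd)).aemeasurable

end Ledger

/-! ### The age, and the discrepancy between local and observer pools. -/

namespace Ledger

open BlockProcess

variable {N k : ℕ}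

/-- The number of blocks among the first `n` that were issued since the last waiting time
longer than `Δ`. -/
def age (Δ : ℝ≥0) : ℕ → Path N k → ℕ
  | 0, _ => 0
  | n + 1, h => if (Δ : ℝ) < coord.time (n + 1) h - coord.time n h then 1 else age Δ n h + 1

@[fun_prop]
theorem measurable_age (Δ : ℝ≥0) (n : ℕ) : Measurable (age (N := N) (k := k) Δ n) := by
  induction n with
  | zero => exact measurable_const
  | succ n ih => exact Measurable.ite (measurableSet_gap Δ n) measurable_const (ih.add_const 1)

section age

variable {Δ : ℝ≥0} {n q : ℕ} {h : Path N k} {i : Fin N}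

theorem age_eq (Δ : ℝ≥0) (n : ℕ) (h : Path N k) : age Δ n h = n ∨
    ∃ j, 1 ≤ j ∧ j ≤ n ∧ j + age Δ n h = n + 1 ∧
      (Δ : ℝ) < coord.time j h - coord.time (j - 1) h := by
  induction n with
  | zero => exact Or.inl rfl
  | succ n ih =>
    by_cases hg : (Δ : ℝ) < coord.time (n + 1) h - coord.time n h
    · refine Or.inr ⟨n + 1, by omega, le_rfl, ?_, hg⟩
      rw [age, if_pos hg]
    · rw [age, if_neg hg]
      rcases ih with h1 | ⟨j, h1, h2, h3, h4⟩
      · exact Or.inl (by omega)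
      · exact Or.inr ⟨j, h1, by omega, by omega, h4⟩

/-- Anything older than the age was issued before the last long wait, hence has arrived everywhere.
-/
theorem lt_add_age (hv : Valid Δ n h) (hnq : n ≤ q)
    (ht : ∀ m < q, coord.time m h ≤ coord.time (m + 1) h) {a : ℕ} (h1 : 1 ≤ a) (ha : a ≤ n)
    (har : a ∉ coord.received q i h) : n < a + age Δ n h := by
  by_contra! hc
  rcases age_eq Δ n h with h2 | ⟨j, h2, h3, h4, h5⟩
  · omega
  · exact har (mem_received_of_gap ht (hv.delay_le a h1 ha i) h5 h1 (by omega) (by omega))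

/-- A stale local tip is referenced by a block still in transit. At most `age` blocks are in
transit, each with at most `k` distinct references. -/
theorem card_localPool_sdiff_le (hv : Valid Δ n h) (hnq : n ≤ q) (hq : q ≤ n + 1)
    (ht : ∀ m < q, coord.time m h ≤ coord.time (m + 1) h) (i : Fin N) :
    (coord.localPool q i h \ coord.observerPool n h).card ≤ k * age Δ n h := by
  have hsub : coord.localPool q i h \ coord.observerPool n h ⊆
      (Finset.Ioc (n - age Δ n h) n).biUnion fun c => coord.refSet c h := by
    intro a ha
    rw [Finset.mem_sdiff, mem_observerPool, not_and] at ha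
    have han : a ≤ n := by
      have := ha.1
      rw [mem_localPool, mem_received] at this
      omega
    have h2 := ha.2 han
    push Not at h2
    obtain ⟨c, h1, hc, l, hl⟩ := h2
    have h3 := lt_add_age (i := i) hv hnq ht h1 hc
      fun hr => (mem_localPool.1 ha.1).2 c hr l hl
    exact Finset.mem_biUnion.2 ⟨c, Finset.mem_Ioc.2 ⟨by omega, hc⟩, mem_refSet.2 ⟨l, hl⟩⟩
  refine (Finset.card_le_card hsub).trans ?_
  refine (Finset.card_biUnion_le_card_mul _ _ k fun c _ => ?_).trans ?_
  · refine Finset.card_image_le.trans ?_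
    simp
  · rw [mul_comm, Nat.card_Ioc]
    exact Nat.mul_le_mul_left k (by omega)

/-- An observer tip is referenced by nobody, so a node can lack it only because the tip itself is
still in transit. -/
theorem card_observerPool_sdiff_le (hv : Valid Δ n h)
    (ht : ∀ m < n + 1, coord.time m h ≤ coord.time (m + 1) h) (i : Fin N) :
    (coord.observerPool n h \ coord.localPool (n + 1) i h).card ≤ age Δ n h := by
  have hsub : coord.observerPool n h \ coord.localPool (n + 1) i h ⊆
      Finset.Ioc (n - age Δ n h) n := by
    intro a ha
    rw [Finset.mem_sdiff, mem_observerPool, mem_localPool] at ha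
    have hrec : ∀ m ∈ coord.received (n + 1) i h, ∀ l, coord.ref m h l ≠ a := fun m hm l =>
      ha.1.2 m (mem_received.1 hm).1.1 (by have := (mem_received.1 hm).1.2; omega) l
    have ha0 : ¬ (a = 0 ∨ a ∈ coord.received (n + 1) i h) := fun h2 => ha.2 ⟨h2, hrec⟩
    push Not at ha0
    have := lt_add_age hv n.le_succ ht (by omega) ha.1.1 ha0.2
    exact Finset.mem_Ioc.2 ⟨by omega, ha.1.1⟩
  refine (Finset.card_le_card hsub).trans ?_
  rw [Nat.card_Ioc]
  omega

theorem localTips_le (hv : Valid Δ n h) (i : Fin N) :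
    localTips i n h ≤ tips n h + k * age Δ n h := by
  have h1 := card_localPool_sdiff_le hv le_rfl n.le_succ hv.time_le i
  have h2 := Finset.card_le_card_sdiff_add_card (s := coord.localPool n i h)
    (t := coord.observerPool n h)
  rw [localTips, tips]
  omega

end age

/-! ### Two of the `k` uniform draws. -/

section draws

theorem tsum_unif_mul_mul {S : Finset ℕ} (hS : S.Nonempty) {i j : Fin k} (hij : i ≠ j)
    (φ ψ : ℕ → ℝ≥0∞) :
    ∑' r : Fin k → ℕ, unif S r * (φ (r i) * ψ (r j)) =
      ((S.card : ℝ≥0∞)⁻¹ * ∑ a ∈ S, φ a) * ((S.card : ℝ≥0∞)⁻¹ * ∑ a ∈ S, ψ a) := by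
  set w : Fin k → ℕ → ℝ≥0∞ := fun l a =>
    (S.card : ℝ≥0∞)⁻¹ * ((if l = i then φ a else 1) * (if l = j then ψ a else 1)) with hw
  have h1 := Finset.prod_univ_sum (fun _ : Fin k => S) w
  have h2 (r : Fin k → ℕ) : ∏ l, w l (r l) = ((S.card : ℝ≥0∞)⁻¹) ^ k * (φ (r i) * ψ (r j)) := by
    simp only [hw, Finset.prod_mul_distrib, Finset.prod_const, Finset.card_univ, Fintype.card_fin,
      Finset.prod_ite_eq', Finset.mem_univ, if_true]
  have hc : (S.card : ℝ≥0∞)⁻¹ * S.card = 1 :=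
    ENNReal.inv_mul_cancel (by simpa using hS.ne_empty) (by simp)
  have h3 (l : Fin k) : ∑ a ∈ S, w l a =
      (if l = i then (S.card : ℝ≥0∞)⁻¹ * ∑ a ∈ S, φ a else 1) *
        (if l = j then (S.card : ℝ≥0∞)⁻¹ * ∑ a ∈ S, ψ a else 1) := by
    simp only [hw, ← Finset.mul_sum]
    by_cases h4 : l = i
    · have h5 : l ≠ j := h4 ▸ hij
      simp [h4, hij]
    · by_cases h5 : l = j
      · simp [h5, hij.symm]
      · simp [h4, h5, hc]
  rw [tsum_unif_mul, ← Finset.sum_congr rfl fun r _ => h2 r, ← h1, Finset.prod_congr rfl fun l _ => h3 l]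
  simp only [Finset.prod_mul_distrib, Finset.prod_ite_eq', Finset.mem_univ, if_true]

/-- The probability that two draws from `S` do not hit two different elements of `O`. -/
theorem tsum_unif_bad_le {S O : Finset ℕ} (hS : S.Nonempty) {i j : Fin k} (hij : i ≠ j) :
    ∑' r : Fin k → ℕ, unif S r * (if r i ∉ O ∨ r j ∉ O ∨ r i = r j then 1 else 0) ≤
      (S.card : ℝ≥0∞)⁻¹ * (2 * (S \ O).card + 1 : ℕ) := by
  have hc : (S.card : ℝ≥0∞)⁻¹ * S.card = 1 :=
    ENNReal.inv_mul_cancel (by simpa using hS.ne_empty) (by simp)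
  have hO : ∑ a ∈ S, (if a ∉ O then (1 : ℝ≥0∞) else 0) = (S \ O).card := by
    rw [Finset.sum_boole, Finset.sdiff_eq_filter]
  calc ∑' r : Fin k → ℕ, unif S r * (if r i ∉ O ∨ r j ∉ O ∨ r i = r j then 1 else 0)
      -- Union bound. The coincidence of the two draws is written as a sum over its common value
      -- `a`, so that every term is a product of a function of `r i` and one of `r j` and
      -- factorizes.
      ≤ ∑' r : Fin k → ℕ, (unif S r * ((if r i ∉ O then 1 else 0) * 1) +
          unif S r * (1 * (if r j ∉ O then 1 else 0)) +
          ∑ a ∈ S, unif S r * ((if r i = a then 1 else 0) * (if r j = a then 1 else 0))) := by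
        refine ENNReal.tsum_le_tsum fun r => ?_
        by_cases hr : ∀ l, r l ∈ S
        · rw [← Finset.mul_sum, ← mul_add, ← mul_add]
          gcongr
          have h1 : ∑ a ∈ S, ((if r i = a then 1 else 0) * (if r j = a then 1 else 0) : ℝ≥0∞) =
              if r i = r j then 1 else 0 := by
            simp only [ite_mul, one_mul, zero_mul, Finset.sum_ite_eq, hr i, if_true]
            simp only [eq_comm]
          rw [h1]
          by_cases h2 : r i ∉ O <;> by_cases h3 : r j ∉ O <;> by_cases h4 : r i = r j <;>
            simp_all
        · simp [unif_of_notMem hr]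
    _ = (S.card : ℝ≥0∞)⁻¹ * (2 * (S \ O).card + 1 : ℕ) := by
        rw [ENNReal.tsum_add, ENNReal.tsum_add, tsum_unif_mul_mul hS hij (fun a => if a ∉ O then 1 else 0)
          (fun _ => 1), tsum_unif_mul_mul hS hij (fun _ => 1) (fun a => if a ∉ O then 1 else 0),
          Summable.tsum_finsetSum fun _ _ => ENNReal.summable]
        have he (a : ℕ) := tsum_unif_mul_mul hS hij (fun b => if b = a then 1 else 0)
          fun b => if b = a then 1 else 0
        rw [Finset.sum_congr rfl fun a _ => he a, hO]
        simp only [Finset.sum_const, nsmul_eq_mul, mul_one, hc, one_mul, Finset.sum_ite_eq']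
        rw [Finset.sum_congr rfl (g := fun _ => (S.card : ℝ≥0∞)⁻¹ * (S.card : ℝ≥0∞)⁻¹)
          fun a ha => by simp [ha]]
        rw [Finset.sum_const, nsmul_eq_mul, ← mul_assoc, mul_comm (S.card : ℝ≥0∞), hc]
        push_cast
        ring

end draws

variable [NeZero N]

theorem age_trunc (Δ : ℝ≥0) {n m : ℕ} (hm : m ≤ n) (h : Path N k) :
    age Δ m (trunc n h) = age Δ m h := by
  induction m with
  | zero => rfl
  | succ m ih =>
    rw [age, age, coord_time_trunc hm, coord_time_trunc (by omega), ih (by omega)]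

theorem age_extend (Δ : ℝ≥0) (n : ℕ) (h : Path N k) (z : Mark N) (r : Fin k → ℕ) :
    age Δ (n + 1) (extend n h z r) = if (Δ : ℝ) < z.1 then 1 else age Δ n h + 1 := by
  have h1 : age Δ n (extend n h z r) = age Δ n h := by
    rw [← age_trunc Δ le_rfl, trunc_extend le_rfl, age_trunc Δ le_rfl]
  simp only [age, gap_extend, h1]

section extend

variable {Δ : ℝ≥0} {n : ℕ} {h : Path N k} {z : Mark N} {r : Fin k → ℕ}

theorem observerPool_extend (n : ℕ) (h : Path N k) (z : Mark N) (r : Fin k → ℕ) :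
    coord.observerPool (n + 1) (extend n h z r) ⊆
      insert (n + 1) (coord.observerPool n h \ Finset.univ.image r) := by
  intro a ha
  rw [mem_observerPool] at ha
  rw [Finset.mem_insert, Finset.mem_sdiff, mem_observerPool]
  by_cases h1 : a = n + 1
  · exact Or.inl h1
  · refine Or.inr ⟨⟨by omega, fun m h2 hm l hl => ?_⟩, ?_⟩
    · refine ha.2 m h2 (by omega) l ?_
      simpa only [coord, extend_apply_of_le h2 hm] using hl
    · intro h2
      obtain ⟨l, -, hl⟩ := Finset.mem_image.1 h2
      refine ha.2 (n + 1) (by omega) le_rfl l ?_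
      rw [coord_ref_extend, hl]

theorem tips_extend_le (n : ℕ) (h : Path N k) (z : Mark N) (r : Fin k → ℕ) :
    tips (n + 1) (extend n h z r) ≤ tips n h + 1 :=
  (Finset.card_le_card (observerPool_extend n h z r)).trans <|
    (Finset.card_insert_le _ _).trans
      (Nat.add_le_add_right (Finset.card_le_card Finset.sdiff_subset) 1)

/-- Two tips disappear and only the new block is added. This is where at least two references are
needed. -/
theorem tips_extend_le_of_ne {i j : Fin k} (hi : r i ∈ coord.observerPool n h)
    (hj : r j ∈ coord.observerPool n h) (hij : r i ≠ r j) :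
    tips (n + 1) (extend n h z r) + 1 ≤ tips n h := by
  have h1 : coord.observerPool n h \ Finset.univ.image r ⊆
      ((coord.observerPool n h).erase (r i)).erase (r j) := by
    intro a ha
    rw [Finset.mem_sdiff] at ha
    rw [Finset.mem_erase, Finset.mem_erase]
    refine ⟨?_, ?_, ha.1⟩
    · rintro rfl; exact ha.2 (Finset.mem_image_of_mem _ (Finset.mem_univ _))
    · rintro rfl; exact ha.2 (Finset.mem_image_of_mem _ (Finset.mem_univ _))
  have h2 := (Finset.card_le_card (observerPool_extend n h z r)).trans
    (Finset.card_insert_le _ _)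
  have h3 := Finset.card_le_card h1
  rw [Finset.card_erase_of_mem (Finset.mem_erase.2 ⟨hij.symm, hj⟩),
    Finset.card_erase_of_mem hi] at h3
  have h4 : 1 < (coord.observerPool n h).card := Finset.one_lt_card.2 ⟨_, hi, _, hj, hij⟩
  rw [tips, tips]
  omega

theorem nextPool_nonempty (hv : Valid Δ n h) (z : Mark N) : (nextPool n h z).Nonempty :=
  localPool_nonempty (hv.extend_of_le z 0) _ le_rfl

theorem card_nextPool_sdiff_le (hv : Valid Δ n h) (hz : 0 ≤ z.1) :
    (nextPool n h z \ coord.observerPool n h).card ≤ k * age Δ n h := by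
  have := card_localPool_sdiff_le (hv.extend_of_le z 0) n.le_succ le_rfl (time_le_extend hv hz 0) z.2.1
  rwa [observerPool_extend_of_le le_rfl, ← age_trunc Δ le_rfl, trunc_extend le_rfl,
    age_trunc Δ le_rfl] at this

theorem tips_le_card_nextPool (hv : Valid Δ n h) (hz : 0 ≤ z.1) :
    tips n h ≤ (nextPool n h z).card + age Δ n h := by
  have h1 := card_observerPool_sdiff_le (hv.extend_of_le z 0) (time_le_extend hv hz 0) z.2.1
  rw [observerPool_extend_of_le le_rfl, ← age_trunc Δ le_rfl, trunc_extend le_rfl,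
    age_trunc Δ le_rfl] at h1
  have h2 := Finset.card_le_card_sdiff_add_card (s := coord.observerPool n h) (t := nextPool n h z)
  rw [tips]
  change (coord.observerPool n h \ nextPool n h z).card ≤ _ at h1
  omega

end extend

end Ledger

/-! ### The Lyapunov function and its drift. -/

namespace Ledger

open BlockProcess

variable {N k : ℕ}

/-- The Lyapunov function `x ^ L + B * y ^ A` of the number `L` of tips and the age `A`. -/
def lyapunov (Δ x y B : ℝ≥0) (n : ℕ) (h : Path N k) : ℝ≥0∞ :=
  (x : ℝ≥0∞) ^ tips n h + B * (y : ℝ≥0∞) ^ age Δ n h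

theorem measurable_lyapunov (Δ x y B : ℝ≥0) (n : ℕ) :
    Measurable (lyapunov (N := N) (k := k) Δ x y B n) :=
  ((measurable_of_countable fun a : ℕ => (x : ℝ≥0∞) ^ a).comp (measurable_tips n)).add
    (measurable_const.mul
      ((measurable_of_countable fun a : ℕ => (y : ℝ≥0∞) ^ a).comp (measurable_age Δ n)))

/-- Both conditions are open and hold at `x = 1`, since long waits have positive probability. They
are imposed on `x ^ 2` because the Lyapunov function with base `x ^ 2` is needed for second moments.
-/
theorem exists_base {ν : Measure (Mark N)} [IsProbabilityMeasure ν] {Δ : ℝ≥0}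
    (hν : Memoryless ν Δ) (q : ℕ) : ∃ x : ℝ≥0, 1 < x ∧ x ^ 2 < 3 ∧
    ν {z | (Δ : ℝ) < z.1}ᶜ * ((x ^ 2 : ℝ≥0) : ℝ≥0∞) ^ q < 1 := by
  have hθ : ν {z : Mark N | (Δ : ℝ) < z.1}ᶜ < 1 := by
    rw [prob_compl_eq_one_sub (measurableSet_gap_mark Δ)]
    exact ENNReal.sub_lt_self ENNReal.one_ne_top one_ne_zero hν.gap_pos.ne'
  obtain ⟨θ, hθ'⟩ : ∃ θ : ℝ≥0, (θ : ℝ≥0∞) = ν {z : Mark N | (Δ : ℝ) < z.1}ᶜ :=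
    ⟨_, ENNReal.coe_toNNReal (hθ.trans ENNReal.one_lt_top).ne⟩
  rw [← hθ'] at hθ ⊢
  have hθ1 : θ < 1 := by exact_mod_cast hθ
  have hc : Continuous fun x : ℝ≥0 => (x ^ 2, θ * (x ^ 2) ^ q) := by fun_prop
  have hopen : IsOpen {x : ℝ≥0 | x ^ 2 < 3 ∧ θ * (x ^ 2) ^ q < 1} :=
    (isOpen_lt (by fun_prop) continuous_const).inter (isOpen_lt (by fun_prop) continuous_const)
  have h1 : {x : ℝ≥0 | x ^ 2 < 3 ∧ θ * (x ^ 2) ^ q < 1} ∈ 𝓝 (1 : ℝ≥0) :=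
    hopen.mem_nhds ⟨by norm_num, by simpa using hθ1⟩
  obtain ⟨x, hx, hx1⟩ := Filter.nonempty_of_mem
    (inter_mem (mem_nhdsWithin_of_mem_nhds (t := Set.Ioi (1 : ℝ≥0)) h1) self_mem_nhdsWithin)
  exact ⟨x, hx1, hx.1, by exact_mod_cast hx.2⟩

variable [NeZero N]

theorem adapted_lyapunov (Δ x y B : ℝ≥0) (n : ℕ) :
    Adapted n (lyapunov (N := N) (k := k) Δ x y B n) :=
  ⟨measurable_lyapunov Δ x y B n, fun h => by
    rw [lyapunov, lyapunov, tips_trunc le_rfl, age_trunc Δ le_rfl]⟩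

section drift

variable {Δ : ℝ≥0} {n : ℕ} {h : Path N k} {z : Mark N}

theorem tsum_unif_bad_nextPool_le (hv : Valid Δ n h) (hz : 0 ≤ z.1) {i j : Fin k} (hij : i ≠ j)
    (hA : (16 * k + 2) * age Δ n h ≤ tips n h) (hL : 8 ≤ tips n h) :
    ∑' r : Fin k → ℕ, unif (nextPool n h z) r *
      (if r i ∉ coord.observerPool n h ∨ r j ∉ coord.observerPool n h ∨ r i = r j then 1 else 0) ≤
        (4 : ℝ≥0∞)⁻¹ := by
  refine (tsum_unif_bad_le (nextPool_nonempty hv z) hij).trans ?_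
  have h1 := card_nextPool_sdiff_le hv hz
  have h2 := tips_le_card_nextPool hv hz
  -- Write `A` for the age. Half of the tips number at least `(8 * k + 1) * A`, the other half at
  -- least `4`. After losing the `A` tips that may be in transit, at least `8 * k * A + 4` remain in
  -- the pool.
  have h3 : 4 * (2 * (nextPool n h z \ coord.observerPool n h).card + 1) ≤
      (nextPool n h z).card := by nlinarith
  have h4 : (4 : ℝ≥0∞) * (2 * (nextPool n h z \ coord.observerPool n h).card + 1 : ℕ) ≤
      (nextPool n h z).card := by exact_mod_cast h3
  have h5 : ((nextPool n h z).card : ℝ≥0∞) ≠ 0 := by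
    simpa using (nextPool_nonempty hv z).ne_empty
  rw [mul_comm, ← div_eq_mul_inv, ENNReal.div_le_iff h5 (by simp)]
  exact (ENNReal.mul_le_iff_le_inv (by simp) (by simp)).1 h4

/-- Three regimes, one summand each: few tips are bounded by a constant; tips outnumbered by a
multiple of the age are bounded by a power of the age; in the remaining case a bad draw has
probability at most `1/4` and the number of tips drifts down. -/
theorem tsum_unif_pow_tips_le (hk : 2 ≤ k) (hv : Valid Δ n h) (hz : 0 ≤ z.1) {x η γ : ℝ≥0}
    (hx : 1 ≤ x) (hη : x ^ 2 = 1 + η) (hγ : 1 + η / 4 ≤ γ * x) :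
    ∑' r : Fin k → ℕ, unif (nextPool n h z) r * (x : ℝ≥0∞) ^ tips (n + 1) (extend n h z r) ≤
      γ * (x : ℝ≥0∞) ^ tips n h + (x : ℝ≥0∞) ^ 8 +
        x * ((x : ℝ≥0∞) ^ (16 * k + 2)) ^ age Δ n h := by
  have hne := nextPool_nonempty hv z
  have hx' : (1 : ℝ≥0∞) ≤ x := by exact_mod_cast hx
  have hcrude (c : ℕ) (hc : tips n h + 1 ≤ c) :
      ∑' r : Fin k → ℕ, unif (nextPool n h z) r * (x : ℝ≥0∞) ^ tips (n + 1) (extend n h z r) ≤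
        (x : ℝ≥0∞) ^ c := by
    refine (ENNReal.tsum_le_tsum fun r => ?_).trans (tsum_unif_mul_const hne ((x : ℝ≥0∞) ^ c)).le
    gcongr
    exact (tips_extend_le n h z r).trans hc
  rcases Nat.lt_or_ge (tips n h) 8 with hL | hL
  · exact (hcrude 8 hL).trans (le_add_right (le_add_left le_rfl))
  rcases Nat.lt_or_ge (tips n h) ((16 * k + 2) * age Δ n h) with hA | hA
  · refine (hcrude ((16 * k + 2) * age Δ n h) hA).trans (le_add_left ?_)
    rw [← pow_mul]
    exact le_mul_of_one_le_left' hx'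
  refine le_add_right (le_add_right ?_)
  set i : Fin k := ⟨0, by omega⟩
  set j : Fin k := ⟨1, by omega⟩
  have hij : i ≠ j := by simp [i, j]
  obtain ⟨L, hL'⟩ : ∃ L, tips n h = L + 1 := ⟨tips n h - 1, by omega⟩
  have hx2 : (x : ℝ≥0∞) ^ 2 = 1 + η := by exact_mod_cast hη
  -- With `L + 1` tips before the step, a good draw leaves at most `L` and a bad one at most `L +
  -- 2`. The latter costs the extra `η * x ^ L`, where `η = x ^ 2 - 1`.
  calc ∑' r : Fin k → ℕ, unif (nextPool n h z) r * (x : ℝ≥0∞) ^ tips (n + 1) (extend n h z r)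
      ≤ ∑' r : Fin k → ℕ, (unif (nextPool n h z) r * (x : ℝ≥0∞) ^ L +
          (unif (nextPool n h z) r * (if r i ∉ coord.observerPool n h ∨
            r j ∉ coord.observerPool n h ∨ r i = r j then 1 else 0)) *
            (η * (x : ℝ≥0∞) ^ L)) := by
        refine ENNReal.tsum_le_tsum fun r => ?_
        rw [mul_assoc, ← mul_add]
        gcongr
        split_ifs with hb
        · rw [one_mul]
          calc (x : ℝ≥0∞) ^ tips (n + 1) (extend n h z r) ≤ (x : ℝ≥0∞) ^ (2 + L) :=
                pow_le_pow_right₀ hx' ((tips_extend_le n h z r).trans (by omega))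
            _ = (x : ℝ≥0∞) ^ L + η * (x : ℝ≥0∞) ^ L := by rw [pow_add, hx2]; ring
        · push Not at hb
          have := tips_extend_le_of_ne (n := n) (h := h) (z := z) hb.1 hb.2.1 hb.2.2
          rw [zero_mul, add_zero]
          exact pow_le_pow_right₀ hx' (by omega)
    _ ≤ (x : ℝ≥0∞) ^ L + (4 : ℝ≥0∞)⁻¹ * (η * (x : ℝ≥0∞) ^ L) := by
        rw [ENNReal.tsum_add, tsum_unif_mul_const hne, ENNReal.tsum_mul_right]
        gcongr
        exact tsum_unif_bad_nextPool_le hv hz hij hA hL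
    _ = ((1 + η / 4 : ℝ≥0) : ℝ≥0∞) * (x : ℝ≥0∞) ^ L := by
        push_cast
        rw [div_eq_mul_inv]
        ring
    _ ≤ ((γ * x : ℝ≥0) : ℝ≥0∞) * (x : ℝ≥0∞) ^ L := by gcongr
    _ = γ * (x : ℝ≥0∞) ^ tips n h := by rw [hL']; push_cast; ring

variable {ν : Measure (Mark N)} [IsProbabilityMeasure ν]

/-- The age grows by one with probability less than one and otherwise restarts at `1`, so `y ^ age`
contracts up to a constant. Its weight `B` is chosen so large that this contraction also absorbs the
error term `x * y ^ age` of the tip estimate. -/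
theorem step_lyapunov_le (hk : 2 ≤ k) (hν : Memoryless ν Δ) (hv : Valid Δ n h)
    {x y η γ B κ C : ℝ≥0} (hx : 1 ≤ x) (hη : x ^ 2 = 1 + η) (hγ : 1 + η / 4 ≤ γ * x)
    (hy : y = x ^ (16 * k + 2)) (hκ : ν {z | (Δ : ℝ) < z.1}ᶜ * y ≤ κ) (hB : x + B * κ ≤ γ * B)
    (hC : C = x ^ 8 + B * y) :
    step ν n (lyapunov Δ x y B (n + 1)) h ≤ γ * lyapunov Δ x y B n h + C := by
  have hne := nextPool_nonempty (h := h) hv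
  have hm := measurableSet_gap_mark (N := N) Δ
  have hy' : (y : ℝ≥0∞) = (x : ℝ≥0∞) ^ (16 * k + 2) := by rw [hy]; push_cast; rfl
  set V₁ : ℝ≥0∞ := γ * (x : ℝ≥0∞) ^ tips n h + (x : ℝ≥0∞) ^ 8 + x * (y : ℝ≥0∞) ^ age Δ n h
  calc step ν n (lyapunov Δ x y B (n + 1)) h
      ≤ ∫⁻ z, ((V₁ + B * y) + {z | (Δ : ℝ) < z.1}ᶜ.indicator
          (fun _ => B * (y * (y : ℝ≥0∞) ^ age Δ n h)) z) ∂ν := by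
        refine lintegral_mono_ae ?_
        filter_upwards [hν.ae_nonneg] with z hz
        simp only [lyapunov, mul_add, ENNReal.tsum_add, add_assoc (a := V₁)]
        refine add_le_add ((tsum_unif_pow_tips_le hk hv hz hx hη hγ).trans (by rw [← hy'])) ?_
        simp only [age_extend]
        rw [tsum_unif_mul_const (hne z)]
        by_cases hg : (Δ : ℝ) < z.1
        · rw [if_pos hg, pow_one]; exact le_self_add
        · rw [if_neg hg, Set.indicator_of_mem (show z ∈ {z : Mark N | (Δ : ℝ) < z.1}ᶜ from hg),
            pow_succ']
          exact le_add_self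
    _ = V₁ + B * y + B * (ν {z | (Δ : ℝ) < z.1}ᶜ * y) * (y : ℝ≥0∞) ^ age Δ n h := by
        rw [lintegral_add_left measurable_const, lintegral_const, measure_univ, mul_one,
          lintegral_indicator hm.compl, setLIntegral_const]
        ring
    _ ≤ V₁ + B * y + B * κ * (y : ℝ≥0∞) ^ age Δ n h := by gcongr
    _ = γ * (x : ℝ≥0∞) ^ tips n h + ((x + B * κ : ℝ≥0) : ℝ≥0∞) * (y : ℝ≥0∞) ^ age Δ n h + C := by
        rw [hC]; push_cast; ring
    _ ≤ γ * (x : ℝ≥0∞) ^ tips n h + ((γ * B : ℝ≥0) : ℝ≥0∞) * (y : ℝ≥0∞) ^ age Δ n h + C := by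
        gcongr
    _ = γ * lyapunov Δ x y B n h + C := by rw [lyapunov]; push_cast; ring

theorem exists_drift (hk : 2 ≤ k) (hν : Memoryless ν Δ) {x : ℝ≥0} (hx : 1 < x) (hx3 : x < 3)
    (hxν : ν {z | (Δ : ℝ) < z.1}ᶜ * (x : ℝ≥0∞) ^ (16 * k + 2) < 1) :
    ∃ B γ C : ℝ≥0, 0 < B ∧ γ < 1 ∧ ∀ n (h : Path N k), Valid Δ n h →
      step ν n (lyapunov Δ x (x ^ (16 * k + 2)) B (n + 1)) h ≤
        γ * lyapunov Δ x (x ^ (16 * k + 2)) B n h + C := by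
  set κ : ℝ≥0 := (ν {z | (Δ : ℝ) < z.1}ᶜ * (x : ℝ≥0∞) ^ (16 * k + 2)).toNNReal with hκ
  have hκ1 : (κ : ℝ≥0∞) = ν {z | (Δ : ℝ) < z.1}ᶜ * (x : ℝ≥0∞) ^ (16 * k + 2) :=
    ENNReal.coe_toNNReal (hxν.trans ENNReal.one_lt_top).ne
  have hκlt : κ < 1 := by rw [← hκ1] at hxν; exact_mod_cast hxν
  set η : ℝ≥0 := x ^ 2 - 1
  have hη : x ^ 2 = 1 + η := (add_tsub_cancel_of_le (one_le_pow₀ hx.le)).symm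
  have hηr : (x : ℝ) ^ 2 = 1 + η := by exact_mod_cast hη
  have hxr : (1 : ℝ) < x := by exact_mod_cast hx
  have hx3r : (x : ℝ) < 3 := by exact_mod_cast hx3
  have hκr : (κ : ℝ) < 1 := by exact_mod_cast hκlt
  have hκ0 : (0 : ℝ) ≤ κ := κ.2
  -- The first entry contracts the tips: `1 + (x ^ 2 - 1) / 4 < x` means `(x - 1) * (x - 3) < 0`,
  -- whence the bound `3` on `x`. The second contracts the age, and `B` makes `x + B * κ` equal to
  -- `B * (1 + κ) / 2`.
  set γ : ℝ≥0 := max ((1 + η / 4) / x) ((1 + κ) / 2) with hγ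
  set B : ℝ≥0 := 2 * x / (1 - κ) with hB
  have h1κ : (0 : ℝ) < 1 - κ := by linarith
  have hBr : (B : ℝ) * (1 - κ) = 2 * x := by
    rw [hB, NNReal.coe_div, NNReal.coe_sub hκlt.le]
    push_cast
    field_simp
  have hB0 : (0 : ℝ) < B := (pos_iff_pos_of_mul_pos (by rw [hBr]; linarith)).2 h1κ
  refine ⟨B, γ, x ^ 8 + B * x ^ (16 * k + 2), by exact_mod_cast hB0, ?_, fun n h hv =>
    step_lyapunov_le hk hν hv hx.le hη ?_ rfl (by rw [hκ1]; push_cast; rfl) ?_ rfl⟩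
  · refine max_lt ?_ ?_
    · rw [div_lt_one (by positivity), ← NNReal.coe_lt_coe]
      push_cast
      nlinarith
    · rw [← NNReal.coe_lt_coe]
      push_cast
      linarith
  · rw [← div_le_iff₀ (by positivity)]
    exact le_max_left _ _
  · refine le_trans ?_ (mul_le_mul_left (le_max_right _ _) B)
    rw [← NNReal.coe_le_coe]
    push_cast
    nlinarith

end drift

end Ledger

/-! ### Regeneration with probability bounded below, and observables. -/

namespace Ledger

open BlockProcess

variable {N k : ℕ} [NeZero N] {ν : Measure (Mark N)} {Δ : ℝ≥0}

section minorization

variable {n : ℕ} {h : Path N k}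

theorem tips_extend_le_one {z : Mark N} {r : Fin k → ℕ} (hs : tips n h ≤ 1) {i : Fin k}
    (hr : r i ∈ coord.observerPool n h) : tips (n + 1) (extend n h z r) ≤ 1 := by
  have h1 : coord.observerPool n h \ Finset.univ.image r = ∅ := by
    refine Finset.sdiff_eq_empty_iff_subset.2 fun a ha => ?_
    rw [Finset.card_le_one.1 hs a ha _ hr]
    exact Finset.mem_image_of_mem _ (Finset.mem_univ _)
  have h2 := Finset.card_le_card (observerPool_extend n h z r)
  rwa [h1, insert_empty_eq, Finset.card_singleton] at h2

/-- After a long wait it suffices to keep the single tuple that references the oldest and the newest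
tip. If they coincide there was one tip, and one tip remains. -/
theorem le_step_gap_tips (hk : 2 ≤ k) (hv : Valid Δ n h) {ℓ K : ℕ} (hs : tips n h ≤ ℓ + 1)
    (hK : ℓ + 1 ≤ K) (hℓ : 1 ≤ ℓ) :
    ν {z | (Δ : ℝ) < z.1} * ((K : ℝ≥0∞)⁻¹) ^ k ≤
      step ν n ({h : Path N k | (Δ : ℝ) < coord.time (n + 1) h - coord.time n h}.indicator
        ({h | tips (n + 1) h ≤ ℓ}.indicator fun _ => 1)) h := by
  have hne : (coord.observerPool n h).Nonempty := ⟨n, hv.mem_observerPool⟩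
  set O := coord.observerPool n h with hO
  set i : Fin k := ⟨0, by omega⟩
  set j : Fin k := ⟨1, by omega⟩
  set r : Fin k → ℕ := fun l => if l = i then O.min' hne else O.max' hne with hr
  have hri : r i = O.min' hne := by simp [hr]
  have hrj : r j = O.max' hne := by simp [hr, i, j]
  have hmem : ∀ l, r l ∈ O := fun l => by
    simp only [hr]; split_ifs
    · exact O.min'_mem hne
    · exact O.max'_mem hne
  rw [step_gap _ hv, mul_comm, ← setLIntegral_const]
  refine lintegral_mono fun z => ?_
  have htips : tips (n + 1) (extend n h z r) ≤ ℓ := by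
    rcases Nat.lt_or_ge 1 (tips n h) with h1 | h1
    · have h2 : r i ≠ r j := by
        rw [hri, hrj]
        exact (Finset.min'_lt_max'_of_card O h1).ne
      have := tips_extend_le_of_ne (n := n) (h := h) (z := z) (hmem i) (hmem j) h2
      omega
    · exact (tips_extend_le_one h1 (hmem i)).trans hℓ
  refine le_trans ?_ (ENNReal.le_tsum r)
  rw [Set.indicator_of_mem (show extend n h z r ∈ {h : Path N k | tips (n + 1) h ≤ ℓ} from htips),
    mul_one, unif_of_mem hmem]
  gcongr
  exact hs.trans hK

end minorization

variable [IsProbabilityMeasure ν] {P : Measure (Path N k)}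

/-- The drift is iterated with the enlarged constant `C / (1 - γ)`, the fixed point of `u ↦ γ * u +
C`. The resulting bound is uniform in the number of steps, as long as there is at least one. -/
theorem exists_lintegral_lyapunov_le (hk : 2 ≤ k) (hν : Memoryless ν Δ) (hP : IsLaw ν P) {x : ℝ≥0}
    (hx : 1 < x) (hx3 : x < 3)
    (hxν : ν {z | (Δ : ℝ) < z.1}ᶜ * (x : ℝ≥0∞) ^ (16 * k + 2) < 1) :
    ∃ B γ C : ℝ≥0, 0 < B ∧ γ < 1 ∧ ∀ n j (g : Path N k → ℝ≥0∞), Adapted n g →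
      ∫⁻ h, g h * lyapunov Δ x (x ^ (16 * k + 2)) B (n + (j + 1)) h ∂P ≤
        ∫⁻ h, g h * (γ * lyapunov Δ x (x ^ (16 * k + 2)) B n h + C) ∂P := by
  obtain ⟨B, γ, C, hB, hγ, hstep⟩ := exists_drift hk hν hx hx3 hxν
  set V : ℕ → Path N k → ℝ≥0∞ := lyapunov Δ x (x ^ (16 * k + 2)) B
  have hγr : (0 : ℝ) < 1 - γ := by
    have : (γ : ℝ) < 1 := by exact_mod_cast hγ
    linarith
  set C' : ℝ≥0 := C / (1 - γ) with hC'
  have hCC : γ * C' + C ≤ C' := by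
    rw [← NNReal.coe_le_coe]
    push_cast
    rw [hC', NNReal.coe_div, NNReal.coe_sub hγ.le]
    push_cast
    apply le_of_eq
    field_simp
    ring
  have hCC' : (γ * C' + C : ℝ≥0∞) ≤ C' := by exact_mod_cast hCC
  have hγ1 : (γ : ℝ≥0∞) ≤ 1 := by exact_mod_cast hγ.le
  have hVm (n : ℕ) : Measurable (V n) := measurable_lyapunov _ _ _ _ n
  have hone (n : ℕ) (g : Path N k → ℝ≥0∞) (hg : Adapted n g) :
      ∫⁻ h, g h * V (n + 1) h ∂P ≤ ∫⁻ h, g h * (γ * V n h + C) ∂P :=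
    hP.lintegral_mul_le hν hg (adapted_lyapunov _ _ _ _ (n + 1)) (fun h hv => hstep n h hv)
  refine ⟨B, γ, C', hB, hγ, fun n j g hg => ?_⟩
  have hsplit (n : ℕ) (c : ℝ≥0) (hg : Measurable g) : ∫⁻ h, g h * (γ * V n h + c) ∂P =
      γ * ∫⁻ h, g h * V n h ∂P + c * ∫⁻ h, g h ∂P := by
    have hgV : Measurable fun h => g h * V n h := hg.mul (hVm n)
    rw [← lintegral_const_mul _ hgV, ← lintegral_const_mul _ hg,
      ← lintegral_add_left (hgV.const_mul _)]
    exact lintegral_congr fun h => by ring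
  have hCle : C ≤ C' := le_trans le_add_self hCC
  induction j with
  | zero =>
    refine (hone n g hg).trans (lintegral_mono fun h => ?_)
    gcongr
  | succ j ih =>
    refine (hone (n + (j + 1)) g (hg.mono (by omega))).trans ?_
    rw [hsplit _ _ hg.measurable] at ih ⊢
    rw [hsplit _ _ hg.measurable]
    calc (γ : ℝ≥0∞) * ∫⁻ h, g h * V (n + (j + 1)) h ∂P + C * ∫⁻ h, g h ∂P
        ≤ γ * (1 * ∫⁻ h, g h * V n h ∂P + C' * ∫⁻ h, g h ∂P) + C * ∫⁻ h, g h ∂P := by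
          gcongr
          refine ih.trans ?_
          gcongr
      _ = γ * ∫⁻ h, g h * V n h ∂P + (γ * C' + C) * ∫⁻ h, g h ∂P := by ring
      _ ≤ _ := by gcongr

/-- Each of `ℓ` steps combines a long wait with a tuple that lowers the allowed number of tips by
one; a last long wait regenerates. The number of steps does not depend on the actual number of tips,
so two paths can be made to regenerate at prescribed indices together. -/
theorem lintegral_regen_ge (hk : 2 ≤ k) (hν : Memoryless ν Δ) (hP : IsLaw ν P) (K ℓ : ℕ)
    (hK : ℓ + 1 ≤ K) : ∀ (n : ℕ) (g : Path N k → ℝ≥0∞), Adapted n g →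
      (ν {z | (Δ : ℝ) < z.1} * ((K : ℝ≥0∞)⁻¹) ^ k) ^ ℓ * ν {z | (Δ : ℝ) < z.1} *
        ∫⁻ h, {h | tips n h ≤ ℓ + 1}.indicator g h ∂P ≤
      ∫⁻ h, {h | Regen Δ (n + ℓ) h}.indicator g h ∂P := by
  induction ℓ with
  | zero =>
    intro n g hg
    have hG : Adapted n ({h | tips n h ≤ 1}.indicator g) := hg.tips_le 1 le_rfl
    rw [pow_zero, one_mul, ← lintegral_const_mul _ hG.measurable]
    have h1 : ∀ h : Path N k, {h | Regen Δ n h}.indicator g h =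
        {h | tips n h ≤ 1}.indicator g h *
          {h | (Δ : ℝ) < coord.time (n + 1) h - coord.time n h}.indicator (fun _ => 1) h := by
      intro h
      simp only [Set.indicator, Set.mem_ofPred_eq, Regen]
      by_cases h1 : (Δ : ℝ) < coord.time (n + 1) h - coord.time n h <;>
        by_cases h2 : tips n h ≤ 1 <;> simp [h1, h2]
    rw [add_zero, lintegral_congr h1, hP.lintegral_mul hG ((Adapted.const 1).gap Δ n)]
    refine lintegral_mono_ae ?_
    filter_upwards [ae_valid hν hP] with h hv
    rw [step_gap_one (hv n), mul_comm]
  | succ ℓ ih =>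
    intro n g hg
    set p := ν {z | (Δ : ℝ) < z.1}
    set g₁ : Path N k → ℝ≥0∞ :=
      {h : Path N k | (Δ : ℝ) < coord.time (n + 1) h - coord.time n h}.indicator
        ({h | tips (n + 1) h ≤ ℓ + 1}.indicator fun _ => 1) with hg₁
    have hA : Adapted (n + 1) g₁ := ((Adapted.const 1).tips_le (ℓ + 1) le_rfl).gap Δ n
    have hG : Adapted n ({h | tips n h ≤ ℓ + 1 + 1}.indicator g) := hg.tips_le _ le_rfl
    have h1 : p * ((K : ℝ≥0∞)⁻¹) ^ k * ∫⁻ h, {h | tips n h ≤ ℓ + 1 + 1}.indicator g h ∂P ≤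
        ∫⁻ h, {h | tips n h ≤ ℓ + 1 + 1}.indicator g h * g₁ h ∂P := by
      rw [hP.lintegral_mul hG hA, ← lintegral_const_mul _ hG.measurable]
      refine lintegral_mono_ae ?_
      filter_upwards [ae_valid hν hP] with h hv
      by_cases hs : tips n h ≤ ℓ + 1 + 1
      · rw [mul_comm]
        gcongr
        exact le_step_gap_tips hk (hv n) hs hK (by omega)
      · rw [Set.indicator_of_notMem (show h ∉ {h : Path N k | tips n h ≤ ℓ + 1 + 1} from hs),
          zero_mul, mul_zero]
    have h2 := ih (by omega) (n + 1) _ ((hG.mono n.le_succ).mul hA)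
    calc _ = (p * ((K : ℝ≥0∞)⁻¹) ^ k) ^ ℓ * p * (p * ((K : ℝ≥0∞)⁻¹) ^ k *
          ∫⁻ h, {h | tips n h ≤ ℓ + 1 + 1}.indicator g h ∂P) := by ring
      _ ≤ (p * ((K : ℝ≥0∞)⁻¹) ^ k) ^ ℓ * p *
          ∫⁻ h, {h | tips n h ≤ ℓ + 1 + 1}.indicator g h * g₁ h ∂P := by gcongr
      _ = (p * ((K : ℝ≥0∞)⁻¹) ^ k) ^ ℓ * p * ∫⁻ h, {h | tips (n + 1) h ≤ ℓ + 1}.indicator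
          (fun h => {h | tips n h ≤ ℓ + 1 + 1}.indicator g h * g₁ h) h ∂P := by
        congr 1
        refine lintegral_congr fun h => ?_
        by_cases hs : tips (n + 1) h ≤ ℓ + 1
        · rw [Set.indicator_of_mem (show h ∈ {h : Path N k | tips (n + 1) h ≤ ℓ + 1} from hs)]
        · rw [Set.indicator_of_notMem (show h ∉ {h : Path N k | tips (n + 1) h ≤ ℓ + 1} from hs), hg₁]
          simp [Set.indicator, hs]
      _ ≤ _ := h2
      _ ≤ _ := by
        refine lintegral_mono fun h => ?_
        rw [show n + 1 + ℓ = n + (ℓ + 1) by ring]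
        refine Set.indicator_le_indicator ?_
        calc _ ≤ g h * 1 := by
              gcongr
              · exact Set.indicator_le_self _ _ _
              · rw [hg₁]
                exact (Set.indicator_le_self _ _ _).trans (Set.indicator_le_self _ _ _)
          _ = g h := mul_one _

/-- From any state with at most `M` tips, the process regenerates `M` steps later with a
probability that is bounded below. -/
theorem exists_minorization (hk : 2 ≤ k) (hν : Memoryless ν Δ) (hP : IsLaw ν P) (M : ℕ)
    (hM : 1 ≤ M) : ∃ c : ℝ≥0, 0 < c ∧ c ≤ 1 ∧ ∀ (n : ℕ) (g : Path N k → ℝ≥0∞), Adapted n g →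
      ∫⁻ h, g h * {h | tips n h ≤ M}.indicator (fun _ => (c : ℝ≥0∞)) h ∂P ≤
      ∫⁻ h, g h * {h | Regen Δ (n + (M - 1)) h}.indicator (fun _ => 1) h ∂P := by
  obtain ⟨ℓ, rfl⟩ : ∃ ℓ, M = ℓ + 1 := ⟨M - 1, by omega⟩
  set c : ℝ≥0∞ := (ν {z | (Δ : ℝ) < z.1} * (((ℓ + 1 : ℕ) : ℝ≥0∞)⁻¹) ^ k) ^ ℓ *
    ν {z | (Δ : ℝ) < z.1} with hc
  have hp1 : ν {z | (Δ : ℝ) < z.1} ≤ 1 := prob_le_one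
  have hK1 : (((ℓ + 1 : ℕ) : ℝ≥0∞)⁻¹) ≤ 1 := by
    rw [ENNReal.inv_le_one]; exact_mod_cast Nat.succ_pos ℓ
  have hc1 : c ≤ 1 :=
    mul_le_one' (pow_le_one' (mul_le_one' hp1 (pow_le_one' hK1 _)) _) hp1
  have hc0 : 0 < c := by
    refine ENNReal.mul_pos (pow_ne_zero _ (mul_ne_zero hν.gap_pos.ne' (pow_ne_zero _ ?_)))
      hν.gap_pos.ne'
    simp
  have hct : (c.toNNReal : ℝ≥0∞) = c := ENNReal.coe_toNNReal (hc1.trans_lt ENNReal.one_lt_top).ne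
  refine ⟨c.toNNReal, ?_, ?_, fun n g hg => ?_⟩
  · rw [← hct] at hc0; exact_mod_cast hc0
  · rw [← hct] at hc1; exact_mod_cast hc1
  · have h1 := lintegral_regen_ge hk hν hP (ℓ + 1) ℓ le_rfl n g hg
    rw [← hc, ← lintegral_const_mul _ (hg.tips_le _ le_rfl).measurable] at h1
    rw [hct, Nat.add_sub_cancel]
    convert h1 using 2 with h h
    · ext h; by_cases hs : tips n h ≤ ℓ + 1 <;> simp [hs, mul_comm]
    · ext h; by_cases hs : Regen Δ (n + ℓ) h <;> simp [hs]

/-- A functional of the block process that depends only on the blocks after a regeneration. -/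
structure Observable (Δ : ℝ≥0) (f : ℕ → Path N k → ℝ≥0∞) : Prop where
  adapted : ∀ n, Adapted n (f n)
  shift : ∀ s m h, Regen Δ s h → (∀ n, Valid Δ n h) → 1 ≤ m → f (s + m) h = f m (shift Δ s h)

theorem observable_tips (Δ : ℝ≥0) (φ : ℕ → ℝ≥0∞) :
    Observable (N := N) (k := k) Δ fun n h => φ (tips n h) :=
  ⟨fun n => ⟨(measurable_of_countable φ).comp (measurable_tips n), fun h => by
    rw [tips_trunc le_rfl]⟩, fun s m h hr hv _ => by rw [tips_shift hr (hv _)]⟩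

theorem observable_localTips (Δ : ℝ≥0) (i : Fin N) (φ : ℕ → ℝ≥0∞) :
    Observable (N := N) (k := k) Δ fun n h => φ (localTips i n h) :=
  ⟨fun n => ⟨(measurable_of_countable φ).comp (measurable_localTips i n), fun h => by
    rw [localTips_trunc le_rfl]⟩, fun s m h hr hv hm => by rw [localTips_shift hr hm (hv _)]⟩

theorem Observable.lintegral_regen [IsProbabilityMeasure P] {f : ℕ → Path N k → ℝ≥0∞}
    (hf : Observable Δ f) (hν : Memoryless ν Δ) (hP : IsLaw ν P) {s m : ℕ} (hm : 1 ≤ m)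
    {g : Path N k → ℝ≥0∞} (hg : Adapted s g) :
    ∫⁻ h, g h * ({h | Regen Δ s h}.indicator (fun _ => 1) h * f (s + m) h) ∂P =
      ∫⁻ h, g h * ({h | Regen Δ s h}.indicator (fun _ => 1) h * ∫⁻ h, f m h ∂P) ∂P := by
  have hG : Adapted (s + 1) ({h | Regen Δ s h}.indicator g) := (hg.mono s.le_succ).regen Δ le_rfl
  have h1 := Ledger.lintegral_regen hν hP hg (hf.adapted m) (f' := f (s + m))
    fun h hr hv => hf.shift s m h hr hv hm
  rw [← lintegral_mul_const _ hG.measurable] at h1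
  convert h1 using 2 with h h
  · ext h; by_cases hs : Regen Δ s h <;> simp [hs]
  · ext h; by_cases hs : Regen Δ s h <;> simp [hs]

end Ledger

/-! ### Two independent paths: contraction until they regenerate together. -/

namespace Ledger

section uncoupled

variable {N k : ℕ}

/-- The indicator of a regeneration. -/
def regenInd (Δ : ℝ≥0) (s : ℕ) : Path N k → ℝ≥0∞ := {h | Regen Δ s h}.indicator fun _ => 1

/-- The indicator that two paths, the first one observed with a lead of `n` blocks, have not
regenerated simultaneously at the end of one of the first `q` periods of length `M`. -/
def uncoupled (Δ : ℝ≥0) (M n : ℕ) : ℕ → Path N k × Path N k → ℝ≥0∞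
  | 0, _ => 1
  | q + 1, p => uncoupled Δ M n q p *
      (1 - regenInd Δ (n + q * M + (M - 1)) p.1 * regenInd Δ (q * M + (M - 1)) p.2)

variable {Δ : ℝ≥0} {M n : ℕ}

theorem uncoupled_eq_add (q : ℕ) (p : Path N k × Path N k) :
    uncoupled Δ M n q p = uncoupled Δ M n (q + 1) p + uncoupled Δ M n q p *
      (regenInd Δ (n + q * M + (M - 1)) p.1 * regenInd Δ (q * M + (M - 1)) p.2) := by
  have h1 (s : ℕ) (h : Path N k) : regenInd Δ s h ≤ 1 := Set.indicator_le_self _ _ _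
  rw [uncoupled, ← mul_add, tsub_add_cancel_of_le (mul_le_one' (h1 _ _) (h1 _ _)), mul_one]

theorem uncoupled_succ_le (q : ℕ) (p : Path N k × Path N k) :
    uncoupled Δ M n (q + 1) p ≤ uncoupled Δ M n q p := by
  rw [uncoupled_eq_add q p]; exact le_self_add

theorem uncoupled_le_one (q : ℕ) (p : Path N k × Path N k) : uncoupled Δ M n q p ≤ 1 := by
  induction q with
  | zero => exact le_rfl
  | succ q ih => exact (uncoupled_succ_le q p).trans ih

end uncoupled

variable {N k : ℕ} [NeZero N]

/-- A function of two paths depending on the first `a` blocks of the first one and the first `b`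
blocks of the second one. -/
structure BiAdapted (a b : ℕ) (G : Path N k × Path N k → ℝ≥0∞) : Prop where
  measurable : Measurable G
  left : ∀ h', Adapted a fun h => G (h, h')
  right : ∀ h, Adapted b fun h' => G (h, h')

namespace BiAdapted

variable {a b a' b' : ℕ} {G H : Path N k × Path N k → ℝ≥0∞}

theorem mono (hG : BiAdapted a b G) (ha : a ≤ a') (hb : b ≤ b') : BiAdapted a' b' G :=
  ⟨hG.measurable, fun h' => (hG.left h').mono ha, fun h => (hG.right h).mono hb⟩

theorem mul (hG : BiAdapted a b G) (hH : BiAdapted a b H) : BiAdapted a b fun p => G p * H p :=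
  ⟨hG.measurable.mul hH.measurable, fun h' => (hG.left h').mul (hH.left h'),
    fun h => (hG.right h).mul (hH.right h)⟩

theorem fst {u : Path N k → ℝ≥0∞} (hu : Adapted a u) (b : ℕ) : BiAdapted a b fun p => u p.1 :=
  ⟨hu.measurable.comp measurable_fst, fun _ => hu, fun h => Adapted.const (u h)⟩

theorem snd {u : Path N k → ℝ≥0∞} (hu : Adapted b u) (a : ℕ) : BiAdapted a b fun p => u p.2 :=
  ⟨hu.measurable.comp measurable_snd, fun h' => Adapted.const (u h'), fun _ => hu⟩

variable {P : Measure (Path N k)} [SFinite P]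

/-- With the other path frozen, `G` is an admissible adapted weight. This lifts one-path estimates
to pairs. -/
theorem lintegral_fst_le (hG : BiAdapted a b G) {u v : Path N k → ℝ≥0∞} (hu : Measurable u)
    (hv : Measurable v) (h : ∀ g, Adapted a g → ∫⁻ h, g h * u h ∂P ≤ ∫⁻ h, g h * v h ∂P) :
    ∫⁻ p, G p * u p.1 ∂(P.prod P) ≤ ∫⁻ p, G p * v p.1 ∂(P.prod P) := by
  have hGu : Measurable fun p => G p * u p.1 := hG.measurable.mul (hu.comp measurable_fst)
  have hGv : Measurable fun p => G p * v p.1 := hG.measurable.mul (hv.comp measurable_fst)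
  rw [lintegral_prod_symm _ hGu.aemeasurable, lintegral_prod_symm _ hGv.aemeasurable]
  exact lintegral_mono fun h' => h _ (hG.left h')

theorem lintegral_snd_le (hG : BiAdapted a b G) {u v : Path N k → ℝ≥0∞} (hu : Measurable u)
    (hv : Measurable v) (h : ∀ g, Adapted b g → ∫⁻ h, g h * u h ∂P ≤ ∫⁻ h, g h * v h ∂P) :
    ∫⁻ p, G p * u p.2 ∂(P.prod P) ≤ ∫⁻ p, G p * v p.2 ∂(P.prod P) := by
  have hGu : Measurable fun p => G p * u p.2 := hG.measurable.mul (hu.comp measurable_snd)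
  have hGv : Measurable fun p => G p * v p.2 := hG.measurable.mul (hv.comp measurable_snd)
  rw [lintegral_prod _ hGu.aemeasurable, lintegral_prod _ hGv.aemeasurable]
  exact lintegral_mono fun h' => h _ (hG.right h')

theorem lintegral_fst_congr (hG : BiAdapted a b G) {u v : Path N k → ℝ≥0∞} (hu : Measurable u)
    (hv : Measurable v) (h : ∀ g, Adapted a g → ∫⁻ h, g h * u h ∂P = ∫⁻ h, g h * v h ∂P) :
    ∫⁻ p, G p * u p.1 ∂(P.prod P) = ∫⁻ p, G p * v p.1 ∂(P.prod P) :=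
  (hG.lintegral_fst_le hu hv fun g hg => (h g hg).le).antisymm
    (hG.lintegral_fst_le hv hu fun g hg => (h g hg).ge)

theorem lintegral_snd_congr (hG : BiAdapted a b G) {u v : Path N k → ℝ≥0∞} (hu : Measurable u)
    (hv : Measurable v) (h : ∀ g, Adapted b g → ∫⁻ h, g h * u h ∂P = ∫⁻ h, g h * v h ∂P) :
    ∫⁻ p, G p * u p.2 ∂(P.prod P) = ∫⁻ p, G p * v p.2 ∂(P.prod P) :=
  (hG.lintegral_snd_le hu hv fun g hg => (h g hg).le).antisymm
    (hG.lintegral_snd_le hv hu fun g hg => (h g hg).ge)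

end BiAdapted

theorem adapted_regenInd (Δ : ℝ≥0) {s n : ℕ} (hs : s + 1 ≤ n) :
    Adapted n (regenInd (N := N) (k := k) Δ s) :=
  (Adapted.const 1).regen Δ hs

theorem measurable_regenInd (Δ : ℝ≥0) (s : ℕ) : Measurable (regenInd (N := N) (k := k) Δ s) :=
  (adapted_regenInd Δ le_rfl).measurable

theorem biAdapted_uncoupled {Δ : ℝ≥0} {M n : ℕ} (hM : 1 ≤ M) (q : ℕ) :
    BiAdapted (n + q * M) (q * M) (uncoupled (N := N) (k := k) Δ M n q) := by
  induction q with
  | zero => exact ⟨measurable_const, fun _ => Adapted.const 1, fun _ => Adapted.const 1⟩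
  | succ q ih =>
    have h1 : n + q * M ≤ n + (q + 1) * M := by rw [Nat.succ_mul]; omega
    have h2 : q * M ≤ (q + 1) * M := by rw [Nat.succ_mul]; omega
    -- A regeneration at `s` involves block `s + 1`. With the offset `M - 1` it is known exactly
    -- when the period of `M` blocks ends.
    have hR := (BiAdapted.fst (adapted_regenInd (N := N) (k := k) Δ
        (show n + q * M + (M - 1) + 1 ≤ n + (q + 1) * M by rw [Nat.succ_mul]; omega))
        ((q + 1) * M)).mul (BiAdapted.snd (adapted_regenInd (N := N) (k := k) Δ
        (show q * M + (M - 1) + 1 ≤ (q + 1) * M by rw [Nat.succ_mul]; omega)) (n + (q + 1) * M))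
    refine (ih.mono h1 h2).mul ⟨hR.measurable.const_sub 1, fun h' => ⟨?_, fun h => ?_⟩,
      fun h => ⟨?_, fun h' => ?_⟩⟩
    · exact (hR.left h').measurable.const_sub 1
    · exact congrArg (1 - ·) ((hR.left h').trunc h)
    · exact (hR.right h).measurable.const_sub 1
    · exact congrArg (1 - ·) ((hR.right h).trunc h')

/-- A Lyapunov function for the block process. -/
structure IsLyapunov (P : Measure (Path N k)) (V : ℕ → Path N k → ℝ≥0) (γ C : ℝ≥0) : Prop where
  lt_one : γ < 1
  adapted : ∀ n, Adapted n fun h => (V n h : ℝ≥0∞)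
  lintegral_le : ∀ n j g, Adapted n g →
    ∫⁻ h, g h * (V (n + (j + 1)) h : ℝ≥0∞) ∂P ≤ ∫⁻ h, g h * (γ * (V n h : ℝ≥0∞) + C) ∂P

section coupling

variable {ν : Measure (Mark N)} [IsProbabilityMeasure ν] {Δ : ℝ≥0} {P : Measure (Path N k)}
  {V : ℕ → Path N k → ℝ≥0} {γ C : ℝ≥0}

/-- The weighted Lyapunov function of a pair of paths. -/
def pairLyapunov (V : ℕ → Path N k → ℝ≥0) (β : ℝ≥0) (a b : ℕ) (p : Path N k × Path N k) : ℝ≥0∞ :=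
  1 + β * ((V a p.1 : ℝ≥0∞) + (V b p.2 : ℝ≥0∞))

theorem IsLyapunov.measurable_coe (hV : IsLyapunov P V γ C) (n : ℕ) :
    Measurable fun h => (V n h : ℝ≥0∞) := (hV.adapted n).measurable

theorem IsLyapunov.measurable_pairLyapunov (hV : IsLyapunov P V γ C) (β : ℝ≥0) (a b : ℕ) :
    Measurable (pairLyapunov V β a b) :=
  measurable_const.add (measurable_const.mul (((hV.measurable_coe a).comp measurable_fst).add
    ((hV.measurable_coe b).comp measurable_snd)))

theorem lintegral_mul_add' {α : Type*} [MeasurableSpace α] {μ : Measure α} {G u v : α → ℝ≥0∞}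
    (hG : Measurable G) (hu : Measurable u) :
    ∫⁻ p, G p * (u p + v p) ∂μ = ∫⁻ p, G p * u p ∂μ + ∫⁻ p, G p * v p ∂μ := by
  have hGu : Measurable fun p => G p * u p := hG.mul hu
  rw [← lintegral_add_left hGu]
  exact lintegral_congr fun p => mul_add _ _ _

theorem lintegral_mul_const_mul' {α : Type*} [MeasurableSpace α] {μ : Measure α} {G u : α → ℝ≥0∞}
    (hG : Measurable G) (hu : Measurable u) (c : ℝ≥0∞) :
    ∫⁻ p, G p * (c * u p) ∂μ = c * ∫⁻ p, G p * u p ∂μ := by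
  have hGu : Measurable fun p => G p * u p := hG.mul hu
  rw [← lintegral_const_mul c hGu]
  exact lintegral_congr fun p => mul_left_comm _ _ _

variable [IsProbabilityMeasure P]

theorem IsLyapunov.pair_drift (hV : IsLyapunov P V γ C) {a b : ℕ} {G : Path N k × Path N k → ℝ≥0∞}
    (hG : BiAdapted a b G) (j : ℕ) :
    ∫⁻ p, G p * ((V (a + (j + 1)) p.1 : ℝ≥0∞) + (V (b + (j + 1)) p.2 : ℝ≥0∞)) ∂(P.prod P) ≤
      ∫⁻ p, G p * (γ * ((V a p.1 : ℝ≥0∞) + (V b p.2 : ℝ≥0∞)) + 2 * C) ∂(P.prod P) := by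
  have hm (n : ℕ) := hV.measurable_coe n
  have h1 := hG.lintegral_fst_le (P := P) (hm (a + (j + 1)))
    (((hm a).const_mul γ).add_const (C : ℝ≥0∞)) fun g hg => hV.lintegral_le a j g hg
  have h2 := hG.lintegral_snd_le (P := P) (hm (b + (j + 1)))
    (((hm b).const_mul γ).add_const (C : ℝ≥0∞)) fun g hg => hV.lintegral_le b j g hg
  have hm1 (n : ℕ) : Measurable fun p : Path N k × Path N k => (V n p.1 : ℝ≥0∞) :=
    (hm n).comp measurable_fst
  have hm2 : Measurable fun p : Path N k × Path N k => (γ * (V a p.1 : ℝ≥0∞) + C) :=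
    ((hm1 a).const_mul γ).add_const (C : ℝ≥0∞)
  rw [lintegral_mul_add' hG.measurable (hm1 _)]
  refine (add_le_add h1 h2).trans (le_of_eq ?_)
  rw [← lintegral_mul_add' hG.measurable hm2]
  exact lintegral_congr fun p => by ring

/-- The indicator of at most `M` tips. -/
def smallInd (M n : ℕ) : Path N k → ℝ≥0∞ := {h | tips n h ≤ M}.indicator fun _ => 1

theorem adapted_smallInd (M n : ℕ) : Adapted n (smallInd (N := N) (k := k) M n) :=
  (Adapted.const 1).tips_le M le_rfl

/-- The paths are treated one after the other, each contributing a factor `c`. Enlarging the weight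
by `M` blocks of the first path is harmless when the second one is moved. -/
theorem pair_minorization {M : ℕ} {c : ℝ≥0} (hM : 1 ≤ M)
    (hc : ∀ (n : ℕ) (g : Path N k → ℝ≥0∞), Adapted n g →
      ∫⁻ h, g h * (c * smallInd M n h) ∂P ≤ ∫⁻ h, g h * regenInd Δ (n + (M - 1)) h ∂P)
    {a b : ℕ} {G : Path N k × Path N k → ℝ≥0∞} (hG : BiAdapted a b G) :
    (c : ℝ≥0∞) ^ 2 * ∫⁻ p, G p * (smallInd M a p.1 * smallInd M b p.2) ∂(P.prod P) ≤
      ∫⁻ p, G p * (regenInd Δ (a + (M - 1)) p.1 * regenInd Δ (b + (M - 1)) p.2) ∂(P.prod P) := by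
  have hs (n : ℕ) := (adapted_smallInd (N := N) (k := k) M n)
  have hr (n : ℕ) := measurable_regenInd (N := N) (k := k) Δ (n + (M - 1))
  have hcs (n : ℕ) : Adapted n fun h : Path N k => c * smallInd M n h :=
    (Adapted.const (c : ℝ≥0∞)).mul (hs n)
  calc (c : ℝ≥0∞) ^ 2 * ∫⁻ p, G p * (smallInd M a p.1 * smallInd M b p.2) ∂(P.prod P)
      = ∫⁻ p, (G p * (c * smallInd M b p.2)) * (c * smallInd M a p.1) ∂(P.prod P) := by
        have hS : Measurable fun p : Path N k × Path N k => smallInd M a p.1 * smallInd M b p.2 :=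
          ((hs a).measurable.comp measurable_fst).mul ((hs b).measurable.comp measurable_snd)
        rw [← lintegral_mul_const_mul' hG.measurable hS]
        exact lintegral_congr fun p => by ring
    _ ≤ ∫⁻ p, (G p * (c * smallInd M b p.2)) * regenInd Δ (a + (M - 1)) p.1 ∂(P.prod P) :=
        (hG.mul (BiAdapted.snd (hcs b) a)).lintegral_fst_le (hcs a).measurable (hr a) (hc a)
    _ = ∫⁻ p, (G p * regenInd Δ (a + (M - 1)) p.1) * (c * smallInd M b p.2) ∂(P.prod P) :=
        lintegral_congr fun p => by ring
    _ ≤ ∫⁻ p, (G p * regenInd Δ (a + (M - 1)) p.1) * regenInd Δ (b + (M - 1)) p.2 ∂(P.prod P) :=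
        ((hG.mono (a' := a + M) (by omega) le_rfl).mul
          (BiAdapted.fst (adapted_regenInd Δ (by omega)) b)).lintegral_snd_le
            (hcs b).measurable (hr b) (hc b)
    _ = _ := lintegral_congr fun p => by ring

/-- Contraction of the weighted Lyapunov function as long as the paths are not coupled. -/
theorem IsLyapunov.uncoupled_succ (hV : IsLyapunov P V γ C) {M : ℕ} {c β ρ : ℝ≥0} (hM : 1 ≤ M)
    (hc : ∀ (n : ℕ) (g : Path N k → ℝ≥0∞), Adapted n g →
      ∫⁻ h, g h * (c * smallInd M n h) ∂P ≤ ∫⁻ h, g h * regenInd Δ (n + (M - 1)) h ∂P)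
    (hsmall : ∀ v : ℝ≥0, 1 + β * (γ * v + 2 * C) ≤ ρ * (1 + β * v) + c ^ 2)
    (hlarge : ∀ n h, M < tips n h → ∀ v : ℝ≥0, V n h ≤ v →
      1 + β * (γ * v + 2 * C) ≤ ρ * (1 + β * v))
    {n : ℕ} {g : Path N k → ℝ≥0∞} (hg : Adapted n g) (hgt : ∫⁻ h, g h ∂P ≠ ⊤) (q : ℕ) :
    ∫⁻ p, g p.1 * uncoupled Δ M n (q + 1) p *
        pairLyapunov V β (n + (q + 1) * M) ((q + 1) * M) p ∂(P.prod P) ≤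
      ρ * ∫⁻ p, g p.1 * uncoupled Δ M n q p *
        pairLyapunov V β (n + q * M) (q * M) p ∂(P.prod P) := by
  set a := n + q * M with ha
  set b := q * M with hb
  have ha' : n + (q + 1) * M = a + ((M - 1) + 1) := by rw [Nat.succ_mul]; omega
  have hb' : (q + 1) * M = b + ((M - 1) + 1) := by rw [Nat.succ_mul]; omega
  set G : Path N k × Path N k → ℝ≥0∞ := fun p => g p.1 * uncoupled Δ M n q p with hGdef
  set G' : Path N k × Path N k → ℝ≥0∞ := fun p => g p.1 * uncoupled Δ M n (q + 1) p with hGdef'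
  have hG : BiAdapted a b G :=
    (BiAdapted.fst (hg.mono (by omega)) b).mul (biAdapted_uncoupled hM q)
  have hG' : Measurable G' :=
    (hg.measurable.comp measurable_fst).mul (biAdapted_uncoupled hM (q + 1)).measurable
  set S : Path N k × Path N k → ℝ≥0∞ := fun p => smallInd M a p.1 * smallInd M b p.2 with hS
  have hSm : Measurable S := ((adapted_smallInd M a).measurable.comp measurable_fst).mul
    ((adapted_smallInd M b).measurable.comp measurable_snd)
  set R : Path N k × Path N k → ℝ≥0∞ := fun p =>
    regenInd Δ (a + (M - 1)) p.1 * regenInd Δ (b + (M - 1)) p.2 with hR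
  have hRm : Measurable R := ((measurable_regenInd Δ _).comp measurable_fst).mul
    ((measurable_regenInd Δ _).comp measurable_snd)
  have hGsplit : ∀ p, G p = G' p + G p * R p := fun p => by
    simp only [hGdef, hGdef', hR]
    rw [mul_assoc, ← mul_add, ← uncoupled_eq_add q p]
  have hGle : ∀ p, G' p ≤ G p := fun p => mul_le_mul_right (uncoupled_succ_le q p) _
  have hGint : ∫⁻ p, G p ∂(P.prod P) ≠ ⊤ := by
    have hg1 : Measurable fun p : Path N k × Path N k => g p.1 := hg.measurable.comp measurable_fst
    have hle : ∫⁻ p, G p ∂(P.prod P) ≤ ∫⁻ p, g p.1 ∂(P.prod P) :=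
      lintegral_mono fun p => mul_le_of_le_one_right' (uncoupled_le_one q p)
    refine ne_top_of_le_ne_top hgt (hle.trans (le_of_eq ?_))
    rw [lintegral_prod _ hg1.aemeasurable]
    simp
  have hmin : (c : ℝ≥0∞) ^ 2 * ∫⁻ p, G p * S p ∂(P.prod P) ≤ ∫⁻ p, G p * R p ∂(P.prod P) :=
    pair_minorization hM hc hG
  -- The mass coupled during this period is at least `c ^ 2` times the mass of pairs with few tips
  -- on both sides.
  have h1 : ∫⁻ p, G' p ∂(P.prod P) + (c : ℝ≥0∞) ^ 2 * ∫⁻ p, G p * S p ∂(P.prod P) ≤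
      ∫⁻ p, G p ∂(P.prod P) := by
    rw [lintegral_congr hGsplit, lintegral_add_left hG']
    gcongr
  have hfin : (c : ℝ≥0∞) ^ 2 * ∫⁻ p, G p * S p ∂(P.prod P) ≠ ⊤ :=
    ne_top_of_le_ne_top hGint (le_add_self.trans h1)
  have h2 := hV.pair_drift hG (M - 1)
  have hVV (a b : ℕ) : Measurable fun p : Path N k × Path N k =>
      (V a p.1 : ℝ≥0∞) + (V b p.2 : ℝ≥0∞) :=
    ((hV.measurable_coe a).comp measurable_fst).add ((hV.measurable_coe b).comp measurable_snd)
  have hpoint : ∀ p : Path N k × Path N k,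
      1 + (β : ℝ≥0∞) * (γ * ((V a p.1 : ℝ≥0∞) + (V b p.2 : ℝ≥0∞)) + 2 * C) ≤
        ρ * pairLyapunov V β a b p + (c : ℝ≥0∞) ^ 2 * S p := by
    intro p
    have hlift {s : ℝ≥0} (h : 1 + β * (γ * (V a p.1 + V b p.2) + 2 * C) ≤
        ρ * (1 + β * (V a p.1 + V b p.2)) + s) :
        1 + (β : ℝ≥0∞) * (γ * ((V a p.1 : ℝ≥0∞) + (V b p.2 : ℝ≥0∞)) + 2 * C) ≤
          ρ * pairLyapunov V β a b p + s := by
      rw [pairLyapunov]; exact_mod_cast h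
    by_cases h3 : tips a p.1 ≤ M
    · by_cases h4 : tips b p.2 ≤ M
      · have : S p = 1 := by simp [hS, smallInd, h3, h4]
        rw [this, mul_one]
        exact_mod_cast hlift (hsmall _)
      · exact (hlift (s := 0) (by
          rw [add_zero]; exact hlarge b p.2 (not_le.1 h4) _ le_add_self)).trans (by simp)
    · exact (hlift (s := 0) (by
        rw [add_zero]; exact hlarge a p.1 (not_le.1 h3) _ le_self_add)).trans (by simp)
  -- The same term is added on both sides: on the left it is paid for by the coupled mass, on the
  -- right it makes up for the missing drift where both paths have few tips. Its finiteness allows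
  -- the cancellation.
  refine (ENNReal.add_le_add_iff_right hfin).1 ?_
  calc ∫⁻ p, G' p * pairLyapunov V β (n + (q + 1) * M) ((q + 1) * M) p ∂(P.prod P) +
        (c : ℝ≥0∞) ^ 2 * ∫⁻ p, G p * S p ∂(P.prod P)
      = (∫⁻ p, G' p ∂(P.prod P) + (c : ℝ≥0∞) ^ 2 * ∫⁻ p, G p * S p ∂(P.prod P)) +
        β * ∫⁻ p, G' p * ((V (a + ((M - 1) + 1)) p.1 : ℝ≥0∞) +
          (V (b + ((M - 1) + 1)) p.2 : ℝ≥0∞)) ∂(P.prod P) := by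
        rw [ha', hb']
        simp only [pairLyapunov]
        rw [lintegral_mul_add' hG' measurable_const, lintegral_mul_const_mul' hG' (hVV _ _)]
        simp only [mul_one]
        ring
    _ ≤ ∫⁻ p, G p ∂(P.prod P) +
        β * ∫⁻ p, G p * (γ * ((V a p.1 : ℝ≥0∞) + (V b p.2 : ℝ≥0∞)) + 2 * C) ∂(P.prod P) := by
        exact add_le_add h1 (mul_le_mul_right (le_trans (lintegral_mono fun p =>
          mul_le_mul_left (hGle p) _) h2) _)
    _ = ∫⁻ p, G p * (1 + (β : ℝ≥0∞) *
          (γ * ((V a p.1 : ℝ≥0∞) + (V b p.2 : ℝ≥0∞)) + 2 * C)) ∂(P.prod P) := by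
        rw [lintegral_mul_add' hG.measurable measurable_const,
          lintegral_mul_const_mul' hG.measurable (((hVV a b).const_mul _).add_const _)]
        simp only [mul_one]
    _ ≤ ∫⁻ p, G p * (ρ * pairLyapunov V β a b p + (c : ℝ≥0∞) ^ 2 * S p) ∂(P.prod P) := by
        exact lintegral_mono fun p => mul_le_mul_right (hpoint p) _
    _ = ρ * ∫⁻ p, G p * pairLyapunov V β a b p ∂(P.prod P) +
        (c : ℝ≥0∞) ^ 2 * ∫⁻ p, G p * S p ∂(P.prod P) := by
        rw [lintegral_mul_add' hG.measurable ((hV.measurable_pairLyapunov β a b).const_mul _),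
          lintegral_mul_const_mul' hG.measurable (hV.measurable_pairLyapunov β a b),
          lintegral_mul_const_mul' hG.measurable hSm]

end coupling

end Ledger

/-! ### From contraction to geometric mixing. -/

namespace Ledger

/-- The choice `β * (2 * C + 1) = c ^ 2` lets the coupling gain cover the drift constant and the
loss `1 - ρ ≤ β`. For large `v`, half of the drift `(1 - γ) * v` does the same. -/
theorem exists_contraction_const {γ C c : ℝ≥0} (hγ : γ < 1) (hc : 0 < c) (hc1 : c ≤ 1) :
    ∃ β ρ : ℝ≥0, 0 < β ∧ ρ < 1 ∧
      (∀ v : ℝ≥0, 1 + β * (γ * v + 2 * C) ≤ ρ * (1 + β * v) + c ^ 2) ∧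
      ∀ v : ℝ≥0, (4 * C + 2) / (1 - γ) ≤ v → 1 + β * (γ * v + 2 * C) ≤ ρ * (1 + β * v) := by
  have hγr : (γ : ℝ) < 1 := by exact_mod_cast hγ
  have hγ0 : (0 : ℝ) ≤ γ := γ.2
  have hC0 : (0 : ℝ) ≤ C := C.2
  have hc0 : (0 : ℝ) < c := by exact_mod_cast hc
  have hc1r : (c : ℝ) ≤ 1 := by exact_mod_cast hc1
  set β : ℝ≥0 := c ^ 2 / (2 * C + 1) with hβ
  have hβr : (β : ℝ) * (2 * C + 1) = c ^ 2 := by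
    rw [hβ]; push_cast; field_simp
  have hβ0 : (0 : ℝ) < β := by rw [hβ]; push_cast; positivity
  have hβ1 : β ≤ 1 := by
    rw [← NNReal.coe_le_coe]; push_cast; nlinarith
  have hβ1r : (β : ℝ) ≤ 1 := by exact_mod_cast hβ1
  set ρ : ℝ≥0 := max (1 - β) ((1 + γ) / 2) with hρ
  have h1 : (1 : ℝ) - β ≤ ρ := by
    have : 1 - β ≤ ρ := le_max_left _ _
    rw [← NNReal.coe_le_coe, NNReal.coe_sub hβ1] at this
    exact this
  have h2 : (1 + γ : ℝ) / 2 ≤ ρ := by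
    have : (1 + γ) / 2 ≤ ρ := le_max_right _ _
    rw [← NNReal.coe_le_coe] at this
    push_cast at this
    exact this
  refine ⟨β, ρ, by exact_mod_cast hβ0, ?_, fun v => ?_, fun v hv => ?_⟩
  · refine max_lt ?_ ?_
    · rw [← NNReal.coe_lt_coe, NNReal.coe_sub hβ1]; push_cast; linarith
    · rw [← NNReal.coe_lt_coe]; push_cast; linarith
  · rw [← NNReal.coe_le_coe]
    push_cast
    have hv0 : (0 : ℝ) ≤ β * v := mul_nonneg hβ0.le v.2
    nlinarith [mul_le_mul_of_nonneg_right (show (γ : ℝ) ≤ ρ by linarith) hv0]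
  · rw [← NNReal.coe_le_coe] at hv ⊢
    rw [NNReal.coe_div, NNReal.coe_sub hγ.le, div_le_iff₀ (by push_cast; linarith)] at hv
    push_cast at hv ⊢
    have hv0 : (0 : ℝ) ≤ β * v := mul_nonneg hβ0.le v.2
    have h3 : (1 + γ : ℝ) / 2 * (β * v) ≤ ρ * (β * v) := mul_le_mul_of_nonneg_right h2 hv0
    have h4 : (β : ℝ) * (4 * C + 2) ≤ β * (v * (1 - γ)) := mul_le_mul_of_nonneg_left hv hβ0.le
    nlinarith

/-- Contraction once per period of `M` is geometric decay in single blocks. The rate `1 - (1 - ρ) /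
(2 * M)` works by Bernoulli's inequality; the factor `2` keeps it positive even for `ρ = 0` and `M =
1`. -/
theorem exists_pow_div_le {ρ : ℝ≥0} (hρ : ρ < 1) {M : ℕ} (hM : 1 ≤ M) :
    ∃ C ρ' : ℝ≥0, ρ' < 1 ∧ ∀ m : ℕ, ρ ^ (m / M) ≤ C * ρ' ^ m := by
  have hρr : (ρ : ℝ) < 1 := by exact_mod_cast hρ
  have hMr : (1 : ℝ) ≤ M := by exact_mod_cast hM
  have hd : (0 : ℝ) < (1 - ρ) / M := by
    have : (0 : ℝ) < 1 - ρ := by linarith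
    positivity
  have hd1 : (1 - ρ : ℝ) / (2 * M) ≤ 1 / 2 := by
    rw [div_le_div_iff₀ (by positivity) (by norm_num)]
    have := ρ.2
    nlinarith
  have hd' : (1 - ρ : ℝ) / (2 * M) = (1 - ρ) / M / 2 := by rw [div_div, mul_comm]
  have h0 : (0 : ℝ) < 1 - (1 - ρ) / (2 * M) := by linarith
  set ρ' : ℝ≥0 := ⟨1 - (1 - ρ) / (2 * M), h0.le⟩ with hρ'
  have hρ'r : (ρ' : ℝ) = 1 - (1 - ρ) / (2 * M) := rfl
  have hρ'0 : 0 < ρ' := by rw [← NNReal.coe_pos, hρ'r]; exact h0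
  have hρ'1 : ρ' < 1 := by
    rw [← NNReal.coe_lt_coe, hρ'r, NNReal.coe_one]; linarith
  have hpow : ρ ≤ ρ' ^ M := by
    rw [← NNReal.coe_le_coe, NNReal.coe_pow, hρ'r]
    have := one_add_mul_le_pow (a := -((1 - ρ : ℝ) / (2 * M))) (by linarith) M
    have e : (M : ℝ) * -((1 - ρ) / (2 * M)) = -((1 - ρ) / 2) := by field_simp
    rw [e] at this
    rw [sub_eq_add_neg]
    linarith
  refine ⟨(ρ' ^ M)⁻¹, ρ', hρ'1, fun m => ?_⟩
  have hpos : 0 < ρ' ^ M := by positivity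
  rw [← div_eq_inv_mul, le_div_iff₀ hpos]
  calc ρ ^ (m / M) * ρ' ^ M ≤ (ρ' ^ M) ^ (m / M) * ρ' ^ M := by gcongr
    _ = ρ' ^ (M * (m / M) + M) := by rw [← pow_mul, ← pow_add]
    _ ≤ ρ' ^ m := by
      refine pow_le_pow_of_le_one zero_le hρ'1.le ?_
      have h1 := Nat.div_add_mod m M
      have h2 := Nat.mod_lt m (show 0 < M by omega)
      omega

variable {N k : ℕ} [NeZero N] {ν : Measure (Mark N)} [IsProbabilityMeasure ν] {Δ : ℝ≥0}
  {P : Measure (Path N k)} [IsProbabilityMeasure P] {V : ℕ → Path N k → ℝ≥0} {γ C : ℝ≥0}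

/-- Decomposition at the coupling time. -/
theorem Observable.exists_coupling {f : ℕ → Path N k → ℝ≥0∞}
    (hf : Observable Δ f) (hν : Memoryless ν Δ) (hP : IsLaw ν P) {M : ℕ} (hM : 1 ≤ M) {n m : ℕ}
    {g : Path N k → ℝ≥0∞} (hg : Adapted n g) (q : ℕ) (hq : q * M ≤ m) :
    ∃ S : ℝ≥0∞,
      ∫⁻ h, g h * f (n + m) h ∂P =
        ∫⁻ p, g p.1 * uncoupled Δ M n q p * f (n + m) p.1 ∂(P.prod P) + S ∧
      (∫⁻ h, g h ∂P) * ∫⁻ h, f m h ∂P =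
        ∫⁻ p, g p.1 * uncoupled Δ M n q p * f m p.2 ∂(P.prod P) + S := by
  have hfm (n : ℕ) := (hf.adapted n).measurable
  have hg1 : Measurable fun p : Path N k × Path N k => g p.1 := hg.measurable.comp measurable_fst
  have hf1 (n : ℕ) : Measurable fun p : Path N k × Path N k => f n p.1 :=
    (hfm n).comp measurable_fst
  have hf2 (n : ℕ) : Measurable fun p : Path N k × Path N k => f n p.2 :=
    (hfm n).comp measurable_snd
  induction q with
  | zero =>
    refine ⟨0, ?_, ?_⟩
    · have h1 : Measurable fun p : Path N k × Path N k => g p.1 * f (n + m) p.1 :=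
        hg1.mul (hf1 _)
      simp only [uncoupled, mul_one, add_zero]
      rw [lintegral_prod _ h1.aemeasurable]
      simp
    · simp only [uncoupled, mul_one, add_zero]
      exact (lintegral_prod_mul hg.measurable.aemeasurable (hfm m).aemeasurable).symm
  | succ q ih =>
    rw [Nat.succ_mul] at hq
    obtain ⟨S, h1, h2⟩ := ih (by omega)
    set G : Path N k × Path N k → ℝ≥0∞ := fun p => g p.1 * uncoupled Δ M n q p with hGdef
    have hG : BiAdapted (n + q * M) (q * M) G :=
      (BiAdapted.fst (hg.mono (by omega)) _).mul (biAdapted_uncoupled hM q)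
    set G' : Path N k × Path N k → ℝ≥0∞ := fun p => g p.1 * uncoupled Δ M n (q + 1) p with hGdef'
    have hG' : Measurable G' := hg1.mul (biAdapted_uncoupled hM (q + 1)).measurable
    set s := n + q * M + (M - 1) with hs
    set s' := q * M + (M - 1) with hs'
    have hR (t : ℕ) : Measurable (regenInd (N := N) (k := k) Δ t) := measurable_regenInd Δ t
    have hGsplit : ∀ p, G p = G' p + G p * (regenInd Δ s p.1 * regenInd Δ s' p.2) := fun p => by
      simp only [hGdef, hGdef']
      rw [mul_assoc, ← mul_add, ← uncoupled_eq_add q p]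
    obtain ⟨d, hd, hd1⟩ : ∃ d, m = s' + d ∧ 1 ≤ d := ⟨m - s', by omega, by omega⟩
    have hd' : n + m = s + d := by omega
    set κ := ∫⁻ h, f d h ∂P with hκ
    -- After a simultaneous regeneration, `d` blocks remain on both paths, and either observable may
    -- be replaced by the fresh mean `κ`. The pairs coupled in this period therefore contribute
    -- equally to both sides and move into `S`.
    set T := ∫⁻ p, G p * (regenInd Δ s p.1 * regenInd Δ s' p.2) * κ ∂(P.prod P) with hT
    have hRf (t u : ℕ) : Measurable fun h : Path N k => regenInd Δ t h * f u h := (hR t).mul (hfm u)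
    have hRκ (t : ℕ) : Measurable fun h : Path N k => regenInd Δ t h * κ := (hR t).mul_const κ
    have e1 : ∫⁻ p, G p * (regenInd Δ s p.1 * regenInd Δ s' p.2) * f (n + m) p.1 ∂(P.prod P) =
        T := by
      have hw : BiAdapted (n + q * M) (q * M + M) fun p => G p * regenInd Δ s' p.2 :=
        (hG.mono le_rfl (by omega)).mul (BiAdapted.snd (adapted_regenInd Δ (by omega)) _)
      have := hw.lintegral_fst_congr (P := P) (hRf s (n + m)) (hRκ s) fun g hg => by
        rw [hd']
        exact hf.lintegral_regen hν hP hd1 (hg.mono (by omega))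
      rw [hT]
      refine (lintegral_congr fun p => ?_).trans (this.trans (lintegral_congr fun p => ?_)) <;> ring
    have e2 : ∫⁻ p, G p * (regenInd Δ s p.1 * regenInd Δ s' p.2) * f m p.2 ∂(P.prod P) = T := by
      have hw : BiAdapted (n + q * M + M) (q * M) fun p => G p * regenInd Δ s p.1 :=
        (hG.mono (by omega) le_rfl).mul (BiAdapted.fst (adapted_regenInd Δ (by omega)) _)
      have := hw.lintegral_snd_congr (P := P) (hRf s' m) (hRκ s') fun g hg => by
        rw [hd]
        exact hf.lintegral_regen hν hP hd1 (hg.mono (by omega))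
      rw [hT]
      refine (lintegral_congr fun p => ?_).trans (this.trans (lintegral_congr fun p => ?_)) <;> ring
    have hsum {u : Path N k × Path N k → ℝ≥0∞} (hu : Measurable u) :
        ∫⁻ p, G p * u p ∂(P.prod P) = ∫⁻ p, G' p * u p ∂(P.prod P) +
          ∫⁻ p, G p * (regenInd Δ s p.1 * regenInd Δ s' p.2) * u p ∂(P.prod P) := by
      have hGu : Measurable fun p => G' p * u p := hG'.mul hu
      rw [← lintegral_add_left hGu]
      refine lintegral_congr fun p => ?_
      conv_lhs => rw [hGsplit p]
      ring
    refine ⟨T + S, ?_, ?_⟩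
    · rw [h1, hsum (hf1 _), e1, add_assoc]
    · rw [h2, hsum (hf2 _), e2, add_assoc]

/-- Exponential mixing of observables, uniformly over all observables dominated by the Lyapunov
function. -/
theorem IsLyapunov.exists_mixing (hν : Memoryless ν Δ) (hP : IsLaw ν P)
    (hV : IsLyapunov P V γ C) (hk : 2 ≤ k) {M : ℕ} (hM : 1 ≤ M)
    (hlarge : ∀ n h, M < tips n h → (4 * C + 2) / (1 - γ) ≤ V n h) (hV1 : ∀ n h, 1 ≤ V n h)
    {v₀ : ℝ≥0} (hV0 : ∀ h, V 0 h ≤ v₀) :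
    ∃ K ρ : ℝ≥0, ρ < 1 ∧ ∀ (f : ℕ → Path N k → ℝ≥0∞) (C₀ : ℝ≥0), Observable Δ f →
      (∀ n h, Valid Δ n h → f n h ≤ C₀ * V n h) → ∀ n m (g : Path N k → ℝ≥0∞), Adapted n g →
      ∫⁻ h, g h ∂P ≠ ⊤ →
      ∫⁻ h, g h * f (n + m) h ∂P ≤ (∫⁻ h, g h ∂P) * ∫⁻ h, f m h ∂P +
        C₀ * K * ρ ^ m * ∫⁻ h, g h * V n h ∂P ∧
      (∫⁻ h, g h ∂P) * ∫⁻ h, f m h ∂P ≤ ∫⁻ h, g h * f (n + m) h ∂P +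
        C₀ * K * ρ ^ m * ∫⁻ h, g h * V n h ∂P := by
  obtain ⟨c, hc0, hc1, hc⟩ := exists_minorization hk hν hP M hM
  obtain ⟨β, ρ, hβ, hρ, hsm, hla⟩ := exists_contraction_const (C := C) hV.lt_one hc0 hc1
  obtain ⟨K₁, ρ', hρ', hpow⟩ := exists_pow_div_le hρ hM
  have hc' (n : ℕ) (g : Path N k → ℝ≥0∞) (hg : Adapted n g) :
      ∫⁻ h, g h * (c * smallInd M n h) ∂P ≤ ∫⁻ h, g h * regenInd Δ (n + (M - 1)) h ∂P := by
    refine le_trans (le_of_eq (lintegral_congr fun h => ?_)) (hc n g hg)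
    by_cases h1 : tips n h ≤ M <;> simp [smallInd, h1]
  -- The factors come from bounding `v + C` by the pair function, from passing from periods to
  -- blocks, and from bounding the initial pair function by a multiple of `V n`.
  refine ⟨(β⁻¹ + C) * K₁ * (1 + β * (1 + v₀)), ρ', hρ', fun f C₀ hf hfV n m g hg hgt => ?_⟩
  set E : ℕ → ℝ≥0∞ := fun q => ∫⁻ p, g p.1 * uncoupled Δ M n q p *
        pairLyapunov V β (n + q * M) (q * M) p ∂(P.prod P) with hE
  have hEpow (q : ℕ) : E q ≤ (ρ : ℝ≥0∞) ^ q * E 0 := by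
    induction q with
    | zero => simp
    | succ q ih =>
      refine (hV.uncoupled_succ hM hc' hsm (fun n h h1 v hv => hla v ((hlarge n h h1).trans hv))
        hg hgt q).trans ?_
      rw [pow_succ', mul_assoc]
      gcongr
  have hg1 : Measurable fun p : Path N k × Path N k => g p.1 := hg.measurable.comp measurable_fst
  have hE0 : E 0 ≤ ((1 + β * (1 + v₀) : ℝ≥0) : ℝ≥0∞) * ∫⁻ h, g h * V n h ∂P := by
    have hm : Measurable fun p : Path N k × Path N k => g p.1 * (V n p.1 : ℝ≥0∞) :=
      hg1.mul ((hV.measurable_coe n).comp measurable_fst)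
    have e : ∫⁻ h, g h * V n h ∂P = ∫⁻ p, g p.1 * (V n p.1 : ℝ≥0∞) ∂(P.prod P) := by
      rw [lintegral_prod _ hm.aemeasurable]; simp
    rw [e, ← lintegral_const_mul _ hm]
    refine lintegral_mono fun p => ?_
    simp only [uncoupled, mul_one, pairLyapunov, zero_mul, add_zero]
    rw [mul_left_comm]
    gcongr
    have h1 : (1 : ℝ≥0) + β * (V n p.1 + V 0 p.2) ≤ (1 + β * (1 + v₀)) * V n p.1 := by
      calc (1 : ℝ≥0) + β * (V n p.1 + V 0 p.2)
          ≤ 1 * V n p.1 + β * (V n p.1 + v₀ * V n p.1) := by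
            gcongr
            · rw [one_mul]; exact hV1 _ _
            · exact (hV0 _).trans (le_mul_of_one_le_right' (hV1 _ _))
        _ = _ := by ring
    exact_mod_cast h1
  set q := m / M with hq
  have hqm : q * M ≤ m := Nat.div_mul_le_self m M
  obtain ⟨S, h1, h2⟩ := hf.exists_coupling hν hP hM hg (m := m) q hqm
  set G : Path N k × Path N k → ℝ≥0∞ := fun p => g p.1 * uncoupled Δ M n q p with hGdef
  have hG : BiAdapted (n + q * M) (q * M) G :=
    (BiAdapted.fst (hg.mono (by omega)) _).mul (biAdapted_uncoupled hM q)
  -- Bridges the incomplete last period between block `q * M` and block `m`.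
  have hdrift (a j : ℕ) (g : Path N k → ℝ≥0∞) (hg : Adapted a g) :
      ∫⁻ h, g h * (V (a + j) h : ℝ≥0∞) ∂P ≤ ∫⁻ h, g h * ((V a h : ℝ≥0∞) + C) ∂P := by
    rcases j with - | j
    · exact lintegral_mono fun h => mul_le_mul_right le_self_add _
    · refine (hV.lintegral_le a j g hg).trans (lintegral_mono fun h => ?_)
      have : (γ : ℝ≥0∞) ≤ 1 := by exact_mod_cast hV.lt_one.le
      gcongr
      exact mul_le_of_le_one_left' this
  have hfinal : (C₀ : ℝ≥0∞) * ((β⁻¹ + C : ℝ≥0) * E q) ≤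
      C₀ * ((β⁻¹ + C) * K₁ * (1 + β * (1 + v₀)) : ℝ≥0) * ρ' ^ m * ∫⁻ h, g h * V n h ∂P := by
    have hpow' : (ρ : ℝ≥0∞) ^ q ≤ K₁ * (ρ' : ℝ≥0∞) ^ m := by exact_mod_cast hpow m
    calc (C₀ : ℝ≥0∞) * ((β⁻¹ + C : ℝ≥0) * E q)
        ≤ C₀ * ((β⁻¹ + C : ℝ≥0) * (K₁ * (ρ' : ℝ≥0∞) ^ m *
          (((1 + β * (1 + v₀) : ℝ≥0) : ℝ≥0∞) * ∫⁻ h, g h * V n h ∂P))) := by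
          gcongr
          exact (hEpow q).trans (mul_le_mul' hpow' hE0)
      _ = _ := by push_cast; ring
  have hpt {v w : ℝ≥0} : v + C ≤ (β⁻¹ + C) * (1 + β * (v + w)) := by
    have hb : β⁻¹ * β = 1 := inv_mul_cancel₀ hβ.ne'
    calc v + C ≤ (v + C) + (w + β⁻¹ + C * β * (v + w)) := le_self_add
      _ = β⁻¹ * β * (v + w) + β⁻¹ + C + C * β * (v + w) := by rw [hb]; ring
      _ = _ := by ring
  have hGpair : Measurable fun p => G p * pairLyapunov V β (n + q * M) (q * M) p :=
    hG.measurable.mul (hV.measurable_pairLyapunov _ _ _)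
  have hmV1 (n : ℕ) : Measurable fun p : Path N k × Path N k => (V n p.1 : ℝ≥0∞) :=
    (hV.measurable_coe n).comp measurable_fst
  have hmV2 (n : ℕ) : Measurable fun p : Path N k × Path N k => (V n p.2 : ℝ≥0∞) :=
    (hV.measurable_coe n).comp measurable_snd
  have hvalid1 : ∀ᵐ p ∂(P.prod P), ∀ n, Valid Δ n p.1 :=
    Measure.quasiMeasurePreserving_fst.ae (ae_valid hν hP)
  have hvalid2 : ∀ᵐ p ∂(P.prod P), ∀ n, Valid Δ n p.2 :=
    Measure.quasiMeasurePreserving_snd.ae (ae_valid hν hP)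
  have hb1 : ∫⁻ p, G p * f (n + m) p.1 ∂(P.prod P) ≤ (C₀ : ℝ≥0∞) * ((β⁻¹ + C : ℝ≥0) * E q) := by
    calc ∫⁻ p, G p * f (n + m) p.1 ∂(P.prod P)
        ≤ ∫⁻ p, G p * (C₀ * (V (n + m) p.1 : ℝ≥0∞)) ∂(P.prod P) := by
          refine lintegral_mono_ae ?_
          filter_upwards [hvalid1] with p hp
          exact mul_le_mul_right (hfV _ _ (hp _)) _
      _ = C₀ * ∫⁻ p, G p * (V (n + m) p.1 : ℝ≥0∞) ∂(P.prod P) :=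
          lintegral_mul_const_mul' hG.measurable (hmV1 _) _
      _ ≤ C₀ * ∫⁻ p, G p * ((V (n + q * M) p.1 : ℝ≥0∞) + C) ∂(P.prod P) := by
          refine mul_le_mul_right (hG.lintegral_fst_le (P := P) (hV.measurable_coe _)
            ((hV.measurable_coe _).add_const _) fun g hg => ?_) _
          have := hdrift (n + q * M) (m - q * M) g hg
          rwa [show n + q * M + (m - q * M) = n + m by omega] at this
      _ ≤ C₀ * ∫⁻ p, (β⁻¹ + C : ℝ≥0) *
          (G p * pairLyapunov V β (n + q * M) (q * M) p) ∂(P.prod P) := by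
          refine mul_le_mul_right (lintegral_mono fun p => ?_) _
          rw [mul_left_comm]
          refine mul_le_mul_right ?_ _
          rw [pairLyapunov]
          norm_cast
          exact ENNReal.coe_le_coe.2 hpt
      _ = _ := by rw [lintegral_const_mul _ hGpair]
  have hb2 : ∫⁻ p, G p * f m p.2 ∂(P.prod P) ≤ (C₀ : ℝ≥0∞) * ((β⁻¹ + C : ℝ≥0) * E q) := by
    calc ∫⁻ p, G p * f m p.2 ∂(P.prod P)
        ≤ ∫⁻ p, G p * (C₀ * (V m p.2 : ℝ≥0∞)) ∂(P.prod P) := by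
          refine lintegral_mono_ae ?_
          filter_upwards [hvalid2] with p hp
          exact mul_le_mul_right (hfV _ _ (hp _)) _
      _ = C₀ * ∫⁻ p, G p * (V m p.2 : ℝ≥0∞) ∂(P.prod P) :=
          lintegral_mul_const_mul' hG.measurable (hmV2 _) _
      _ ≤ C₀ * ∫⁻ p, G p * ((V (q * M) p.2 : ℝ≥0∞) + C) ∂(P.prod P) := by
          refine mul_le_mul_right (hG.lintegral_snd_le (P := P) (hV.measurable_coe _)
            ((hV.measurable_coe _).add_const _) fun g hg => ?_) _
          have := hdrift (q * M) (m - q * M) g hg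
          rwa [show q * M + (m - q * M) = m by omega] at this
      _ ≤ C₀ * ∫⁻ p, (β⁻¹ + C : ℝ≥0) *
          (G p * pairLyapunov V β (n + q * M) (q * M) p) ∂(P.prod P) := by
          refine mul_le_mul_right (lintegral_mono fun p => ?_) _
          rw [mul_left_comm]
          refine mul_le_mul_right ?_ _
          rw [pairLyapunov, add_comm (V (n + q * M) p.1 : ℝ≥0∞)]
          norm_cast
          exact ENNReal.coe_le_coe.2 hpt
      _ = _ := by rw [lintegral_const_mul _ hGpair]
  constructor
  · rw [h1, h2, add_comm (∫⁻ p, G p * f m p.2 ∂(P.prod P)), add_assoc, add_comm]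
    exact add_le_add le_rfl ((hb1.trans hfinal).trans le_add_self)
  · rw [h1, h2, add_comm (∫⁻ p, G p * f (n + m) p.1 ∂(P.prod P)), add_assoc, add_comm]
    exact add_le_add le_rfl ((hb2.trans hfinal).trans le_add_self)

end Ledger

/-! ### A law of large numbers under geometrically decaying correlations. -/

namespace Ledger

theorem exists_limit_of_geometric {a : ℕ → ℝ} {K ρ : ℝ} (hρ0 : 0 ≤ ρ) (hρ : ρ < 1)
    (h : ∀ n m, |a (n + m) - a m| ≤ K * ρ ^ m) :
    ∃ c, Tendsto a atTop (𝓝 c) ∧ ∀ m, |a m - c| ≤ K * ρ ^ m := by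
  have hlim : Tendsto (fun m => K * ρ ^ m) atTop (𝓝 0) := by
    simpa using (tendsto_pow_atTop_nhds_zero_of_lt_one hρ0 hρ).const_mul K
  have hc : CauchySeq a := by
    refine cauchySeq_of_le_tendsto_0' (fun m => K * ρ ^ m) (fun m n hmn => ?_) hlim
    obtain ⟨d, rfl⟩ := Nat.exists_eq_add_of_le' hmn
    rw [dist_comm, Real.dist_eq]
    exact h d m
  obtain ⟨c, hc⟩ := cauchySeq_tendsto_of_complete hc
  refine ⟨c, hc, fun m => ?_⟩
  have h1 : Tendsto (fun n => |a (n + m) - a m|) atTop (𝓝 |c - a m|) :=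
    (((tendsto_add_atTop_iff_nat m).2 hc).sub_const _).abs
  rw [abs_sub_comm]
  exact le_of_tendsto' h1 fun n => h n m

section average

variable {Ω : Type*} [MeasurableSpace Ω] {P : Measure Ω} {Y : ℕ → Ω → ℝ} {K ρ : ℝ}

theorem memLp_sum (hY : ∀ n, MemLp (Y n) 2 P) (n : ℕ) :
    MemLp (fun ω => ∑ m ∈ Finset.Icc 1 n, Y m ω) 2 P :=
  memLp_finsetSum _ fun m _ => hY m

/-- The variance of a sum of variables with geometrically decaying correlations grows at most
linearly. -/
theorem integral_sq_sum_le (hY : ∀ n, MemLp (Y n) 2 P) (hρ0 : 0 ≤ ρ) (hρ : ρ < 1)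
    (hcov : ∀ n m, |∫ ω, Y n ω * Y (n + m) ω ∂P| ≤ K * ρ ^ m) (n : ℕ) :
    ∫ ω, (∑ m ∈ Finset.Icc 1 n, Y m ω) ^ 2 ∂P ≤ (2 * K / (1 - ρ) + K) * n := by
  have hK : 0 ≤ K := by simpa using (abs_nonneg _).trans (hcov 0 0)
  induction n with
  | zero => simp
  | succ n ih =>
    have hmul (i j : ℕ) : Integrable (fun ω => Y i ω * Y j ω) P := (hY i).integrable_mul (hY j)
    have hS := (memLp_sum hY n).integrable_sq
    have hSY : Integrable (fun ω => 2 * ∑ m ∈ Finset.Icc 1 n, Y m ω * Y (n + 1) ω) P :=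
      (integrable_finsetSum _ fun m _ => hmul m (n + 1)).const_mul 2
    have hYY : Integrable (fun ω => Y (n + 1) ω * Y (n + 1) ω) P := hmul _ _
    have e : ∀ ω, (∑ m ∈ Finset.Icc 1 (n + 1), Y m ω) ^ 2 =
        (∑ m ∈ Finset.Icc 1 n, Y m ω) ^ 2 + 2 * ∑ m ∈ Finset.Icc 1 n, Y m ω * Y (n + 1) ω +
          Y (n + 1) ω * Y (n + 1) ω := fun ω => by
      rw [Finset.sum_Icc_succ_top (by omega), ← Finset.sum_mul]; ring
    have h1 : ∑ m ∈ Finset.Icc 1 n, ∫ ω, Y m ω * Y (n + 1) ω ∂P ≤ K / (1 - ρ) := by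
      calc ∑ m ∈ Finset.Icc 1 n, ∫ ω, Y m ω * Y (n + 1) ω ∂P
          ≤ ∑ m ∈ Finset.Icc 1 n, K * ρ ^ (n + 1 - m) := by
            refine Finset.sum_le_sum fun m hm => ?_
            rw [Finset.mem_Icc] at hm
            have := hcov m (n + 1 - m)
            rw [show m + (n + 1 - m) = n + 1 by omega] at this
            exact (le_abs_self _).trans this
        _ = ∑ j ∈ Finset.Ico 1 (n + 1), K * ρ ^ j := by
            have := Finset.sum_Ico_reflect (fun j => K * ρ ^ j) 1 (Nat.le_succ (n + 1))
            rw [← Finset.Ico_add_one_right_eq_Icc, this]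
            congr 1
            ext; simp
        _ ≤ K / (1 - ρ) := by
            rw [← Finset.mul_sum, div_eq_mul_inv, ← tsum_geometric_of_lt_one hρ0 hρ]
            exact mul_le_mul_of_nonneg_left ((summable_geometric_of_lt_one hρ0 hρ).sum_le_tsum _
              fun _ _ => by positivity) hK
    have h2 : ∫ ω, Y (n + 1) ω * Y (n + 1) ω ∂P ≤ K := by
      simpa using (le_abs_self _).trans (hcov (n + 1) 0)
    have hSS : Integrable (fun ω => (∑ m ∈ Finset.Icc 1 n, Y m ω) ^ 2 +
        2 * ∑ m ∈ Finset.Icc 1 n, Y m ω * Y (n + 1) ω) P := hS.add hSY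
    simp_rw [e]
    rw [integral_add hSS hYY, integral_add hS hSY, integral_const_mul,
      integral_finsetSum _ fun m _ => hmul m (n + 1)]
    push_cast
    have : 2 * K / (1 - ρ) = 2 * (K / (1 - ρ)) := by ring
    linarith

/-- Along geometrically growing times the second moments of the averages are summable, so the
squared averages are almost surely summable and tend to zero. -/
theorem ae_tendsto_sum_floor_pow (hY : ∀ n, MemLp (Y n) 2 P) {C : ℝ}
    (hC : ∀ n : ℕ, ∫ ω, (∑ m ∈ Finset.Icc 1 n, Y m ω) ^ 2 ∂P ≤ C * n) {c : ℝ} (hc : 1 < c) :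
    ∀ᵐ ω ∂P, Tendsto (fun j : ℕ => (∑ m ∈ Finset.Icc 1 ⌊c ^ j⌋₊, Y m ω) / ⌊c ^ j⌋₊)
      atTop (𝓝 0) := by
  set S : ℕ → Ω → ℝ := fun n ω => ∑ m ∈ Finset.Icc 1 n, Y m ω with hS
  have hC0 : 0 ≤ C := by simpa using (integral_nonneg fun ω => sq_nonneg _).trans (hC 1)
  have hfl (j : ℕ) : c ^ j / 2 ≤ (⌊c ^ j⌋₊ : ℝ) ∧ (1 : ℝ) ≤ ⌊c ^ j⌋₊ := by
    have h1 : 1 ≤ c ^ j := one_le_pow₀ hc.le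
    have h2 : 1 ≤ ⌊c ^ j⌋₊ := Nat.le_floor (by simpa using h1)
    have h2' : (1 : ℝ) ≤ ⌊c ^ j⌋₊ := by exact_mod_cast h2
    have h3 := Nat.lt_floor_add_one (c ^ j)
    exact ⟨by linarith, h2'⟩
  have hint (j : ℕ) : Integrable (fun ω => (S ⌊c ^ j⌋₊ ω / ⌊c ^ j⌋₊) ^ 2) P := by
    simp_rw [div_pow]
    exact (memLp_sum hY _).integrable_sq.div_const _
  have hle (j : ℕ) : ∫ ω, (S ⌊c ^ j⌋₊ ω / ⌊c ^ j⌋₊) ^ 2 ∂P ≤ 2 * C * c⁻¹ ^ j := by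
    obtain ⟨h1, h2⟩ := hfl j
    simp_rw [div_pow]
    rw [integral_div, div_le_iff₀ (by positivity)]
    have hcj : c⁻¹ ^ j * c ^ j = 1 := by rw [← mul_pow, inv_mul_cancel₀ (by positivity), one_pow]
    calc _ ≤ C * ⌊c ^ j⌋₊ := hC _
      _ = 2 * C * c⁻¹ ^ j * ((c ^ j / 2) * ⌊c ^ j⌋₊) := by linear_combination (- C * ⌊c ^ j⌋₊) * hcj
      _ ≤ 2 * C * c⁻¹ ^ j * (⌊c ^ j⌋₊ ^ 2) := by rw [sq]; gcongr
  have hsum : Summable fun j : ℕ => 2 * C * c⁻¹ ^ j :=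
    (summable_geometric_of_lt_one (by positivity) (inv_lt_one_of_one_lt₀ hc)).mul_left _
  have hlin : ∑' j, ∫⁻ ω, ENNReal.ofReal ((S ⌊c ^ j⌋₊ ω / ⌊c ^ j⌋₊) ^ 2) ∂P ≠ ⊤ := by
    refine ne_top_of_le_ne_top hsum.tsum_ofReal_ne_top (ENNReal.tsum_le_tsum fun j => ?_)
    rw [← ofReal_integral_eq_lintegral_ofReal (hint j) (ae_of_all _ fun _ => sq_nonneg _)]
    exact ENNReal.ofReal_le_ofReal (hle j)
  rw [← lintegral_tsum fun j => (hint j).aemeasurable.ennreal_ofReal] at hlin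
  filter_upwards [ae_lt_top' (AEMeasurable.tsum fun j => (hint j).aemeasurable.ennreal_ofReal)
    hlin] with ω hω
  have h0 := ENNReal.tendsto_atTop_zero_of_tsum_ne_top hω.ne
  have h1 : Tendsto (fun j : ℕ => (S ⌊c ^ j⌋₊ ω / ⌊c ^ j⌋₊) ^ 2) atTop (𝓝 0) := by
    have := (ENNReal.tendsto_toReal ENNReal.zero_ne_top).comp h0
    simpa [Function.comp_def, ENNReal.toReal_ofReal, sq_nonneg] using this
  have h2 := h1.sqrt
  simp only [Real.sqrt_sq_eq_abs, Real.sqrt_zero] at h2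
  exact (tendsto_zero_iff_abs_tendsto_zero _).2 h2

variable [IsProbabilityMeasure P]

/-- A law of large numbers for nonnegative variables with geometrically decaying correlations. -/
theorem timeAveragesConverge_of_cov {X : ℕ → Ω → ℝ} {c : ℝ} (hX : ∀ n, MemLp (X n) 2 P)
    (hX0 : ∀ n ω, 0 ≤ X n ω) (hρ0 : 0 ≤ ρ) (hρ : ρ < 1)
    (hcov : ∀ n m, |∫ ω, (X n ω - c) * (X (n + m) ω - c) ∂P| ≤ K * ρ ^ m) :
    TimeAveragesConverge P X c := by
  have hY (n : ℕ) : MemLp (fun ω => X n ω - c) 2 P := (hX n).sub (memLp_const c)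
  have hvar := integral_sq_sum_le hY hρ0 hρ hcov
  set C := 2 * K / (1 - ρ) + K
  have hsub (n : ℕ) (ω : Ω) : ∑ m ∈ Finset.Icc 1 n, (X m ω - c) =
      (∑ m ∈ Finset.Icc 1 n, X m ω) - n * c := by
    rw [Finset.sum_sub_distrib]; simp
  have hMem (n : ℕ) : MemLp (timeAverage X n) 2 P := (memLp_sum hX n).const_mul _
  refine ⟨?_, hMem, ?_⟩
  -- Partial sums of nonnegative terms are monotone. Convergence along the powers of each base in a
  -- sequence tending to `1` therefore fills the gaps between those powers.
  · set b : ℕ → ℝ := fun j => 1 + 1 / ((j : ℝ) + 1)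
    have hb (j : ℕ) : 1 < b j := by
      have : (0 : ℝ) < 1 / ((j : ℝ) + 1) := by positivity
      simp only [b]; linarith
    have hblim : Tendsto b atTop (𝓝 1) := by
      simpa [b] using tendsto_one_div_add_atTop_nhds_zero_nat.const_add (1 : ℝ)
    filter_upwards [ae_all_iff.2 fun j => ae_tendsto_sum_floor_pow hY hvar (hb j)] with ω hω
    have := tendsto_div_of_monotone_of_tendsto_div_floor_pow
      (fun n => ∑ m ∈ Finset.Icc 1 n, X m ω) c (fun n n' hn => ?_) b hb hblim fun j => ?_
    · refine this.congr fun n => ?_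
      rw [timeAverage]; ring
    · exact Finset.sum_le_sum_of_subset_of_nonneg (Finset.Icc_subset_Icc_right hn)
        fun m _ _ => hX0 m ω
    · have h1 := (hω j).add_const c
      rw [zero_add] at h1
      refine h1.congr fun i => ?_
      have h2 : 1 ≤ ⌊b j ^ i⌋₊ := Nat.le_floor (by simpa using one_le_pow₀ (hb j).le)
      have h3 : (⌊b j ^ i⌋₊ : ℝ) ≠ 0 := by exact_mod_cast (by omega : ⌊b j ^ i⌋₊ ≠ 0)
      rw [hsub]
      field_simp
      ring
  · have hL : ∀ n : ℕ, 1 ≤ n → eLpNorm (fun ω => timeAverage X n ω - c) 2 P ≤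
        ENNReal.ofReal (Real.sqrt (C / n)) := fun n hn => by
      have hn' : (0 : ℝ) < n := by exact_mod_cast hn
      have hm : MemLp (fun ω => timeAverage X n ω - c) 2 P := (hMem n).sub (memLp_const c)
      rw [hm.eLpNorm_eq_integral_rpow_norm two_ne_zero ENNReal.ofNat_ne_top]
      simp only [ENNReal.toReal_ofNat, Real.rpow_two, Real.norm_eq_abs, sq_abs]
      rw [Real.sqrt_eq_rpow, ← one_div]
      have h1 : ∀ ω, (timeAverage X n ω - c) ^ 2 =
          (∑ m ∈ Finset.Icc 1 n, (X m ω - c)) ^ 2 / n ^ 2 := fun ω => by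
        rw [hsub, timeAverage]; field_simp
      simp_rw [h1]
      rw [integral_div]
      refine ENNReal.ofReal_le_ofReal (Real.rpow_le_rpow
        (div_nonneg (integral_nonneg fun _ => sq_nonneg _) (sq_nonneg _)) ?_ (by norm_num))
      rw [div_le_div_iff₀ (by positivity) hn', sq, ← mul_assoc]
      exact mul_le_mul_of_nonneg_right (hvar n) hn'.le
    have h0 : Tendsto (fun n : ℕ => ENNReal.ofReal (Real.sqrt (C / n))) atTop (𝓝 0) := by
      have := (tendsto_const_div_atTop_nhds_zero_nat C).sqrt
      rw [Real.sqrt_zero] at this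
      simpa using ENNReal.tendsto_ofReal this
    exact tendsto_of_tendsto_of_tendsto_of_le_of_le' tendsto_const_nhds h0
      (Eventually.of_forall fun _ => zero_le) (eventually_atTop.2 ⟨1, hL⟩)

end average

end Ledger

/-! ### Convergence in distribution from convergence of point probabilities. -/

namespace Ledger

section distribution

variable {Ω : Type*} [MeasurableSpace Ω] {P : Measure Ω} [IsProbabilityMeasure P]

theorem integral_comp_natCast {X : Ω → ℕ} (hX : Measurable X) {φ : ℝ → ℝ} {B : ℝ}
    (hφ : ∀ v, |φ v| ≤ B) :
    HasSum (fun v : ℕ => φ v * P.real {ω | X ω = v}) (∫ ω, φ (X ω) ∂P) := by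
  have hint : Integrable (fun v : ℕ => φ v) (P.map X) :=
    have : IsProbabilityMeasure (P.map X) := Measure.isProbabilityMeasure_map hX.aemeasurable
    Integrable.of_bound (measurable_of_countable _).aestronglyMeasurable B
      (ae_of_all _ fun v => hφ v)
  have h := hasSum_integral_iUnion (μ := P.map X) (f := fun v : ℕ => φ v) (s := fun v : ℕ => {v})
    (fun v => measurableSet_singleton v) (fun i j hij => by simpa using hij)
    hint.integrableOn
  rw [Set.iUnion_of_singleton, setIntegral_univ,
    integral_map hX.aemeasurable (measurable_of_countable _).aestronglyMeasurable] at h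
  have e : (fun v : ℕ => φ v * P.real {ω | X ω = v}) =
      fun v : ℕ => ∫ x in {v}, φ (x : ℕ) ∂(P.map X) := by
    ext v
    rw [Measure.restrict_singleton, integral_smul_measure, integral_dirac, smul_eq_mul, mul_comm,
      Measure.map_apply hX (measurableSet_singleton v)]
    rfl
  rwa [e]

/-- Integer-valued variables with bounded second moments converge in distribution if the
probabilities of all single values converge. -/
theorem convergesInDistribution_of_tendsto_measure {X : ℕ → Ω → ℕ} (hX : ∀ n, Measurable (X n))
    {C : ℝ≥0} (hC : ∀ n, ∫⁻ ω, (X n ω : ℝ≥0∞) ^ 2 ∂P ≤ C) {π : ℕ → ℝ}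
    (hπ : ∀ v, Tendsto (fun n => P.real {ω | X n ω = v}) atTop (𝓝 (π v))) :
    ConvergesInDistribution P fun n ω => (X n ω : ℝ) := by
  -- A summable bound on all point probabilities at once, by Markov's inequality for the square. It
  -- justifies dominated convergence of the sums over `v`.
  set b : ℕ → ℝ := fun v => (if v = 0 then 1 else 0) + C * (1 / (v : ℝ) ^ 2) with hb
  have hbsum : Summable b :=
    (summable_of_ne_finset_zero (s := {0}) (by simp)).add
      ((Real.summable_one_div_nat_pow.2 one_lt_two).mul_left _)
  have hle (n v : ℕ) : P.real {ω | X n ω = v} ≤ b v := by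
    rcases eq_or_ne v 0 with rfl | hv
    · simp [hb]
    · have hv2 : ((v : ℝ≥0∞) ^ 2) ≠ 0 := by positivity
      have h1 : P {ω | X n ω = v} ≤ C / (v : ℝ≥0∞) ^ 2 := by
        refine (measure_mono fun ω (hω : X n ω = v) => ?_).trans
          ((meas_ge_le_lintegral_div (μ := P) (f := fun ω => (X n ω : ℝ≥0∞) ^ 2)
            (ε := (v : ℝ≥0∞) ^ 2) ?_ hv2 (by simp)).trans (by gcongr; exact hC n))
        · simp [hω]
        · exact ((measurable_of_countable fun a : ℕ => (a : ℝ≥0∞) ^ 2).comp (hX n)).aemeasurable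
      have h2 := ENNReal.toReal_mono (ENNReal.div_ne_top ENNReal.coe_ne_top hv2) h1
      simpa [hb, hv, Measure.real, div_eq_mul_inv] using h2
  have hπ0 (v : ℕ) : 0 ≤ π v := ge_of_tendsto' (hπ v) fun _ => measureReal_nonneg
  have hπb (v : ℕ) : π v ≤ b v := le_of_tendsto' (hπ v) fun n => hle n v
  have hlim {φ : ℝ → ℝ} {B : ℝ} (hφ : ∀ v, |φ v| ≤ B) :
      Tendsto (fun n => ∫ ω, φ (X n ω) ∂P) atTop (𝓝 (∑' v : ℕ, φ v * π v)) := by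
    simp_rw [fun n => (integral_comp_natCast (P := P) (hX n) hφ).tsum_eq.symm]
    refine tendsto_tsum_of_dominated_convergence (hbsum.mul_left B)
      (fun v => (hπ v).const_mul _) (Eventually.of_forall fun n v => ?_)
    rw [norm_mul, Real.norm_eq_abs, Real.norm_eq_abs, abs_of_nonneg measureReal_nonneg]
    exact mul_le_mul (hφ _) (hle _ _) measureReal_nonneg ((abs_nonneg _).trans (hφ 0))
  have hπsum : Summable π := Summable.of_nonneg_of_le hπ0 hπb hbsum
  -- Testing with the constant `1` shows that no mass escapes to infinity.
  have hπ1 : ∑' v, π v = 1 := by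
    have h := hlim (φ := fun _ => 1) (B := 1) (by simp)
    simp only [integral_const, probReal_univ, smul_eq_mul, mul_one, one_mul] at h
    exact tendsto_nhds_unique h tendsto_const_nhds
  set ν : Measure ℝ := Measure.sum fun v : ℕ => ENNReal.ofReal (π v) • Measure.dirac (v : ℝ) with hν
  have hνprob : IsProbabilityMeasure ν := ⟨by
    rw [hν, Measure.sum_apply _ MeasurableSet.univ]
    simp only [Measure.smul_apply, measure_univ, smul_eq_mul, mul_one]
    rw [← ENNReal.ofReal_tsum_of_nonneg hπ0 hπsum, hπ1, ENNReal.ofReal_one]⟩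
  have hνint (φ : BoundedContinuousFunction ℝ ℝ) : ∫ x, φ x ∂ν = ∑' v : ℕ, φ v * π v := by
    have h := hasSum_integral_measure (f := φ)
      (μ := fun v : ℕ => ENNReal.ofReal (π v) • Measure.dirac (v : ℝ)) (φ.integrable ν)
    rw [← h.tsum_eq]
    refine tsum_congr fun v => ?_
    rw [integral_smul_measure, integral_dirac, ENNReal.toReal_ofReal (hπ0 v), smul_eq_mul, mul_comm]
  have hmeas (n : ℕ) : Measurable fun ω => (X n ω : ℝ) := measurable_from_nat.comp (hX n)
  refine ⟨ν, hνprob, fun n => (hmeas n).aemeasurable, aemeasurable_id, ?_⟩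
  refine ProbabilityMeasure.tendsto_iff_forall_integral_tendsto.2 fun φ => ?_
  simp only [ProbabilityMeasure.coe_mk, Measure.map_id, hνint]
  refine (hlim fun v => φ.norm_coe_le_norm v).congr fun n => ?_
  exact (integral_map (hmeas n).aemeasurable φ.continuous.aestronglyMeasurable).symm

end distribution

end Ledger

/-! ### A Lyapunov function with bounded second moments. -/

namespace Ledger

theorem natCast_mul_sub_le_pow {x : ℝ≥0} (hx : 1 < x) (m : ℕ) : (m : ℝ≥0) * (x - 1) ≤ x ^ m := by
  rw [← NNReal.coe_le_coe]
  push_cast [NNReal.coe_sub hx.le]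
  have h := one_add_mul_le_pow (a := (x : ℝ) - 1) (by linarith [x.2]) m
  rw [add_sub_cancel] at h
  linarith

section

variable {N k : ℕ}

theorem tips_zero (h : Path N k) : tips 0 h = 1 := by simp [tips, BlockProcess.observerPool]

/-- The Lyapunov function as a finite number. -/
def nnLyapunov (Δ x y B : ℝ≥0) (n : ℕ) (h : Path N k) : ℝ≥0 := x ^ tips n h + B * y ^ age Δ n h

theorem coe_nnLyapunov (Δ x y B : ℝ≥0) (n : ℕ) (h : Path N k) :
    (nnLyapunov Δ x y B n h : ℝ≥0∞) = lyapunov Δ x y B n h := by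
  simp [nnLyapunov, lyapunov]

/-- Squaring the two exponentials squares their bases. The drift for the base `x ^ 2` provides its
own weight `B'`, so the weights have to be compared. -/
theorem nnLyapunov_sq_le (Δ x y B : ℝ≥0) {B' : ℝ≥0} (hB' : 0 < B') (n : ℕ) (h : Path N k) :
    nnLyapunov Δ x y B n h ^ 2 ≤
      (2 + 2 * B ^ 2 / B') * nnLyapunov Δ (x ^ 2) (y ^ 2) B' n h := by
  simp only [nnLyapunov]
  set a := x ^ tips n h with ha
  set b := y ^ age Δ n h with hb
  rw [pow_right_comm x 2, ← ha, pow_right_comm y 2, ← hb]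
  have h1 : 2 * B ^ 2 / B' * (B' * b ^ 2) = 2 * (B * b) ^ 2 := by field_simp
  have h2 : (a + B * b) ^ 2 ≤ 2 * a ^ 2 + 2 * (B * b) ^ 2 := by
    rw [← NNReal.coe_le_coe]
    push_cast
    nlinarith [sq_nonneg ((a : ℝ) - B * b)]
  calc (a + B * b) ^ 2 ≤ 2 * a ^ 2 + 2 * B ^ 2 / B' * (B' * b ^ 2) := by rw [h1]; exact h2
    _ ≤ 2 * (a ^ 2 + B' * b ^ 2) + 2 * B ^ 2 / B' * (a ^ 2 + B' * b ^ 2) := by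
      gcongr
      · exact le_self_add
      · exact le_add_self
    _ = _ := by ring

variable [NeZero N] {ν : Measure (Mark N)} [IsProbabilityMeasure ν] {Δ : ℝ≥0}
  {P : Measure (Path N k)}

theorem isLyapunov_nnLyapunov {x y B γ C : ℝ≥0} (hγ : γ < 1)
    (h : ∀ n j (g : Path N k → ℝ≥0∞), Adapted n g →
      ∫⁻ h, g h * lyapunov Δ x y B (n + (j + 1)) h ∂P ≤
        ∫⁻ h, g h * (γ * lyapunov Δ x y B n h + C) ∂P) :
    IsLyapunov P (nnLyapunov Δ x y B) γ C where
  lt_one := hγ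
  adapted n := by simpa only [coe_nnLyapunov] using adapted_lyapunov Δ x y B n
  lintegral_le n j g hg := by simpa only [coe_nnLyapunov] using h n j g hg

variable [IsProbabilityMeasure P]

theorem IsLyapunov.lintegral_le_add {V : ℕ → Path N k → ℝ≥0} {γ C v₀ : ℝ≥0}
    (hV : IsLyapunov P V γ C) (hV0 : ∀ h, V 0 h ≤ v₀) (n : ℕ) :
    ∫⁻ h, (V n h : ℝ≥0∞) ∂P ≤ (v₀ + C : ℝ≥0) := by
  have h0 (h : Path N k) : (V 0 h : ℝ≥0∞) ≤ v₀ := by exact_mod_cast hV0 h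
  have hγ : (γ : ℝ≥0∞) ≤ 1 := by exact_mod_cast hV.lt_one.le
  rcases n with - | n
  · calc _ ≤ ∫⁻ h : Path N k, (v₀ + C : ℝ≥0) ∂P := by
          refine lintegral_mono fun h => (h0 h).trans ?_
          exact_mod_cast le_self_add
      _ = _ := by simp
  · have := hV.lintegral_le 0 n (fun _ => 1) (Adapted.const 1)
    simp only [one_mul, zero_add] at this
    refine this.trans ?_
    calc _ ≤ ∫⁻ h : Path N k, (v₀ + C : ℝ≥0) ∂P := by
          refine lintegral_mono fun h => ?_
          push_cast
          gcongr
          exact (mul_le_of_le_one_left' hγ).trans (h0 h)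
      _ = _ := by simp

theorem exists_isLyapunov (hk : 2 ≤ k) (hν : Memoryless ν Δ) (hP : IsLaw ν P) :
    ∃ (V : ℕ → Path N k → ℝ≥0) (γ C v₀ K : ℝ≥0) (M : ℕ), IsLyapunov P V γ C ∧ 1 ≤ M ∧
      (∀ n h, M < tips n h → (4 * C + 2) / (1 - γ) ≤ V n h) ∧ (∀ n h, 1 ≤ V n h) ∧
      (∀ h, V 0 h ≤ v₀) ∧ (∀ n, ∫⁻ h, (V n h : ℝ≥0∞) ^ 2 ∂P ≤ K) ∧
      (∀ n h, (tips n h : ℝ≥0) ≤ K * V n h) ∧ ∀ n h, (age Δ n h : ℝ≥0) ≤ K * V n h := by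
  obtain ⟨x, hx, hx3, hxν⟩ := exists_base hν (16 * k + 2)
  set q := 16 * k + 2 with hq
  have hxx : x ≤ x ^ 2 := le_self_pow hx.le two_ne_zero
  have hxν' : ν {z | (Δ : ℝ) < z.1}ᶜ * (x : ℝ≥0∞) ^ q < 1 := by
    refine lt_of_le_of_lt ?_ hxν
    gcongr
  obtain ⟨B, γ, C, hB, hγ, hstep⟩ :=
    exists_lintegral_lyapunov_le hk hν hP hx (hxx.trans_lt hx3) hxν'
  obtain ⟨B', γ', C', hB', hγ', hstep'⟩ :=
    exists_lintegral_lyapunov_le hk hν hP (one_lt_pow₀ hx two_ne_zero) hx3 hxν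
  have hV := isLyapunov_nnLyapunov hγ hstep
  have hV' := isLyapunov_nnLyapunov hγ' hstep'
  have hy : 1 < x ^ q := one_lt_pow₀ hx (by omega)
  have hzero (x y B : ℝ≥0) (h : Path N k) : nnLyapunov Δ x y B 0 h ≤ x + B := by
    simp [nnLyapunov, tips_zero, age]
  -- More than `M` tips alone push the function above the threshold required by
  -- `exists_contraction_const`.
  obtain ⟨M, hM⟩ := pow_unbounded_of_one_lt ((4 * C + 2) / (1 - γ)) hx
  have hδ : 0 < x - 1 := tsub_pos_of_lt hx
  have hδ' : 0 < x ^ q - 1 := tsub_pos_of_lt hy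
  set K₀ := (2 + 2 * B ^ 2 / B') * (x ^ 2 + B' + C') with hK₀
  refine ⟨nnLyapunov Δ x (x ^ q) B, γ, C, x + B, K₀ + (x - 1)⁻¹ + (B * (x ^ q - 1))⁻¹, M + 1, hV,
    by omega, fun n h hn => ?_, fun n h => ?_, hzero _ _ _, fun n => ?_,
    fun n h => ?_, fun n h => ?_⟩
  · calc (4 * C + 2) / (1 - γ) ≤ x ^ M := hM.le
      _ ≤ x ^ tips n h := pow_le_pow_right₀ hx.le (by omega)
      _ ≤ _ := le_self_add
  · exact (one_le_pow₀ hx.le).trans le_self_add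
  · calc ∫⁻ h, (nnLyapunov Δ x (x ^ q) B n h : ℝ≥0∞) ^ 2 ∂P
        ≤ ∫⁻ h, ((2 + 2 * B ^ 2 / B' : ℝ≥0) : ℝ≥0∞) *
          (nnLyapunov Δ (x ^ 2) ((x ^ 2) ^ q) B' n h : ℝ≥0∞) ∂P := by
          refine lintegral_mono fun h => ?_
          have := nnLyapunov_sq_le Δ x (x ^ q) B hB' n h
          rw [pow_right_comm x q 2] at this
          norm_cast
          exact ENNReal.coe_le_coe.2 this
      _ = ((2 + 2 * B ^ 2 / B' : ℝ≥0) : ℝ≥0∞) *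
          ∫⁻ h, (nnLyapunov Δ (x ^ 2) ((x ^ 2) ^ q) B' n h : ℝ≥0∞) ∂P :=
          lintegral_const_mul _ (hV'.measurable_coe n)
      _ ≤ ((2 + 2 * B ^ 2 / B' : ℝ≥0) : ℝ≥0∞) * ((x ^ 2 + B' + C' : ℝ≥0) : ℝ≥0∞) := by
          gcongr
          exact hV'.lintegral_le_add (hzero _ _ _) n
      _ ≤ _ := by
          rw [← ENNReal.coe_mul, ← hK₀]
          exact_mod_cast le_self_add.trans le_self_add
  · have h1 := natCast_mul_sub_le_pow hx (tips n h)
    calc (tips n h : ℝ≥0) = (x - 1)⁻¹ * (tips n h * (x - 1)) := by field_simp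
      _ ≤ _ := by
        gcongr
        · exact le_add_self.trans le_self_add
        · exact h1.trans le_self_add
  · have h1 := natCast_mul_sub_le_pow hy (age Δ n h)
    calc (age Δ n h : ℝ≥0) = (B * (x ^ q - 1))⁻¹ * (B * (age Δ n h * (x ^ q - 1))) := by field_simp
      _ ≤ _ := by
        gcongr
        · exact le_add_self
        · exact (mul_le_mul_right h1 B).trans le_add_self

end

end Ledger

/-! ### Limit theorems for integer-valued observables. -/

namespace Ledger

theorem abs_toReal_sub_toReal_le {a b : ℝ≥0∞} {e : ℝ≥0} (ha : a ≠ ⊤) (hb : b ≠ ⊤)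
    (h1 : a ≤ b + e) (h2 : b ≤ a + e) : |a.toReal - b.toReal| ≤ e := by
  lift a to ℝ≥0 using ha
  lift b to ℝ≥0 using hb
  have h1' : a ≤ b + e := by exact_mod_cast h1
  have h2' : b ≤ a + e := by exact_mod_cast h2
  rw [← NNReal.coe_le_coe, NNReal.coe_add] at h1' h2'
  rw [ENNReal.coe_toReal, ENNReal.coe_toReal, abs_sub_le_iff]
  constructor <;> linarith

theorem integral_natCast {Ω : Type*} [MeasurableSpace Ω] {P : Measure Ω} {u : Ω → ℕ}
    (hu : Measurable u) : ∫ ω, (u ω : ℝ) ∂P = (∫⁻ ω, (u ω : ℝ≥0∞) ∂P).toReal := by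
  have hm : Measurable fun ω => (u ω : ℝ≥0∞) := measurable_from_nat.comp hu
  rw [← integral_toReal hm.aemeasurable (ae_of_all _ fun ω => by simp)]
  simp

variable {N k : ℕ} [NeZero N] {ν : Measure (Mark N)} [IsProbabilityMeasure ν] {Δ : ℝ≥0}
  {P : Measure (Path N k)} [IsProbabilityMeasure P]

/-- Mixing is used three times: with weight `1` for the convergence of means, with weight `X n` for
covariances, and with weight `1` on indicators of single values for convergence in distribution. -/
theorem converge_of_observable (hk : 2 ≤ k) (hν : Memoryless ν Δ) (hP : IsLaw ν P)
    {X : ℕ → Path N k → ℕ} (hX : ∀ φ : ℕ → ℝ≥0∞, Observable Δ fun n h => φ (X n h))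
    (hmeas : ∀ n, Measurable (X n))
    (hle : ∀ n h, Valid Δ n h → X n h ≤ tips n h + k * age Δ n h) :
    (∃ c, TimeAveragesConverge P (fun n h => (X n h : ℝ)) c) ∧
      ConvergesInDistribution P fun n h => (X n h : ℝ) := by
  obtain ⟨V, γ, C, v₀, K, M, hV, hM, hlarge, hV1, hV0, hV2, htips, hage⟩ :=
    exists_isLyapunov hk hν hP
  obtain ⟨A, ρ, hρ, hmix⟩ := hV.exists_mixing hν hP hk hM hlarge hV1 hV0
  have hρ' : (ρ : ℝ) < 1 := by exact_mod_cast hρ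
  set L : ℝ≥0 := K + k * K with hL
  have hXV (n : ℕ) (h : Path N k) (hv : Valid Δ n h) : (X n h : ℝ≥0∞) ≤ L * V n h := by
    have h1 : (X n h : ℝ≥0) ≤ L * V n h := by
      calc (X n h : ℝ≥0) ≤ tips n h + k * age Δ n h := by exact_mod_cast hle n h hv
        _ ≤ K * V n h + k * (K * V n h) := by
          gcongr
          · exact htips n h
          · exact hage n h
        _ = _ := by rw [hL]; ring
    exact_mod_cast h1
  have hvalid := ae_valid hν hP
  have hVint (n : ℕ) : ∫⁻ h, (V n h : ℝ≥0∞) ∂P ≤ K :=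
    (lintegral_mono fun h => by
      have : V n h ≤ V n h ^ 2 := le_self_pow (hV1 n h) two_ne_zero
      norm_cast
      exact ENNReal.coe_le_coe.2 this).trans (hV2 n)
  have hXint2 (n : ℕ) : ∫⁻ h, (X n h : ℝ≥0∞) ^ 2 ∂P ≤ (L ^ 2 * K : ℝ≥0) := by
    calc ∫⁻ h, (X n h : ℝ≥0∞) ^ 2 ∂P ≤ ∫⁻ h, (L ^ 2 : ℝ≥0) * (V n h : ℝ≥0∞) ^ 2 ∂P := by
          refine lintegral_mono_ae ?_
          filter_upwards [hvalid] with h hh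
          rw [ENNReal.coe_pow, ← mul_pow]
          gcongr
          exact hXV n h (hh n)
      _ = (L ^ 2 : ℝ≥0) * ∫⁻ h, (V n h : ℝ≥0∞) ^ 2 ∂P :=
          lintegral_const_mul _ ((hV.measurable_coe n).pow_const 2)
      _ ≤ _ := by
          rw [ENNReal.coe_mul]
          gcongr
          exact hV2 n
  have hXm (n : ℕ) : Measurable fun h => (X n h : ℝ≥0∞) := measurable_from_nat.comp (hmeas n)
  have hXint (n : ℕ) : ∫⁻ h, (X n h : ℝ≥0∞) ∂P ≠ ⊤ := by
    refine ne_top_of_le_ne_top ENNReal.coe_ne_top ((lintegral_mono fun h => ?_).trans (hXint2 n))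
    norm_cast
    exact (Nat.cast_le (α := ℝ≥0∞)).2 (Nat.le_self_pow two_ne_zero (X n h))
  have hmean {f : ℕ → Path N k → ℝ≥0∞} {C₀ : ℝ≥0} (hf : Observable Δ f)
      (hfV : ∀ n h, Valid Δ n h → f n h ≤ C₀ * V n h) :
      ∃ c, Tendsto (fun n => (∫⁻ h, f n h ∂P).toReal) atTop (𝓝 c) ∧
        ∀ m, |(∫⁻ h, f m h ∂P).toReal - c| ≤ (C₀ * A * K : ℝ≥0) * (ρ : ℝ) ^ m := by
    have hfin (n : ℕ) : ∫⁻ h, f n h ∂P ≠ ⊤ := by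
      refine ne_top_of_le_ne_top (b := C₀ * (K : ℝ≥0∞)) (by finiteness) ?_
      calc ∫⁻ h, f n h ∂P ≤ ∫⁻ h, C₀ * (V n h : ℝ≥0∞) ∂P := by
            refine lintegral_mono_ae ?_
            filter_upwards [hvalid] with h hh
            exact hfV n h (hh n)
        _ = C₀ * ∫⁻ h, (V n h : ℝ≥0∞) ∂P := lintegral_const_mul _ (hV.measurable_coe n)
        _ ≤ _ := by gcongr; exact hVint n
    refine exists_limit_of_geometric ρ.coe_nonneg hρ' fun n m => ?_
    obtain ⟨h1, h2⟩ := hmix f C₀ hf hfV n m (fun _ => 1) (Adapted.const 1) (by simp)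
    simp only [one_mul, lintegral_one, measure_univ] at h1 h2
    have herr : (C₀ : ℝ≥0∞) * A * ρ ^ m * ∫⁻ h, (V n h : ℝ≥0∞) ∂P ≤
        ((C₀ * A * K * ρ ^ m : ℝ≥0) : ℝ≥0∞) := by
      calc _ ≤ (C₀ : ℝ≥0∞) * A * ρ ^ m * K := by gcongr; exact hVint n
        _ = _ := by push_cast; ring
    have := abs_toReal_sub_toReal_le (hfin (n + m)) (hfin m) (h1.trans (add_le_add le_rfl herr))
      (h2.trans (add_le_add le_rfl herr))
    simpa using this
  constructor
  · obtain ⟨c, -, hc⟩ := hmean (hX fun v => (v : ℝ≥0∞)) hXV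
    refine ⟨c, ?_⟩
    set E : ℕ → ℝ := fun n => (∫⁻ h, (X n h : ℝ≥0∞) ∂P).toReal with hE
    have hMem (n : ℕ) : MemLp (fun h => (X n h : ℝ)) 2 P := by
      have hm : Measurable fun h => (X n h : ℝ) := measurable_from_nat.comp (hmeas n)
      refine (memLp_two_iff_integrable_sq hm.aestronglyMeasurable).2 ?_
      have := integrable_toReal_of_lintegral_ne_top ((hXm n).pow_const 2).aemeasurable
        (ne_top_of_le_ne_top ENNReal.coe_ne_top (hXint2 n))
      simpa using this
    have hEle (n : ℕ) : |E n| ≤ |c| + (L * A * K : ℝ≥0) := by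
      have h1 : E n = c + (E n - c) := by ring
      have h2 : (ρ : ℝ) ^ n ≤ 1 := pow_le_one₀ ρ.coe_nonneg hρ'.le
      rw [h1]
      refine (abs_add_le _ _).trans (add_le_add le_rfl ((hc n).trans ?_))
      exact mul_le_of_le_one_right (NNReal.coe_nonneg _) h2
    set B : ℝ := L * A * (L * K) + (|c| + (L * A * K : ℝ≥0)) * (L * A * K : ℝ≥0) +
      |c| * (L * A * K : ℝ≥0) with hB
    refine timeAveragesConverge_of_cov (K := B) hMem (fun n h => Nat.cast_nonneg _) ρ.coe_nonneg hρ'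
      fun n m => ?_
    have hint (n : ℕ) : Integrable (fun h => (X n h : ℝ)) P := (hMem n).integrable one_le_two
    have hintmul : Integrable (fun h => (X n h : ℝ) * X (n + m) h) P :=
      (hMem n).integrable_mul (hMem (n + m))
    have hEint (n : ℕ) : ∫ h, (X n h : ℝ) ∂P = E n := integral_natCast (hmeas n)
    set F : ℝ := ∫ h, (X n h : ℝ) * X (n + m) h ∂P with hF
    have hF' : F = (∫⁻ h, (X n h : ℝ≥0∞) * X (n + m) h ∂P).toReal := by
      have := integral_natCast (P := P) ((hmeas n).mul (hmeas (n + m)))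
      simpa using this
    have hFE : |F - E n * E m| ≤ L * A * (L * K) * (ρ : ℝ) ^ m := by
      obtain ⟨h1, h2⟩ := hmix _ L (hX fun v => (v : ℝ≥0∞)) hXV n m (fun h => (X n h : ℝ≥0∞))
        ((hX fun v => (v : ℝ≥0∞)).adapted n) (hXint n)
      have herr : (L : ℝ≥0∞) * A * ρ ^ m * ∫⁻ h, (X n h : ℝ≥0∞) * V n h ∂P ≤
          ((L * A * (L * K) * ρ ^ m : ℝ≥0) : ℝ≥0∞) := by
        calc _ ≤ (L : ℝ≥0∞) * A * ρ ^ m * ∫⁻ h, L * (V n h : ℝ≥0∞) ^ 2 ∂P := by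
              refine mul_le_mul_right (lintegral_mono_ae ?_) _
              filter_upwards [hvalid] with h hh
              rw [sq, ← mul_assoc]
              gcongr
              exact hXV n h (hh n)
          _ = (L : ℝ≥0∞) * A * ρ ^ m * (L * ∫⁻ h, (V n h : ℝ≥0∞) ^ 2 ∂P) := by
              rw [lintegral_const_mul _ ((hV.measurable_coe n).pow_const 2)]
          _ ≤ (L : ℝ≥0∞) * A * ρ ^ m * (L * K) := by gcongr; exact hV2 n
          _ = _ := by push_cast; ring
      have hfin : (∫⁻ h, (X n h : ℝ≥0∞) ∂P) * ∫⁻ h, (X m h : ℝ≥0∞) ∂P ≠ ⊤ :=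
        ENNReal.mul_ne_top (hXint n) (hXint m)
      have := abs_toReal_sub_toReal_le
        (ne_top_of_le_ne_top (by finiteness) (h1.trans (add_le_add le_rfl herr))) hfin (h1.trans (add_le_add le_rfl herr)) (h2.trans (add_le_add le_rfl herr))
      rw [ENNReal.toReal_mul, ← hF'] at this
      simpa using this
    have hcov : ∫ h, ((X n h : ℝ) - c) * ((X (n + m) h : ℝ) - c) ∂P =
        F - c * E n - c * E (n + m) + c ^ 2 := by
      have e : ∀ h, ((X n h : ℝ) - c) * ((X (n + m) h : ℝ) - c) =
          (X n h : ℝ) * X (n + m) h - c * X n h - c * X (n + m) h + c ^ 2 := fun h => by ring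
      have i1 := (hint n).const_mul c
      have i2 := (hint (n + m)).const_mul c
      have i3 : Integrable (fun h => (X n h : ℝ) * X (n + m) h - c * X n h) P := hintmul.sub i1
      have i4 : Integrable (fun h => (X n h : ℝ) * X (n + m) h - c * X n h - c * X (n + m) h) P :=
        i3.sub i2
      simp_rw [e]
      rw [integral_add i4 (integrable_const _), integral_sub i3 i2, integral_sub hintmul i1,
        integral_const_mul, integral_const_mul, hEint, hEint, ← hF]
      simp
    -- The variables are centered at the limit `c` and not at their means, so the errors `E m - c`
    -- and `E (n + m) - c` join the mixing error; all three decay like `ρ ^ m`.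
    have hdec : F - c * E n - c * E (n + m) + c ^ 2 =
        (F - E n * E m) + E n * (E m - c) + -c * (E (n + m) - c) := by ring
    have hpow : (ρ : ℝ) ^ (n + m) ≤ (ρ : ℝ) ^ m :=
      pow_le_pow_of_le_one ρ.coe_nonneg hρ'.le (by omega)
    rw [hcov, hdec]
    calc _ ≤ |F - E n * E m| + |E n| * |E m - c| + |c| * |E (n + m) - c| := by
          refine (abs_add_le _ _).trans ?_
          rw [abs_mul (-c), abs_neg, ← abs_mul (E n)]
          gcongr
          exact abs_add_le _ _
      _ ≤ L * A * (L * K) * (ρ : ℝ) ^ m + (|c| + (L * A * K : ℝ≥0)) *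
          ((L * A * K : ℝ≥0) * (ρ : ℝ) ^ m) + |c| * ((L * A * K : ℝ≥0) * (ρ : ℝ) ^ m) := by
          gcongr
          · exact hEle n
          · exact hc m
          · exact (hc (n + m)).trans (by gcongr)
      _ = _ := by rw [hB]; ring
  · have hlim (v : ℕ) : ∃ p, Tendsto (fun n => P.real {h | X n h = v}) atTop (𝓝 p) := by
      -- Indicators are dominated with constant `1` because the Lyapunov function is at least `1`.
      obtain ⟨p, hp, -⟩ := hmean (C₀ := 1) (hX (Set.indicator {v} fun _ => 1)) fun n h _ => by
        have h1 : (1 : ℝ≥0∞) ≤ V n h := by exact_mod_cast hV1 n h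
        rw [ENNReal.coe_one, one_mul]
        exact (Set.indicator_le_self' (fun _ _ => zero_le) _).trans h1
      refine ⟨p, hp.congr fun n => ?_⟩
      have : ∫⁻ h, Set.indicator {v} (fun _ => 1) (X n h) ∂P = P {h | X n h = v} :=
        lintegral_indicator_one (hmeas n (measurableSet_singleton v))
      rw [this, Measure.real]
    choose p hp using hlim
    exact convergesInDistribution_of_tendsto_measure hmeas hXint2 hp

end Ledger

/-! ### Transfer from path space to the original probability space. -/

namespace Ledger

section map

variable {Ω Ω' : Type*} [MeasurableSpace Ω] [MeasurableSpace Ω'] {P : Measure Ω} {T : Ω → Ω'}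
  {X : ℕ → Ω' → ℝ}

theorem TimeAveragesConverge.of_map (hT : Measurable T) {c : ℝ}
    (h : TimeAveragesConverge (P.map T) X c) : TimeAveragesConverge P (fun n ω => X n (T ω)) c := by
  obtain ⟨h1, h2, h3⟩ := h
  refine ⟨ae_of_ae_map hT.aemeasurable h1, fun n => (h2 n).comp_of_map hT.aemeasurable, ?_⟩
  refine h3.congr fun n => ?_
  exact eLpNorm_map_measure ((h2 n).aestronglyMeasurable.sub aestronglyMeasurable_const)
    hT.aemeasurable

theorem ConvergesInDistribution.of_map [IsProbabilityMeasure P] [IsProbabilityMeasure (P.map T)]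
    (hT : Measurable T) (hX : ∀ n, Measurable (X n)) (h : ConvergesInDistribution (P.map T) X) :
    ConvergesInDistribution P fun n ω => X n (T ω) := by
  obtain ⟨ν, hν, h⟩ := h
  refine ⟨ν, hν, fun n => ((hX n).comp hT).aemeasurable, aemeasurable_id, ?_⟩
  refine h.tendsto.congr fun n => Subtype.ext ?_
  exact Measure.map_map (hX n) hT

end map

/-- The sizes of the tip pools obey a law of large numbers and converge in distribution. -/
theorem IsBlockProcess.converge {Ω : Type*} [MeasurableSpace Ω] {P : Measure Ω}
    [IsProbabilityMeasure P] {N k : ℕ} {rate : Fin N → ℝ≥0} {D : Fin N → Measure (Fin N → ℝ≥0)}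
    {ξ : BlockProcess Ω N k} (hξ : IsBlockProcess ξ P rate D) (hk : 2 ≤ k)
    (hrate : 0 < ∑ i, rate i) (hD : IsDelayLaw D) (hsync : PartiallySynchronous D) :
    (∃ (μo : ℝ) (μ : Fin N → ℝ),
      TimeAveragesConverge P ξ.observerSize μo ∧
      ∀ i, TimeAveragesConverge P (ξ.localSize i) (μ i)) ∧
    ConvergesInDistribution P ξ.observerSize ∧
    ∀ i, ConvergesInDistribution P (ξ.localSize i) := by
  -- A positive total rate forces a node to exist; `trunc` needs one as its default issuer.
  have : NeZero N := ⟨by rintro rfl; simp at hrate⟩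
  have : ∀ i, IsProbabilityMeasure (D i) := hD.isProbabilityMeasure
  have : IsProbabilityMeasure (markLaw rate D) := hξ.isProbabilityMeasure_markLaw
  obtain ⟨Δ, hΔ⟩ := hsync
  have hν := memoryless_markLaw hrate hΔ
  have hT : Measurable ξ.path := hξ.measurable_path
  have hP : IsLaw (markLaw rate D) (P.map ξ.path) := hξ.isLaw_map_path
  have : IsProbabilityMeasure (P.map ξ.path) := Measure.isProbabilityMeasure_map hT.aemeasurable
  have ho : ξ.observerSize = fun n ω => (tips n (ξ.path ω) : ℝ) := by
    ext n ω
    rw [tips, BlockProcess.observerPool_path]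
    rfl
  have hl (i : Fin N) : ξ.localSize i = fun n ω => (localTips i n (ξ.path ω) : ℝ) := by
    ext n ω
    rw [localTips, BlockProcess.localPool_path ξ hξ.time_zero]
    rfl
  obtain ⟨⟨μo, hμo⟩, hdo⟩ := converge_of_observable hk hν hP (observable_tips Δ) measurable_tips
    fun n h _ => Nat.le_add_right _ _
  have hloc (i : Fin N) := converge_of_observable hk hν hP (observable_localTips Δ i)
    (measurable_localTips i) fun n h hv => localTips_le hv i
  choose μ hμ using fun i => (hloc i).1
  rw [ho]
  simp only [hl]
  exact ⟨⟨μo, μ, hμo.of_map hT, fun i => (hμ i).of_map hT⟩,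
    hdo.of_map hT fun n => measurable_from_nat.comp (measurable_tips n),
    fun i => (hloc i).2.of_map hT fun n => measurable_from_nat.comp (measurable_localTips i n)⟩

end Ledger

end

theorem theorem4 {Ω : Type*} [MeasurableSpace Ω] (P : Measure Ω) [IsProbabilityMeasure P]
    (N k : ℕ) (hk : 2 ≤ k)
    (rate : Fin N → ℝ≥0) (hrate : 0 < ∑ i, rate i)
    (D : Fin N → Measure (Fin N → ℝ≥0)) (hD : Ledger.IsDelayLaw D)
    (hsync : Ledger.PartiallySynchronous D)
    (ξ : Ledger.BlockProcess Ω N k) (hξ : Ledger.IsBlockProcess ξ P rate D) :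
    (∃ (μo : ℝ) (μ : Fin N → ℝ),
      Ledger.TimeAveragesConverge P ξ.observerSize μo ∧
      ∀ i, Ledger.TimeAveragesConverge P (ξ.localSize i) (μ i)) ∧
    Ledger.ConvergesInDistribution P ξ.observerSize ∧
    ∀ i, Ledger.ConvergesInDistribution P (ξ.localSize i) :=
  hξ.converge hk hrate hD hsync
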